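/- **Setting.** Let $d\ge 1$ and let $\Gamma$ be the set of locally finite subsets of $\mathbb R^d$, with the $\sigma$-algebra generated by the counts $\eta\mapsto\#(\eta\cap\Delta)$, $\Delta$ bounded Borel; let $\Gamma_0\subset\Gamma$ be the finite configurations. Let $H:\Gamma_0\to\mathbb R\cup\{\infty\}$ be a measurable, translation-invariant, stable Hamiltonian ($H(\eta)\ge -B\,\#\eta$ for some $B>0$) with $H(\emptyset)=0$, $H(\{x\})=0$, and $H(\eta)=\infty$ whenever $H(\gamma)=\infty$ for some $\gamma\subset\eta$. The interaction energy of finite configurations is given by $H(\gamma\cup\eta)=H(\gamma)+W(\gamma\mid\eta)+H(\eta)$ (with $W=\infty$ if $H(\gamma)=\infty$ or $H(\eta)=\infty$), and for infinite $\eta$ it is the limit of $W(\gamma\mid\eta\cap B)$ along growing balls $B$. A probability measure $\mathsf P$ on $\Gamma$ is a $(\mu,H)$-Gibbs measure, $\mu\in\mathbb R$, if it is supported on configurations all of whose finite parts have finite energy and on a set of tempered configurations (a set closed under adding finitely many points, on which, for every finite $\gamma$ disjoint from $\eta$, the above limit exists in $\mathbb R\cup\{\infty\}$ and does not depend on the centre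 of the balls), and if for all measurable $G\ge 0$ $$\int_\Gamma\sum_{x\in\eta}G(x,\eta)\,d\mathsf P(\eta)=\int_{\mathbb R^d}\int_\Gamma G(x,\{x\}\cup\eta)\,e^{\mu-W(\{x\}\mid\eta)}\,d\mathsf P(\eta)\,dx .$$ For a set $\boldsymbol x_n=\{x_1,\dots,x_n\}$ of $n$ points, its correlation functions and Janossy densities ($\Lambda$ bounded Borel) are $$\rho^{(n)}(\boldsymbol x_n)=\int_\Gamma e^{n\mu-H(\boldsymbol x_n)-W(\boldsymbol x_n\mid\eta)}\,d\mathsf P(\eta),\qquad j^{(n)}_\Lambda(\boldsymbol x_n)=\int_{\{\eta\cap\Lambda=\emptyset\}} e^{n\mu-H(\boldsymbol x_n)-W(\boldsymbol x_n\mid\eta)}\,d\mathsf P(\eta).$$ For functions $\Psi,\Phi$ on $\Gamma_0$ write $\Psi^{(k)}(y_1,\dots,y_k)=\Psi(\{y_1,\dots,y_k\})$, $(\Psi*\Phi)(\eta)=\sum_{\gamma\subset\eta}\Psi(\gamma)\Phi(\eta\setminus\gamma)$, $\mathbb 1(\eta)=1$ if $\eta=\emptyset$ and $0$ otherwise, $\exp^*\Psi=\mathbb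 1+\sum_{n\ge1}\frac1{n!}\Psi^{*n}$, and $(D_\gamma\Psi)(\eta)=\Psi(\eta\cup\gamma)$ if $\eta\cap\gamma=\emptyset$, $0$ otherwise. The truncated correlation functions $\rho_T$ are given recursively by $\rho=\exp^*\rho_T$, $\rho_T(\emptyset)=0$. **Theorem.** Let $M,A,r>0$ and $d(r)\in\mathbb R$. There is $D_0>0$ such that the following holds for every $\mu\in\mathbb R$, every $H$ as above and every translation-invariant $(\mu,H)$-Gibbs measure $\mathsf P$ which satisfies a Ruelle bound ($\rho^{(n)}\le\xi^n$ for all $n\ge1$, for some $\xi>0$) and, for some $0<D_\rho\le D_0$, the assumptions * (A) for $n=1,2$ and every bounded $\Delta\subset\mathbb R^d$, $\displaystyle\lim_{\Lambda\nearrow\mathbb R^d}\ \sup_{\boldsymbol x_n\subset\Delta}\Big|\frac{j^{(n)}_\Lambda(\boldsymbol x_n)}{j^{(0)}_\Lambda}-e^{n\mu-H(\boldsymbol x_n)}\Big|=0$ (it suffices that $\Lambda$ runs through some increasing sequence of bounded Borel sets with union $\mathbb R^d$); * (B) for $m=1,2$, all $k\ge1$, all Borel $\Lambda\subset\mathbb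 R^d$ and all sets $\boldsymbol x_m$ of $m$ points, $\displaystyle\int_{\Lambda^k}|\rho_T^{(m+k)}(\boldsymbol x_m,\boldsymbol y_k)|\,d\boldsymbol y_k\le (m+k-1)!\,M A^m D_\rho^k\prod_{i=1}^m\rho^{(1)}(x_i)$; * (C) $\rho^{(1)}>0$, and $\rho^{(1)}(x_1)\rho^{(1)}(x_2)\le d(r)\,\rho^{(2)}(x_1,x_2)$ whenever $|x_1-x_2|\ge r$. The density $\rho^{(1)}\equiv\rho$ is constant; there are families $\omega_x$, $x\in\mathbb R^d$, and $\omega_{x_1,x_2}$, $|x_1-x_2|\ge r$, of functions on $\Gamma_0$ that vanish at $\emptyset$ and are recursively defined such that $$\frac{D_{\{x\}}\rho_T}{\rho^{(1)}(x)}=\exp^*\omega_x,\qquad \frac{D_{\{x_1,x_2\}}\rho_T}{\rho^{(2)}(x_1,x_2)}=\Big(\exp^*\omega_{x_1,x_2}-\frac{\rho^{(1)}(x_1)\rho^{(1)}(x_2)}{\rho^{(2)}(x_1,x_2)}\mathbb 1\Big)*\frac{D_{\{x_1\}}\rho_T}{\rho^{(1)}(x_1)}*\frac{D_{\{x_2\}}\rho_T}{\rho^{(1)}(x_2)};$$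 and, with all integrals and series absolutely convergent, $$\mu=\log\rho+\sum_{k=1}^\infty\frac{(-1)^k}{k!}\int_{(\mathbb R^d)^k}\omega^{(k)}_0(\boldsymbol y_k)\,d\boldsymbol y_k ,$$ and, for all $x_1,x_2$ with $|x_1-x_2|\ge r$, $$H(\{x_1,x_2\})=-\log\Big(\frac{\rho^{(2)}(x_1,x_2)}{\rho^2}\Big)-\sum_{k=1}^\infty\frac{(-1)^k}{k!}\int_{(\mathbb R^d)^k}\omega^{(k)}_{x_1,x_2}(\boldsymbol y_k)\,d\boldsymbol y_k .$$ -/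

import Mathlib

open MeasureTheory Filter Topology
open scoped ENNReal Classical

noncomputable section

namespace InverseGibbs

/-- The space `ℝ^d` with its Euclidean norm. -/
abbrev Space (d : ℕ) : Type := EuclideanSpace ℝ (Fin d)

/-! ### Configurations and point processes -/

/-- The set `Γ` of locally finite configurations in `ℝ^d`. -/
def Configuration (d : ℕ) : Type :=
  {η : Set (Space d) // ∀ Δ : Set (Space d), Bornology.IsBounded Δ → (η ∩ Δ).Finite}

/-- The σ-algebra on `Γ` generated by the events `{N(· ∩ Δ) = m}`, `Δ` bounded Borel. -/
instance Configuration.instMeasurableSpace (d : ℕ) : MeasurableSpace (Configuration d) :=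
  MeasurableSpace.generateFrom
    {S | ∃ (Δ : Set (Space d)) (m : ℕ), Bornology.IsBounded Δ ∧ MeasurableSet Δ ∧
      S = {η : Configuration d | (η.1 ∩ Δ).ncard = m}}

/-- A finite set of points, seen as a configuration. -/
def Configuration.ofFinset {d : ℕ} (x : Finset (Space d)) : Configuration d :=
  ⟨(x : Set (Space d)), fun _ _ => x.finite_toSet.inter_of_left _⟩

/-- The configuration `η ∪ x` for a finite set of points `x`. -/
def Configuration.addPoints {d : ℕ} (η : Configuration d) (x : Finset (Space d)) :
    Configuration d :=
  ⟨η.1 ∪ (x : Set (Space d)), fun Δ hΔ => by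
    rw [Set.union_inter_distrib_right]
    exact (η.2 Δ hΔ).union (x.finite_toSet.inter_of_left _)⟩

/-- The translated configuration `η + a`. -/
def Configuration.translate {d : ℕ} (a : Space d) (η : Configuration d) : Configuration d :=
  ⟨(fun y => y + a) '' η.1, fun Δ hΔ => by
    have hb : Bornology.IsBounded ((fun y => y + -a) '' Δ) := by
      obtain ⟨C, hC⟩ := isBounded_iff_forall_norm_le.1 hΔ
      refine isBounded_iff_forall_norm_le.2 ⟨C + ‖-a‖, ?_⟩
      rintro _ ⟨y, hy, rfl⟩
      exact (norm_add_le _ _).trans (add_le_add (hC y hy) le_rfl)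
    refine ((η.2 _ hb).image (fun y => y + a)).subset ?_
    rintro _ ⟨⟨y, hy, rfl⟩, hyΔ⟩
    exact ⟨y, ⟨hy, ⟨y + a, hyΔ, by simp⟩⟩, rfl⟩⟩

/-- The finitely many points of `η` in the closed ball with centre `a` and radius `R`. -/
def Configuration.inBall {d : ℕ} (η : Configuration d) (a : Space d) (R : ℝ) :
    Finset (Space d) :=
  (η.2 (Metric.closedBall a R) Metric.isBounded_closedBall).toFinset

/-- A point process is translation invariant if its law is invariant under all translations. -/
def TranslationInvariant {d : ℕ} (P : Measure (Configuration d)) : Prop :=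
  ∀ (a : Space d) (S : Set (Configuration d)), MeasurableSet S →
    P (Configuration.translate a ⁻¹' S) = P S

/-! ### Hamiltonians, interaction energy and Gibbs measures -/

/-- A translation-invariant stable Hamiltonian `H : Γ₀ → ℝ ∪ {∞}`; the value `-∞` of `EReal` is
excluded by stability. The energy of the empty configuration is zero, and so is the energy of a
single point (the one-body part of the energy is carried by the chemical potential).
`hereditary` expresses that `H(η' ∪ η) = H(η') + W(η' ∣ η) + H(η)` with `W > -∞`. -/
structure IsHamiltonian {d : ℕ} (H : Finset (Space d) → EReal) : Prop where
  /-- `H` is measurable for the trace on `Γ₀` of the σ-algebra of `Γ`. -/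
  measurable : Measurable[MeasurableSpace.comap Configuration.ofFinset inferInstance] H
  empty : H ∅ = 0
  singleton : ∀ x : Space d, H {x} = 0
  hereditary : ∀ x y : Finset (Space d), x ⊆ y → H x = ⊤ → H y = ⊤
  translate : ∀ (a : Space d) (x : Finset (Space d)), H (x.image fun y => y + a) = H x
  stable : ∃ B : ℝ, 0 < B ∧ ∀ x : Finset (Space d), ((-(B * x.card) : ℝ) : EReal) ≤ H x

/-- The interaction energy `W(x ∣ η)` of finite configurations, i.e. the solution of
`H(x ∪ η) = H(x) + W(x ∣ η) + H(η)`, where `W = ∞` if `H(x) = ∞` or `H(η) = ∞`. -/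
def finiteInteraction {d : ℕ} (H : Finset (Space d) → EReal) (x η : Finset (Space d)) : EReal :=
  if H x = ⊤ ∨ H η = ⊤ then ⊤ else H (x ∪ η) - H x - H η

/-- The interaction energy `W(x ∣ η)` of a finite and a possibly infinite configuration, the limit
of `W(x ∣ η ∩ B_n)` along the growing balls `B_n` (written as a lower limit to be total; on the
tempered configurations in `IsGibbs` it is a limit). -/
def interaction {d : ℕ} (H : Finset (Space d) → EReal) (x : Finset (Space d))
    (η : Configuration d) : EReal :=
  liminf (fun n : ℕ => finiteInteraction H x (η.inBall 0 n)) atTop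

/-- A set `T` of tempered configurations for `H`: it is stable under adding finitely many points,
and for `η ∈ T` the interaction energy of any finite set of further points with `η` is well defined
in `ℝ ∪ {∞}`, as the limit along growing balls, whatever their centre. -/
structure IsTemperedSet {d : ℕ} (H : Finset (Space d) → EReal) (T : Set (Configuration d)) :
    Prop where
  addPoints : ∀ η ∈ T, ∀ x : Finset (Space d), η.addPoints x ∈ T
  limit : ∀ η ∈ T, ∀ x : Finset (Space d), Disjoint (x : Set (Space d)) η.1 →
    ∃ w : EReal, w ≠ ⊥ ∧ ∀ a : Space d,
      Tendsto (fun n : ℕ => finiteInteraction H x (η.inBall a n)) atTop (𝓝 w)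

/-- `P` is a `(μ, H)`-Gibbs measure: it is supported on tempered configurations of locally finite
energy and it satisfies the GNZ equation. -/
structure IsGibbs {d : ℕ} (μ : ℝ) (H : Finset (Space d) → EReal)
    (P : Measure (Configuration d)) : Prop where
  tempered : ∃ T : Set (Configuration d), IsTemperedSet H T ∧ ∀ᵐ η ∂P, η ∈ T
  finite_energy : ∀ᵐ η ∂P, ∀ n : ℕ, H (η.inBall 0 n) ≠ ⊤
  gnz : ∀ G : Space d → Configuration d → ℝ≥0∞, Measurable (Function.uncurry G) →
    ∫⁻ η, ∑' x : η.1, G x η ∂P =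
      ∫⁻ x : Space d, ∫⁻ η, G x (η.addPoints {x}) *
        EReal.exp ((μ : EReal) - interaction H {x} η) ∂P

/-! ### Correlation functions and Janossy densities -/

/-- `exp(n μ - H(x) - W(x ∣ η))` for a set `x` of `n` points. -/
def boltzmann {d : ℕ} (μ : ℝ) (H : Finset (Space d) → EReal) (x : Finset (Space d))
    (η : Configuration d) : ℝ≥0∞ :=
  EReal.exp (((x.card * μ : ℝ) : EReal) - H x - interaction H x η)

/-- The correlation functions `ρ^(n)(x₁, …, xₙ)` of a Gibbs measure, with values in `[0, ∞]`. -/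
def correlation {d : ℕ} (μ : ℝ) (H : Finset (Space d) → EReal) (P : Measure (Configuration d))
    (x : Finset (Space d)) : ℝ≥0∞ :=
  ∫⁻ η, boltzmann μ H x η ∂P

/-- The correlation functions as a real function on finite configurations. -/
def rho {d : ℕ} (μ : ℝ) (H : Finset (Space d) → EReal) (P : Measure (Configuration d))
    (x : Finset (Space d)) : ℝ :=
  (correlation μ H P x).toReal

/-- The Ruelle bound `ρ^(n) ≤ ξ^n`. -/
def RuelleBound {d : ℕ} (μ : ℝ) (H : Finset (Space d) → EReal) (P : Measure (Configuration d)) :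
    Prop :=
  ∃ ξ : ℝ, 0 < ξ ∧ ∀ x : Finset (Space d), x.Nonempty →
    correlation μ H P x ≤ ENNReal.ofReal (ξ ^ x.card)

/-- The Janossy densities `j_Λ^(n)(x₁, …, xₙ)` of a Gibbs measure:
the integral of `exp(n μ - H(x) - W(x ∣ η))` over the `η` without points in `Λ`. -/
def janossy {d : ℕ} (μ : ℝ) (H : Finset (Space d) → EReal) (P : Measure (Configuration d))
    (Λ : Set (Space d)) (x : Finset (Space d)) : ℝ :=
  (∫⁻ η in {η : Configuration d | η.1 ∩ Λ = ∅}, boltzmann μ H x η ∂P).toReal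

/-! ### Ruelle calculus for functions on finite configurations -/

/-- The value `F^(k)(y₁, …, y_k) = F({y₁, …, y_k})`. -/
def atPoints {d : ℕ} (F : Finset (Space d) → ℝ) {k : ℕ} (y : Fin k → Space d) : ℝ :=
  F (Finset.univ.image y)

/-- The product `(Ψ ∗ Φ)(η) = ∑_{γ ⊆ η} Ψ(γ) Φ(η \ γ)`. -/
def starMul {d : ℕ} (Ψ Φ : Finset (Space d) → ℝ) (η : Finset (Space d)) : ℝ :=
  ∑ γ ∈ η.powerset, Ψ γ * Φ (η \ γ)

/-- The unit of the product `∗`. -/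
def starOne {d : ℕ} (η : Finset (Space d)) : ℝ := if η = ∅ then 1 else 0

/-- The powers for the product `∗`. -/
def starPow {d : ℕ} (Ψ : Finset (Space d) → ℝ) : ℕ → Finset (Space d) → ℝ
  | 0 => starOne
  | n + 1 => starMul Ψ (starPow Ψ n)

/-- The star-exponential `exp^∗ Ψ = ∑ₙ Ψ^{∗n} / n!`. -/
def starExp {d : ℕ} (Ψ : Finset (Space d) → ℝ) (η : Finset (Space d)) : ℝ :=
  ∑' n : ℕ, ((n.factorial : ℝ))⁻¹ * starPow Ψ n η

/-- The operator `D_γ`. -/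
def dOp {d : ℕ} (γ : Finset (Space d)) (Ψ : Finset (Space d) → ℝ) (η : Finset (Space d)) : ℝ :=
  if Disjoint η γ then Ψ (η ∪ γ) else 0

/-- The solution `Φ` of `exp^∗ Φ = Ψ` (for `Ψ(∅) = 1`), by recursion on the number of points:
the term of highest order in `(exp^∗ Φ)(η)` is `Φ(η)`, and the others, which contain `Φ` only on
proper subsets of `η`, are subtracted from `Ψ(η)`. -/
def starLog {d : ℕ} (Ψ : Finset (Space d) → ℝ) (η : Finset (Space d)) : ℝ :=
  Ψ η - starExp (fun γ => if _h : γ ⊂ η then starLog Ψ γ else 0) η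
termination_by η.card
decreasing_by exact Finset.card_lt_card _h

/-- The truncated correlation functions `ρ_T`, given by `ρ = exp^∗ ρ_T`. -/
def truncated {d : ℕ} (ρ : Finset (Space d) → ℝ) : Finset (Space d) → ℝ := starLog ρ

/-- `D_{x} ρ_T / ρ^(1)(x)`. -/
def normD {d : ℕ} (ρ : Finset (Space d) → ℝ) (x : Space d) (η : Finset (Space d)) : ℝ :=
  dOp {x} (truncated ρ) η / ρ {x}

/-- The family `ω_x`, given recursively by `D_{x} ρ_T / ρ^(1)(x) = exp^∗ ω_x`. -/
def omega1 {d : ℕ} (ρ : Finset (Space d) → ℝ) (x : Space d) : Finset (Space d) → ℝ :=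
  starLog (normD ρ x)

/-- The family `ω_{x₁,x₂}`, given recursively by
`D_{x₁,x₂} ρ_T / ρ^(2)(x₁,x₂) = (exp^∗ ω_{x₁,x₂} - (ρ^(1)(x₁) ρ^(1)(x₂) / ρ^(2)(x₁,x₂)) 𝟙)
  ∗ (D_{x₁} ρ_T / ρ^(1)(x₁)) ∗ (D_{x₂} ρ_T / ρ^(1)(x₂))`:
at `η`, the right-hand side is `ω_{x₁,x₂}(η)` plus terms with `ω_{x₁,x₂}` on proper subsets. -/
def omega2 {d : ℕ} (ρ : Finset (Space d) → ℝ) (x₁ x₂ : Space d) (η : Finset (Space d)) : ℝ :=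
  dOp {x₁, x₂} (truncated ρ) η / ρ {x₁, x₂} -
    starMul (starMul (fun ζ => starExp (fun γ => if _h : γ ⊂ η then omega2 ρ x₁ x₂ γ else 0) ζ -
      ρ {x₁} * ρ {x₂} / ρ {x₁, x₂} * starOne ζ) (normD ρ x₁)) (normD ρ x₂) η
termination_by η.card
decreasing_by exact Finset.card_lt_card _h

/-- The `k`-th term `((-1)^k / k!) ∫ F^(k)(y) dy` of the expansions. -/
def expansionTerm {d : ℕ} (F : Finset (Space d) → ℝ) (k : ℕ) : ℝ :=
  (-1) ^ k / (k.factorial : ℝ) * ∫ y : Fin k → Space d, atPoints F y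

/-! ### The three assumptions -/

/-- Limits of the ratios of Janossy densities: for `n = 1, 2` and all bounded `Δ`,
`j_Λ^(n)(x) / j_Λ^(0)` tends to `exp(n μ - H(x))`, uniformly in `x ∈ Δ^n`, as `Λ` increases to
`ℝ^d` along some sequence of bounded Borel sets. -/
def AssumptionA {d : ℕ} (μ : ℝ) (H : Finset (Space d) → EReal) (P : Measure (Configuration d)) :
    Prop :=
  ∃ Λ : ℕ → Set (Space d), Monotone Λ ∧ (∀ i, Bornology.IsBounded (Λ i)) ∧
    (∀ i, MeasurableSet (Λ i)) ∧ (⋃ i, Λ i) = Set.univ ∧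
    ∀ n : ℕ, n = 1 ∨ n = 2 → ∀ Δ : Set (Space d), Bornology.IsBounded Δ →
      TendstoUniformlyOn (fun (i : ℕ) (x : Finset (Space d)) =>
          janossy μ H P (Λ i) x / janossy μ H P (Λ i) ∅)
        (fun x => (EReal.exp (((n * μ : ℝ) : EReal) - H x)).toReal) atTop
        {x : Finset (Space d) | x.card = n ∧ (x : Set (Space d)) ⊆ Δ}

/-- Strong Brillinger mixing with constants `M`, `A`, `D`. -/
def AssumptionB {d : ℕ} (ρ : Finset (Space d) → ℝ) (M A D : ℝ) : Prop :=
  ∀ (Λ : Set (Space d)), MeasurableSet Λ → ∀ k : ℕ, 1 ≤ k →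
    ∀ x : Finset (Space d), x.card = 1 ∨ x.card = 2 →
      ∫⁻ y in Set.univ.pi (fun _ : Fin k => Λ), ‖atPoints (dOp x (truncated ρ)) y‖ₑ ≤
        ENNReal.ofReal (((x.card + k - 1).factorial : ℝ) * M * A ^ x.card * D ^ k *
          ∏ p ∈ x, ρ {p})

/-- Positivity of the density, and the lower bound on the pair correlation function at
distance at least `r`, with constant `dr`. -/
def AssumptionC {d : ℕ} (ρ : Finset (Space d) → ℝ) (r dr : ℝ) : Prop :=
  (∀ x : Space d, 0 < ρ {x}) ∧
    ∀ x₁ x₂ : Space d, r ≤ dist x₁ x₂ → ρ {x₁} * ρ {x₂} ≤ dr * ρ {x₁, x₂}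

end InverseGibbs

end

open InverseGibbs

open MeasureTheory Filter Topology
open scoped ENNReal Classical

noncomputable section

namespace InverseGibbs

variable {d : ℕ}

/-! ### The star algebra -/

/-! Functions on finite configurations form a commutative algebra under `starMul`, and `expansion`,
the map taking `F` to `∑ (-1)^k / k! ∫ F^(k)`, is multiplicative on absolutely convergent elements.
It therefore turns star-exponentials into exponentials. Restriction to a region is also
multiplicative. Hence an algebraic identity between correlation functions becomes a numerical
identity in every bounded region.

Two sources of such identities are combined. On the probabilistic side, iterating the GNZ equation
expresses weighted factorial moments of the number of points in `Λ` through the correlation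
functions. Inclusion-exclusion then gives the Janossy density of `γ` as the expansion of `D_γ ρ`
restricted to `Λ` (`janossy_eq_expansion`). The Ruelle bound makes this series converge for bounded
`Λ`.

On the algebraic side, adding a point acts on `ρ = exp^∗ ρ_T` as a derivation, so off the added
points `D_x ρ = ρ ∗ D_x ρ_T` and `D_{x₁,x₂} ρ = ρ ∗ (D_{x₁} ρ_T ∗ D_{x₂} ρ_T + D_{x₁,x₂} ρ_T)`. The
factor `ρ` cancels in the quotient of Janossy densities. What remains is `ρ^(1) exp(∑ ω_x)` in the
one-point case. In the two-point case the unit subtracted in the equation of `ω_{x₁,x₂}` cancels the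
product of the one-point terms, leaving `ρ^(2)` times the exponentials of the expansions of
`ω_{x₁,x₂}`, `ω_{x₁}` and `ω_{x₂}` (`expansion_res_dOp_singleton`, `expansion_res_dOp_pair`).

The expansions of the `ω` converge in the whole space, whereas that of `ρ` is only used in bounded
regions. This is where smallness of `D` enters: the mixing bound makes the normalised derivatives of
`ρ_T` close to the unit in a weighted norm. Division by a function close to the unit preserves
finiteness of that norm (`tailNorm_le_of_starMul`). The star-logarithm reduces to a division,
because multiplication by the number of points is a derivation (`absConv_of_starExp`). Letting `Λ`
grow, the quotients tend to `e^μ` and `e^{2μ - H}` by assumption; taking logarithms and eliminating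
the one-point terms gives both formulas. -/

theorem starMul_congr {Ψ Ψ' Φ Φ' : Finset (Space d) → ℝ} {η : Finset (Space d)}
    (h₁ : ∀ γ ⊆ η, Ψ γ = Ψ' γ) (h₂ : ∀ γ ⊆ η, Φ γ = Φ' γ) :
    starMul Ψ Φ η = starMul Ψ' Φ' η := by
  refine Finset.sum_congr rfl fun γ hγ => ?_
  rw [h₁ γ (Finset.mem_powerset.1 hγ), h₂ _ Finset.sdiff_subset]

theorem starMul_comm (Ψ Φ : Finset (Space d) → ℝ) : starMul Ψ Φ = starMul Φ Ψ := by
  funext η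
  refine Finset.sum_nbij' (fun γ => η \ γ) (fun γ => η \ γ) ?_ ?_ ?_ ?_ ?_
  · intro γ _; simp
  · intro γ _; simp
  · intro γ hγ; simpa using Finset.mem_powerset.1 hγ
  · intro γ hγ; simpa using Finset.mem_powerset.1 hγ
  · intro γ hγ
    simp only [Finset.sdiff_sdiff_eq_self (Finset.mem_powerset.1 hγ)]
    ring

theorem starMul_assoc (Ψ Φ Θ : Finset (Space d) → ℝ) :
    starMul (starMul Ψ Φ) Θ = starMul Ψ (starMul Φ Θ) := by
  funext η
  simp only [starMul, Finset.sum_mul, Finset.mul_sum]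
  rw [Finset.sum_sigma', Finset.sum_sigma']
  -- Both sides run over the ordered splittings of `η` into three disjoint parts.
  refine Finset.sum_nbij' (fun p => ⟨p.2, p.1 \ p.2⟩) (fun p => ⟨p.1 ∪ p.2, p.1⟩) ?_ ?_ ?_ ?_ ?_
  · rintro ⟨γ, δ⟩ h
    simp only [Finset.mem_sigma, Finset.mem_powerset] at h ⊢
    exact ⟨h.2.trans h.1, Finset.sdiff_subset_sdiff h.1 subset_rfl⟩
  · rintro ⟨δ, ε⟩ h
    simp only [Finset.mem_sigma, Finset.mem_powerset] at h ⊢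
    exact ⟨Finset.union_subset h.1 (h.2.trans Finset.sdiff_subset), Finset.subset_union_left⟩
  · rintro ⟨γ, δ⟩ h
    simp only [Finset.mem_sigma, Finset.mem_powerset] at h
    simp [Finset.union_sdiff_of_subset h.2]
  · rintro ⟨δ, ε⟩ h
    simp only [Finset.mem_sigma, Finset.mem_powerset] at h
    have : Disjoint ε δ := Finset.disjoint_of_subset_left h.2 Finset.sdiff_disjoint
    simp [Finset.union_sdiff_cancel_left this.symm]
  · rintro ⟨γ, δ⟩ h
    simp only [Finset.mem_sigma, Finset.mem_powerset] at h
    have : (η \ δ) \ (γ \ δ) = η \ γ := by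
      ext z; simp only [Finset.mem_sdiff]; have := @h.2 z; tauto
    simp only [this]; ring

theorem starOne_starMul (Ψ : Finset (Space d) → ℝ) : starMul starOne Ψ = Ψ := by
  funext η
  rw [starMul, Finset.sum_eq_single ∅]
  · simp [starOne]
  · intro γ _ h; simp [starOne, h]
  · simp

theorem starMul_starOne (Ψ : Finset (Space d) → ℝ) : starMul Ψ starOne = Ψ := by
  rw [starMul_comm, starOne_starMul]

theorem starMul_empty (Ψ Φ : Finset (Space d) → ℝ) : starMul Ψ Φ ∅ = Ψ ∅ * Φ ∅ := by
  simp [starMul]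

theorem starMul_sub_left (Ψ Ψ' Φ : Finset (Space d) → ℝ) (η : Finset (Space d)) :
    starMul (fun γ => Ψ γ - Ψ' γ) Φ η = starMul Ψ Φ η - starMul Ψ' Φ η := by
  simp [starMul, sub_mul, Finset.sum_sub_distrib]

theorem starMul_sum_left {ι : Type*} (s : Finset ι) (Ψ : ι → Finset (Space d) → ℝ)
    (Φ : Finset (Space d) → ℝ) (η : Finset (Space d)) :
    starMul (fun γ => ∑ i ∈ s, Ψ i γ) Φ η = ∑ i ∈ s, starMul (Ψ i) Φ η := by
  simp only [starMul, Finset.sum_mul]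
  rw [Finset.sum_comm]

theorem starMul_smul_left (c : ℝ) (Ψ Φ : Finset (Space d) → ℝ) (η : Finset (Space d)) :
    starMul (fun γ => c * Ψ γ) Φ η = c * starMul Ψ Φ η := by
  simp [starMul, Finset.mul_sum, mul_assoc]

/-- If the left factors agree on the proper subsets of `η`, the products differ at `η` only by the
term of the full set. -/
theorem starMul_sub_of_eq_ssubset {Ψ Ψ' : Finset (Space d) → ℝ} (Φ : Finset (Space d) → ℝ)
    {η : Finset (Space d)} (h : ∀ γ ⊂ η, Ψ γ = Ψ' γ) :
    starMul Ψ Φ η - starMul Ψ' Φ η = (Ψ η - Ψ' η) * Φ ∅ := by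
  rw [← starMul_sub_left, starMul, Finset.sum_eq_single η]
  · simp
  · intro γ hγ hne
    rw [h γ ((Finset.mem_powerset.1 hγ).ssubset_of_ne hne)]
    simp
  · simp

theorem starPow_congr {Φ Φ' : Finset (Space d) → ℝ} (n : ℕ) {η : Finset (Space d)}
    (h : ∀ γ ⊆ η, Φ γ = Φ' γ) : starPow Φ n η = starPow Φ' n η := by
  induction n generalizing η with
  | zero => rfl
  | succ n ih => exact starMul_congr h fun γ hγ => ih fun δ hδ => h δ (hδ.trans hγ)

/-- Each of the `n` factors must receive a nonempty part of `η`. So the series of `starExp` is a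
finite sum at every configuration, and no summability question arises there. -/
theorem starPow_eq_zero {Φ : Finset (Space d) → ℝ} (h0 : Φ ∅ = 0) {n : ℕ} {η : Finset (Space d)}
    (hn : η.card < n) : starPow Φ n η = 0 := by
  induction n generalizing η with
  | zero => omega
  | succ n ih =>
    refine Finset.sum_eq_zero fun γ hγ => ?_
    rcases γ.eq_empty_or_nonempty with rfl | hne
    · simp [h0]
    · rw [ih, mul_zero]
      rw [Finset.card_sdiff_of_subset (Finset.mem_powerset.1 hγ)]
      have := hne.card_pos
      have := Finset.card_le_card (Finset.mem_powerset.1 hγ)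
      omega

theorem starExp_eq_sum {Φ : Finset (Space d) → ℝ} (h0 : Φ ∅ = 0) {N : ℕ} {η : Finset (Space d)}
    (hN : η.card < N) :
    starExp Φ η = ∑ n ∈ Finset.range N, ((n.factorial : ℝ))⁻¹ * starPow Φ n η := by
  refine tsum_eq_sum fun n hn => ?_
  rw [starPow_eq_zero h0 (by simp at hn; omega), mul_zero]

theorem starExp_congr {Φ Φ' : Finset (Space d) → ℝ} {η : Finset (Space d)}
    (h : ∀ γ ⊆ η, Φ γ = Φ' γ) : starExp Φ η = starExp Φ' η := by
  simp only [starExp, starPow_congr _ h]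

theorem starExp_empty {Φ : Finset (Space d) → ℝ} (h0 : Φ ∅ = 0) : starExp Φ ∅ = 1 := by
  rw [starExp_eq_sum h0 (N := 1) (by simp)]
  simp [starPow, starOne]

theorem starPow_one (Φ : Finset (Space d) → ℝ) : starPow Φ 1 = Φ := starMul_starOne Φ

/-- The restriction of a function to the proper subsets of `η`. -/
def properPart (Φ : Finset (Space d) → ℝ) (η γ : Finset (Space d)) : ℝ :=
  if γ ⊂ η then Φ γ else 0

/-- In a power of order at least two, a nonzero term splits `η` into at least two nonempty parts, so
`Φ` is evaluated on proper subsets only. The value at `η` itself enters through the linear term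
alone, and this makes the recursive definitions solvable. -/
theorem starExp_eq_add_properPart {Φ : Finset (Space d) → ℝ} (h0 : Φ ∅ = 0)
    {η : Finset (Space d)} (hη : η.Nonempty) :
    starExp Φ η = Φ η + starExp (properPart Φ η) η := by
  have h0' : properPart Φ η ∅ = 0 := by simp [properPart, h0]
  have hpow : ∀ n, starPow Φ (n + 2) η = starPow (properPart Φ η) (n + 2) η := by
    intro n
    refine Finset.sum_congr rfl fun γ hγ => ?_
    have hγη := Finset.mem_powerset.1 hγ
    rcases γ.eq_empty_or_nonempty with rfl | hne
    · simp [h0, h0']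
    by_cases hγe : γ = η
    · subst hγe
      rw [Finset.sdiff_self, starPow_eq_zero h0 (by simp), starPow_eq_zero h0' (by simp)]
      simp
    · have hss : γ ⊂ η := hγη.ssubset_of_ne hγe
      have : η \ γ ⊂ η := Finset.sdiff_ssubset hγη hne
      congr 1
      · simp [properPart, hss]
      · exact starPow_congr _ fun δ hδ => by
          simp [properPart, hδ.trans_ssubset this]
  have hc : η.card < η.card + 2 := by omega
  rw [starExp_eq_sum h0 hc, starExp_eq_sum h0' hc, Finset.sum_range_succ', Finset.sum_range_succ',
    Finset.sum_range_succ', Finset.sum_range_succ']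
  have hself : properPart Φ η η = 0 := by simp [properPart]
  have hzero : starPow Φ 0 η = starPow (properPart Φ η) 0 η := rfl
  simp only [hpow, zero_add, starPow_one, hself, hzero, Nat.factorial_one, Nat.cast_one, inv_one,
    one_mul]
  ring

theorem starLog_eq (Ψ : Finset (Space d) → ℝ) (η : Finset (Space d)) :
    starLog Ψ η = Ψ η - starExp (properPart (starLog Ψ) η) η := by
  rw [starLog]
  congr 2

theorem starLog_empty {Ψ : Finset (Space d) → ℝ} (h : Ψ ∅ = 1) : starLog Ψ ∅ = 0 := by
  rw [starLog_eq, starExp_empty (by simp [properPart]), h, sub_self]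

theorem starExp_starLog {Ψ : Finset (Space d) → ℝ} (h : Ψ ∅ = 1) : starExp (starLog Ψ) = Ψ := by
  funext η
  rcases η.eq_empty_or_nonempty with rfl | hne
  · rw [starExp_empty (starLog_empty h), h]
  · rw [starExp_eq_add_properPart (starLog_empty h) hne, starLog_eq Ψ η]
    ring

/-! ### Derivations -/

theorem dOp_singleton_apply {x : Space d} {η : Finset (Space d)} (hx : x ∉ η)
    (Φ : Finset (Space d) → ℝ) : dOp {x} Φ η = Φ (insert x η) := by
  rw [dOp, if_pos (by simpa using hx), Finset.union_comm, Finset.insert_eq]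

theorem dOp_empty (Φ : Finset (Space d) → ℝ) : dOp ∅ Φ = Φ := by
  funext η; simp [dOp]

/-- Leibniz rule: the additional point lies in exactly one of the two parts of a splitting. -/
theorem starMul_insert {x : Space d} {η : Finset (Space d)} (hx : x ∉ η)
    (Ψ Φ : Finset (Space d) → ℝ) :
    starMul Ψ Φ (insert x η) = starMul (dOp {x} Ψ) Φ η + starMul Ψ (dOp {x} Φ) η := by
  rw [starMul, Finset.sum_powerset_insert hx, add_comm]
  congr 1 <;> refine Finset.sum_congr rfl fun γ hγ => ?_
  · have hxγ : x ∉ γ := fun h => hx (Finset.mem_powerset.1 hγ h)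
    rw [dOp_singleton_apply hxγ, Finset.insert_sdiff_insert, Finset.sdiff_insert_of_notMem hx]
  · have hxγ : x ∉ γ := fun h => hx (Finset.mem_powerset.1 hγ h)
    rw [dOp_singleton_apply (fun h => hx (Finset.sdiff_subset h)),
      Finset.insert_sdiff_of_notMem _ hxγ]

theorem starPow_insert {x : Space d} {η : Finset (Space d)} (hx : x ∉ η)
    (Φ : Finset (Space d) → ℝ) (n : ℕ) :
    starPow Φ (n + 1) (insert x η) = (n + 1) * starMul (starPow Φ n) (dOp {x} Φ) η := by
  induction n generalizing η with
  | zero =>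
    rw [starPow_one, starPow, starOne_starMul, dOp_singleton_apply hx]; simp
  | succ n ih =>
    rw [starPow, starMul_insert hx]
    have h1 : starMul Φ (dOp {x} (starPow Φ (n + 1))) η =
        starMul (fun γ => (n + 1 : ℝ) * starMul (starPow Φ n) (dOp {x} Φ) γ) Φ η := by
      rw [starMul_comm]
      refine starMul_congr (fun γ hγ => ?_) fun _ _ => rfl
      have hxγ : x ∉ γ := fun h => hx (hγ h)
      rw [dOp_singleton_apply hxγ, ih hxγ]
    rw [h1, starMul_smul_left, starMul_comm _ Φ, ← starMul_assoc, starMul_comm (dOp {x} Φ)]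
    change starMul (starPow Φ (n + 1)) (dOp {x} Φ) η +
      ((n : ℝ) + 1) * starMul (starPow Φ (n + 1)) (dOp {x} Φ) η = _
    push_cast; ring

/-- The operator `D_{x}` acts on star-exponentials as a derivation, off the point `x`. -/
theorem starExp_insert {x : Space d} {η : Finset (Space d)} (hx : x ∉ η)
    {Φ : Finset (Space d) → ℝ} (h0 : Φ ∅ = 0) :
    starExp Φ (insert x η) = starMul (starExp Φ) (dOp {x} Φ) η := by
  have hc : (insert x η).card < η.card + 1 + 1 := by rw [Finset.card_insert_of_notMem hx]; omega
  rw [starExp_eq_sum h0 hc, Finset.sum_range_succ',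
    starMul_congr (Ψ' := fun γ => ∑ n ∈ Finset.range (η.card + 1),
      ((n.factorial : ℝ))⁻¹ * starPow Φ n γ)
      (fun γ hγ => starExp_eq_sum h0 (Nat.lt_succ_of_le (Finset.card_le_card hγ)))
      (fun _ _ => rfl), starMul_sum_left]
  simp only [starMul_smul_left, starPow_insert hx]
  simp only [starPow, starOne, Finset.insert_ne_empty, if_false, mul_zero, add_zero]
  refine Finset.sum_congr rfl fun n _ => ?_
  rw [Nat.factorial_succ]
  have : (n.factorial : ℝ) ≠ 0 := by positivity
  push_cast
  field_simp

/-- The operator `(K Φ)(η) = #η Φ(η)`, a derivation of the star algebra. -/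
def numberOp (Φ : Finset (Space d) → ℝ) (η : Finset (Space d)) : ℝ := η.card * Φ η

theorem numberOp_starExp {Φ : Finset (Space d) → ℝ} (h0 : Φ ∅ = 0) :
    numberOp (starExp Φ) = starMul (numberOp Φ) (starExp Φ) := by
  funext η
  -- For a fixed point `x`, the part containing `x` is singled out. Summing over `x ∈ η` then counts
  -- each part `γ` exactly `γ.card` times.
  have h1 : ∀ x ∈ η, starExp Φ η =
      ∑ γ ∈ η.powerset, if x ∈ γ then Φ γ * starExp Φ (η \ γ) else 0 := by
    intro x hx
    obtain ⟨ζ, hxζ, rfl⟩ : ∃ ζ, x ∉ ζ ∧ insert x ζ = η :=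
      ⟨η.erase x, Finset.notMem_erase _ _, Finset.insert_erase hx⟩
    have hz : ∑ γ ∈ ζ.powerset,
        (if x ∈ γ then Φ γ * starExp Φ (insert x ζ \ γ) else 0) = 0 := by
      refine Finset.sum_eq_zero fun γ hγ => ?_
      rw [if_neg fun h => hxζ (Finset.mem_powerset.1 hγ h)]
    rw [starExp_insert hxζ h0, starMul_comm, starMul, Finset.sum_powerset_insert hxζ, hz, zero_add]
    · refine Finset.sum_congr rfl fun γ hγ => ?_
      have hxγ : x ∉ γ := fun h => hxζ (Finset.mem_powerset.1 hγ h)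
      rw [if_pos (Finset.mem_insert_self _ _), dOp_singleton_apply hxγ,
        Finset.insert_sdiff_insert, Finset.sdiff_insert_of_notMem hxζ]
  have h2 : numberOp (starExp Φ) η = ∑ x ∈ η, starExp Φ η := by simp [numberOp]
  rw [h2, Finset.sum_congr rfl h1, Finset.sum_comm]
  refine Finset.sum_congr rfl fun γ hγ => ?_
  rw [Finset.sum_ite, Finset.sum_const, Finset.sum_const_zero, add_zero,
    Finset.filter_mem_eq_inter, Finset.inter_eq_right.2 (Finset.mem_powerset.1 hγ)]
  simp [numberOp, mul_assoc]

/-! ### The recursively defined functions -/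

section Recursions

variable {ρ : Finset (Space d) → ℝ}

theorem truncated_empty (h : ρ ∅ = 1) : truncated ρ ∅ = 0 := starLog_empty h

theorem starExp_truncated (h : ρ ∅ = 1) : starExp (truncated ρ) = ρ := starExp_starLog h

theorem rho_insert (h : ρ ∅ = 1) {x : Space d} {η : Finset (Space d)} (hx : x ∉ η) :
    ρ (insert x η) = starMul ρ (dOp {x} (truncated ρ)) η := by
  have := starExp_insert hx (truncated_empty h)
  rwa [starExp_truncated h] at this

theorem truncated_singleton (h : ρ ∅ = 1) (x : Space d) : truncated ρ {x} = ρ {x} := by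
  have := rho_insert h (Finset.notMem_empty x)
  rw [starMul_empty, h, dOp_singleton_apply (Finset.notMem_empty x)] at this
  simpa using this.symm

/-- Second derivative of a star-exponential: the Leibniz rule is applied to `ρ ∗ D_{x₁} ρ_T`, and
the derivative of `ρ` is rewritten by the one-point formula. -/
theorem rho_insert_insert (h : ρ ∅ = 1) {x₁ x₂ : Space d} (h12 : x₁ ≠ x₂) {η : Finset (Space d)}
    (hx₁ : x₁ ∉ η) (hx₂ : x₂ ∉ η) :
    ρ (insert x₁ (insert x₂ η)) =
      starMul (starMul ρ (dOp {x₁} (truncated ρ))) (dOp {x₂} (truncated ρ)) η +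
        starMul ρ (dOp {x₁, x₂} (truncated ρ)) η := by
  have hx : x₁ ∉ insert x₂ η := by simp [h12, hx₁]
  rw [rho_insert h hx, starMul_insert hx₂]
  congr 1
  · have : ∀ γ ⊆ η, dOp {x₂} ρ γ = starMul ρ (dOp {x₂} (truncated ρ)) γ := fun γ hγ => by
      have hxγ : x₂ ∉ γ := fun h => hx₂ (hγ h)
      rw [dOp_singleton_apply hxγ, rho_insert h hxγ]
    rw [starMul_congr this fun _ _ => rfl, starMul_assoc,
      starMul_comm (dOp {x₂} _), ← starMul_assoc]
  · refine starMul_congr (fun _ _ => rfl) fun γ hγ => ?_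
    have h1 : x₁ ∉ γ := fun h => hx₁ (hγ h)
    have h2 : x₂ ∉ γ := fun h => hx₂ (hγ h)
    rw [dOp_singleton_apply h2, dOp_singleton_apply (by simp [h12, h1]), dOp, if_pos (by simp [h1, h2])]
    congr 1; ext z; simp

theorem truncated_pair (h : ρ ∅ = 1) {x₁ x₂ : Space d} (h12 : x₁ ≠ x₂) :
    truncated ρ {x₁, x₂} = ρ {x₁, x₂} - ρ {x₁} * ρ {x₂} := by
  have := rho_insert_insert h h12 (Finset.notMem_empty x₁) (Finset.notMem_empty x₂)
  rw [starMul_empty, starMul_empty, starMul_empty, h] at this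
  have e1 : ∀ x, dOp {x} (truncated ρ) ∅ = ρ {x} := fun x => by
    simp [dOp, truncated_singleton h]
  rw [e1, e1] at this
  simp only [dOp, Finset.disjoint_empty_left, if_true, Finset.empty_union] at this
  simp only [insert_empty_eq] at this
  linarith

theorem normD_empty (h : ρ ∅ = 1) {x : Space d} (hx : ρ {x} ≠ 0) : normD ρ x ∅ = 1 := by
  simp [normD, dOp, truncated_singleton h, hx]

theorem omega1_empty (h : ρ ∅ = 1) {x : Space d} (hx : ρ {x} ≠ 0) : omega1 ρ x ∅ = 0 :=
  starLog_empty (normD_empty h hx)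

theorem starExp_omega1 (h : ρ ∅ = 1) {x : Space d} (hx : ρ {x} ≠ 0) :
    starExp (omega1 ρ x) = normD ρ x :=
  starExp_starLog (normD_empty h hx)

theorem omega2_eq (x₁ x₂ : Space d) (η : Finset (Space d)) :
    omega2 ρ x₁ x₂ η = dOp {x₁, x₂} (truncated ρ) η / ρ {x₁, x₂} -
      starMul (starMul (fun ζ => starExp (properPart (omega2 ρ x₁ x₂) η) ζ -
        ρ {x₁} * ρ {x₂} / ρ {x₁, x₂} * starOne ζ) (normD ρ x₁)) (normD ρ x₂) η := by
  rw [omega2]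
  have : (fun γ => if _h : γ ⊂ η then omega2 ρ x₁ x₂ γ else 0) =
      properPart (omega2 ρ x₁ x₂) η := by
    funext γ; simp [properPart]
  rw [this]

/-- By `truncated_pair` the left-hand side of the defining equation is `1 - ρ^(1) ρ^(1) / ρ^(2)` at
the empty configuration. This equals the value of the right-hand side because `exp^∗` and both
one-point factors are `1` there. -/
theorem omega2_empty (h : ρ ∅ = 1) {x₁ x₂ : Space d} (h12 : x₁ ≠ x₂) (hx₁ : ρ {x₁} ≠ 0)
    (hx₂ : ρ {x₂} ≠ 0) (hx : ρ {x₁, x₂} ≠ 0) : omega2 ρ x₁ x₂ ∅ = 0 := by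
  rw [omega2_eq, starMul_empty, starMul_empty, starExp_empty (by simp [properPart]),
    normD_empty h hx₁, normD_empty h hx₂]
  simp only [dOp, Finset.disjoint_empty_left, if_true, Finset.empty_union,
    truncated_pair h h12, starOne]
  field_simp
  ring

/-- Replacing the proper-subset truncation by the full `omega2` changes the bracket, among the
subsets of `η`, only at `η` itself, and there by `omega2 ρ x₁ x₂ η`. Both one-point factors equal
`1` at `∅`, so the product changes by the same amount. -/
theorem omega2_equation (h : ρ ∅ = 1) {x₁ x₂ : Space d} (h12 : x₁ ≠ x₂) (hx₁ : ρ {x₁} ≠ 0)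
    (hx₂ : ρ {x₂} ≠ 0) (hx : ρ {x₁, x₂} ≠ 0) (η : Finset (Space d)) :
    dOp {x₁, x₂} (truncated ρ) η / ρ {x₁, x₂} =
      starMul (starMul (fun ζ => starExp (omega2 ρ x₁ x₂) ζ -
        ρ {x₁} * ρ {x₂} / ρ {x₁, x₂} * starOne ζ) (normD ρ x₁)) (normD ρ x₂) η := by
  have h0 := omega2_empty h h12 hx₁ hx₂ hx
  have hsub : ∀ γ ⊂ η, starExp (omega2 ρ x₁ x₂) γ = starExp (properPart (omega2 ρ x₁ x₂) η) γ :=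
    fun γ hγ => starExp_congr fun δ hδ => by simp [properPart, hδ.trans_ssubset hγ]
  have hη : starExp (omega2 ρ x₁ x₂) η - starExp (properPart (omega2 ρ x₁ x₂) η) η =
      omega2 ρ x₁ x₂ η := by
    rcases η.eq_empty_or_nonempty with rfl | hne
    · rw [starExp_empty h0, starExp_empty (by simp [properPart]), h0, sub_self]
    · rw [starExp_eq_add_properPart h0 hne]; ring
  have key := omega2_eq (ρ := ρ) x₁ x₂ η
  have e1 := starMul_sub_of_eq_ssubset (normD ρ x₁) (η := η)
    (Ψ := fun ζ => starExp (omega2 ρ x₁ x₂) ζ - ρ {x₁} * ρ {x₂} / ρ {x₁, x₂} * starOne ζ)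
    (Ψ' := fun ζ => starExp (properPart (omega2 ρ x₁ x₂) η) ζ -
        ρ {x₁} * ρ {x₂} / ρ {x₁, x₂} * starOne ζ) fun γ hγ => by
      simp only [hsub γ hγ]
  have e2 := starMul_sub_of_eq_ssubset (normD ρ x₂) (η := η)
    (Ψ := starMul (fun ζ => starExp (omega2 ρ x₁ x₂) ζ -
        ρ {x₁} * ρ {x₂} / ρ {x₁, x₂} * starOne ζ) (normD ρ x₁))
    (Ψ' := starMul (fun ζ => starExp (properPart (omega2 ρ x₁ x₂) η) ζ -
        ρ {x₁} * ρ {x₂} / ρ {x₁, x₂} * starOne ζ) (normD ρ x₁)) fun γ hγ =>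
      starMul_congr (fun δ hδ => by simp only [hsub δ (hδ.trans_ssubset hγ)]) fun _ _ => rfl
  rw [normD_empty h hx₁, mul_one] at e1
  rw [normD_empty h hx₂, mul_one, e1] at e2
  linarith

end Recursions

/-! ### Integrals of functions on finite configurations -/

theorem nontrivial_space (hd : 1 ≤ d) : Nontrivial (Space d) := by
  have : Nonempty (Fin d) := ⟨⟨0, hd⟩⟩
  infer_instance

/-- `atPoints` forgets repetitions, so `F^(k)` sees genuine `k`-point sets only off the diagonals.
These lie in proper subspaces and are null once the space is nontrivial. -/
theorem ae_injective [Nontrivial (Space d)] (k : ℕ) :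
    ∀ᵐ y : Fin k → Space d, Function.Injective y := by
  have h : ∀ i j : Fin k, i ≠ j → ∀ᵐ y : Fin k → Space d, y i ≠ y j := by
    intro i j hij
    let S : Submodule ℝ (Fin k → Space d) :=
      LinearMap.ker (LinearMap.proj (R := ℝ) (φ := fun _ : Fin k => Space d) i -
        LinearMap.proj (R := ℝ) (φ := fun _ : Fin k => Space d) j)
    have hS : S ≠ ⊤ := by
      obtain ⟨v, hv⟩ := exists_ne (0 : Space d)
      intro htop
      have : (Pi.single i v : Fin k → Space d) ∈ S := htop ▸ Submodule.mem_top
      simp [S, hij.symm, hv] at this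
    have := Measure.addHaar_submodule (volume : Measure (Fin k → Space d)) S hS
    rw [ae_iff]
    convert this using 2
    ext y
    simp [S, sub_eq_zero]
  have h' : ∀ᵐ y : Fin k → Space d, ∀ i j, i ≠ j → y i ≠ y j := by
    rw [ae_all_iff]; intro i
    rw [ae_all_iff]; intro j
    by_cases hij : i = j
    · simp [hij]
    · filter_upwards [h i j hij] with y hy _ using hy
  filter_upwards [h'] with y hy i j hij
  by_contra hne
  exact hy i j hne hij

theorem ae_notMem_finset [Nontrivial (Space d)] (Z : Finset (Space d)) (k : ℕ) :
    ∀ᵐ y : Fin k → Space d, Disjoint (Finset.univ.image y) Z := by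
  have h : ∀ᵐ y : Fin k → Space d, ∀ z ∈ Z, ∀ i, y i ≠ z := by
    rw [Finset.eventually_all]
    intro z _
    rw [ae_all_iff]
    intro i
    rw [ae_iff]
    simpa [volume_pi] using Measure.pi_hyperplane (fun _ : Fin k => (volume : Measure (Space d))) i z
  filter_upwards [h] with y hy
  rw [Finset.disjoint_left]
  intro z hz hzZ
  obtain ⟨i, _, rfl⟩ := Finset.mem_image.1 hz
  exact hy _ hzZ i rfl

/-- Two functions that agree on the configurations without points in the finite set `Z`. -/
def EqOff (Z : Finset (Space d)) (F G : Finset (Space d) → ℝ) : Prop :=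
  ∀ η, Disjoint η Z → F η = G η

theorem EqOff.ae_eq [Nontrivial (Space d)] {Z : Finset (Space d)} {F G : Finset (Space d) → ℝ}
    (h : EqOff Z F G) (k : ℕ) :
    (fun y : Fin k → Space d => atPoints F y) =ᵐ[volume] fun y => atPoints G y := by
  filter_upwards [ae_notMem_finset Z k] with y hy using h _ hy

/-- All `F^(k)` are a.e. strongly measurable. -/
def AEMeas (F : Finset (Space d) → ℝ) : Prop :=
  ∀ k, AEStronglyMeasurable (fun y : Fin k → Space d => atPoints F y) volume

/-- The term `(1 / k!) ∫ |F^(k)|`. -/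
def absTerm (F : Finset (Space d) → ℝ) (k : ℕ) : ℝ≥0∞ :=
  ENNReal.ofReal (k.factorial : ℝ)⁻¹ * ∫⁻ y : Fin k → Space d, ‖atPoints F y‖ₑ

theorem EqOff.absTerm_eq [Nontrivial (Space d)] {Z : Finset (Space d)}
    {F G : Finset (Space d) → ℝ} (h : EqOff Z F G) (k : ℕ) : absTerm F k = absTerm G k := by
  rw [absTerm, absTerm]
  congr 1
  refine lintegral_congr_ae ?_
  filter_upwards [h.ae_eq k] with y hy
  rw [hy]

theorem EqOff.expansionTerm_eq [Nontrivial (Space d)] {Z : Finset (Space d)}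
    {F G : Finset (Space d) → ℝ} (h : EqOff Z F G) (k : ℕ) :
    expansionTerm F k = expansionTerm G k := by
  rw [expansionTerm, expansionTerm, integral_congr_ae (h.ae_eq k)]

theorem card_image_univ {k : ℕ} {y : Fin k → Space d} (hy : Function.Injective y) :
    (Finset.univ.image y).card = k := by
  rw [Finset.card_image_of_injective _ hy, Finset.card_univ, Fintype.card_fin]

theorem integral_fin_zero (f : (Fin 0 → Space d) → ℝ) : ∫ y, f y = f default := by
  rw [integral_unique]
  simp [measureReal_def, volume_pi]
  exact congrArg f (Subsingleton.elim _ _)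

theorem lintegral_fin_zero (f : (Fin 0 → Space d) → ℝ≥0∞) : ∫⁻ y, f y = f default := by
  rw [lintegral_unique]
  simp [volume_pi]
  exact congrArg f (Subsingleton.elim _ _)

theorem absTerm_zero (F : Finset (Space d) → ℝ) : absTerm F 0 = ‖F ∅‖ₑ := by
  rw [absTerm, lintegral_fin_zero]
  simp [atPoints]

theorem expansionTerm_zero (F : Finset (Space d) → ℝ) : expansionTerm F 0 = F ∅ := by
  rw [expansionTerm, integral_fin_zero]
  simp [atPoints]

theorem enorm_expansionTerm_le (F : Finset (Space d) → ℝ) (k : ℕ) :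
    ‖expansionTerm F k‖ₑ ≤ absTerm F k := by
  rw [expansionTerm, absTerm, enorm_mul]
  gcongr
  · rw [Real.enorm_eq_ofReal_abs, abs_div, abs_pow]
    simp
  · exact enorm_integral_le_lintegral_enorm _

theorem integrable_atPoints {F : Finset (Space d) → ℝ} (hF : AEMeas F) {k : ℕ}
    (h : absTerm F k ≠ ∞) : Integrable (fun y : Fin k → Space d => atPoints F y) := by
  refine ⟨hF k, ?_⟩
  rw [hasFiniteIntegral_iff_enorm, lt_top_iff_ne_top]
  intro h'
  refine h ?_
  rw [absTerm, h', ENNReal.mul_top]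
  simp only [ne_eq, ENNReal.ofReal_eq_zero, not_le]
  positivity

/-- Splitting the coordinates in `S` from the others. -/
def splitEquiv {k : ℕ} (S : Finset (Fin k)) :
    (Fin k → Space d) ≃ᵐ (Fin S.card → Space d) × (Fin (k - S.card) → Space d) :=
  (MeasurableEquiv.piCongrLeft (fun _ => Space d)
    (finSumEquivOfFinset (s := S) (m := S.card) (n := k - S.card) rfl
      (by rw [Finset.card_compl, Fintype.card_fin]))).symm.trans
    (MeasurableEquiv.sumPiEquivProdPi fun _ => Space d)

theorem measurePreserving_splitEquiv {k : ℕ} (S : Finset (Fin k)) :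
    MeasurePreserving (splitEquiv (d := d) S) volume volume :=
  ((volume_measurePreserving_piCongrLeft (fun _ => Space d) _).symm).trans
    (volume_measurePreserving_sumPiEquivProdPi fun _ => Space d)

theorem image_splitEquiv_fst {k : ℕ} (S : Finset (Fin k)) (y : Fin k → Space d) :
    Finset.univ.image (splitEquiv S y).1 = S.image y := by
  have : (splitEquiv S y).1 = y ∘ S.orderEmbOfFin rfl := rfl
  rw [this, ← Finset.image_image, Finset.image_orderEmbOfFin_univ]

theorem image_splitEquiv_snd {k : ℕ} (S : Finset (Fin k)) (y : Fin k → Space d) :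
    Finset.univ.image (splitEquiv S y).2 = Sᶜ.image y := by
  have : (splitEquiv S y).2 = y ∘ Sᶜ.orderEmbOfFin
    (by rw [Finset.card_compl, Fintype.card_fin]) := rfl
  rw [this, ← Finset.image_image, Finset.image_orderEmbOfFin_univ]

/-- For distinct points, subsets of the configuration correspond bijectively to subsets of the index
set; coincident points would break this. -/
theorem atPoints_starMul {Ψ Φ : Finset (Space d) → ℝ} {k : ℕ} {y : Fin k → Space d}
    (hy : Function.Injective y) :
    atPoints (starMul Ψ Φ) y =
      ∑ S : Finset (Fin k), atPoints Ψ (splitEquiv S y).1 * atPoints Φ (splitEquiv S y).2 := by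
  simp only [atPoints, image_splitEquiv_fst, image_splitEquiv_snd]
  rw [starMul, Finset.powerset_image, Finset.sum_image fun S _ T _ h =>
    Finset.image_injective hy h, Finset.powerset_univ]
  refine Finset.sum_congr rfl fun S _ => ?_
  rw [Finset.compl_eq_univ_sdiff, Finset.image_sdiff _ _ hy]

theorem ae_atPoints_starMul [Nontrivial (Space d)] (Ψ Φ : Finset (Space d) → ℝ) (k : ℕ) :
    (fun y : Fin k → Space d => atPoints (starMul Ψ Φ) y) =ᵐ[volume] fun y =>
      ∑ S : Finset (Fin k), atPoints Ψ (splitEquiv S y).1 * atPoints Φ (splitEquiv S y).2 := by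
  filter_upwards [ae_injective k] with y hy using atPoints_starMul hy

theorem aestronglyMeasurable_split {Ψ Φ : Finset (Space d) → ℝ} (hΨ : AEMeas Ψ) (hΦ : AEMeas Φ)
    {k : ℕ} (S : Finset (Fin k)) :
    AEStronglyMeasurable (fun y : Fin k → Space d =>
      atPoints Ψ (splitEquiv S y).1 * atPoints Φ (splitEquiv S y).2) volume := by
  have : AEStronglyMeasurable (fun z : (Fin S.card → Space d) × (Fin (k - S.card) → Space d) =>
      atPoints Ψ z.1 * atPoints Φ z.2) (volume.prod volume) :=
    ((hΨ _).comp_fst).mul ((hΦ _).comp_snd)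
  exact this.comp_measurePreserving (measurePreserving_splitEquiv S)

theorem aemeas_starMul [Nontrivial (Space d)] {Ψ Φ : Finset (Space d) → ℝ} (hΨ : AEMeas Ψ)
    (hΦ : AEMeas Φ) : AEMeas (starMul Ψ Φ) := fun k => by
  refine AEStronglyMeasurable.congr ?_ (ae_atPoints_starMul Ψ Φ k).symm
  exact Finset.aestronglyMeasurable_fun_sum _ fun S _ => aestronglyMeasurable_split hΨ hΦ S

theorem sum_finset_fin_card {R : Type*} [Semiring R] (k : ℕ) (g : ℕ → ℕ → R) :
    ∑ S : Finset (Fin k), g S.card (k - S.card) =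
      ∑ p ∈ Finset.HasAntidiagonal.antidiagonal k, (k.choose p.1 : R) * g p.1 p.2 := by
  have := Finset.sum_powerset_apply_card (fun j => g j (k - j)) (x := (Finset.univ : Finset (Fin k)))
  rw [Finset.powerset_univ] at this
  rw [this, Finset.card_univ, Fintype.card_fin,
    Finset.Nat.sum_antidiagonal_eq_sum_range_succ (fun i j => (k.choose i : R) * g i j)]
  simp [nsmul_eq_mul]

theorem inv_factorial_mul_choose {i j k : ℕ} (h : i + j = k) :
    (k.factorial : ℝ)⁻¹ * k.choose i = (i.factorial : ℝ)⁻¹ * (j.factorial : ℝ)⁻¹ := by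
  have h1 := Nat.choose_mul_factorial_mul_factorial (n := k) (k := i) (by omega)
  rw [show k - i = j by omega] at h1
  have h2 : (k.choose i : ℝ) * i.factorial * j.factorial = k.factorial := by exact_mod_cast h1
  have : (k.factorial : ℝ) ≠ 0 := by positivity
  have : (i.factorial : ℝ) ≠ 0 := by positivity
  have : (j.factorial : ℝ) ≠ 0 := by positivity
  field_simp
  rw [← h2]

theorem absTerm_starMul_le [Nontrivial (Space d)] {Ψ Φ : Finset (Space d) → ℝ} (hΨ : AEMeas Ψ)
    (hΦ : AEMeas Φ) (k : ℕ) :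
    absTerm (starMul Ψ Φ) k ≤
      ∑ p ∈ Finset.HasAntidiagonal.antidiagonal k, absTerm Ψ p.1 * absTerm Φ p.2 := by
  let a : ℕ → ℝ≥0∞ := fun i => ∫⁻ y : Fin i → Space d, ‖atPoints Ψ y‖ₑ
  let b : ℕ → ℝ≥0∞ := fun i => ∫⁻ y : Fin i → Space d, ‖atPoints Φ y‖ₑ
  have h1 : ∫⁻ y : Fin k → Space d, ‖atPoints (starMul Ψ Φ) y‖ₑ ≤
      ∑ S : Finset (Fin k), a S.card * b (k - S.card) := by
    calc ∫⁻ y : Fin k → Space d, ‖atPoints (starMul Ψ Φ) y‖ₑ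
        ≤ ∫⁻ y : Fin k → Space d, ∑ S : Finset (Fin k),
          ‖atPoints Ψ (splitEquiv S y).1 * atPoints Φ (splitEquiv S y).2‖ₑ := by
          refine lintegral_mono_ae ?_
          filter_upwards [ae_atPoints_starMul Ψ Φ k] with y hy
          rw [hy]
          exact enorm_sum_le _ _
      _ = ∑ S : Finset (Fin k), ∫⁻ y : Fin k → Space d,
          ‖atPoints Ψ (splitEquiv S y).1 * atPoints Φ (splitEquiv S y).2‖ₑ :=
          lintegral_finsetSum' _ fun S _ => (aestronglyMeasurable_split hΨ hΦ S).enorm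
      _ = ∑ S : Finset (Fin k), a S.card * b (k - S.card) := by
          refine Finset.sum_congr rfl fun S _ => ?_
          simp only [enorm_mul]
          rw [(measurePreserving_splitEquiv S).lintegral_comp_emb
            (MeasurableEquiv.measurableEmbedding _) (fun z :
              (Fin S.card → Space d) × (Fin (k - S.card) → Space d) =>
              ‖atPoints Ψ z.1‖ₑ * ‖atPoints Φ z.2‖ₑ)]
          exact lintegral_prod_mul (hΨ _).enorm (hΦ _).enorm
  rw [absTerm]
  refine (mul_le_mul_right h1 _).trans (le_of_eq ?_)
  rw [sum_finset_fin_card k (fun i j => a i * b j), Finset.mul_sum]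
  refine Finset.sum_congr rfl fun p hp => ?_
  rw [absTerm, absTerm, ← mul_assoc]
  have : ENNReal.ofReal (k.factorial : ℝ)⁻¹ * (k.choose p.1 : ℝ≥0∞) =
      ENNReal.ofReal (p.1.factorial : ℝ)⁻¹ * ENNReal.ofReal (p.2.factorial : ℝ)⁻¹ := by
    rw [← ENNReal.ofReal_natCast, ← ENNReal.ofReal_mul (by positivity),
      ← ENNReal.ofReal_mul (by positivity),
      inv_factorial_mul_choose (Finset.HasAntidiagonal.mem_antidiagonal.1 hp)]
  rw [this]
  ring

/-- The integral over each index splitting factorises by Fubini. The binomial number of splittings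
of a given size cancels against the factorials, so the terms obey a Cauchy product, like
coefficients of exponential generating functions. -/
theorem expansionTerm_starMul [Nontrivial (Space d)] {Ψ Φ : Finset (Space d) → ℝ}
    (hΨ : AEMeas Ψ) (hΦ : AEMeas Φ) (hΨ' : ∀ k, absTerm Ψ k ≠ ∞) (hΦ' : ∀ k, absTerm Φ k ≠ ∞)
    (k : ℕ) :
    expansionTerm (starMul Ψ Φ) k =
      ∑ p ∈ Finset.HasAntidiagonal.antidiagonal k, expansionTerm Ψ p.1 * expansionTerm Φ p.2 := by
  let a : ℕ → ℝ := fun i => ∫ y : Fin i → Space d, atPoints Ψ y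
  let b : ℕ → ℝ := fun i => ∫ y : Fin i → Space d, atPoints Φ y
  have h1 : ∫ y : Fin k → Space d, atPoints (starMul Ψ Φ) y =
      ∑ S : Finset (Fin k), a S.card * b (k - S.card) := by
    rw [integral_congr_ae (ae_atPoints_starMul Ψ Φ k), integral_finsetSum]
    · refine Finset.sum_congr rfl fun S _ => ?_
      rw [(measurePreserving_splitEquiv S).integral_comp
        (MeasurableEquiv.measurableEmbedding _) (fun z :
          (Fin S.card → Space d) × (Fin (k - S.card) → Space d) =>
          atPoints Ψ z.1 * atPoints Φ z.2)]
      exact integral_prod_mul (fun z : Fin S.card → Space d => atPoints Ψ z)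
        (fun z : Fin (k - S.card) → Space d => atPoints Φ z)
    · intro S _
      have : Integrable (fun z : (Fin S.card → Space d) × (Fin (k - S.card) → Space d) =>
          atPoints Ψ z.1 * atPoints Φ z.2) (volume.prod volume) :=
        (integrable_atPoints hΨ (hΨ' _)).mul_prod (integrable_atPoints hΦ (hΦ' _))
      exact (measurePreserving_splitEquiv S).integrable_comp_of_integrable this
  rw [expansionTerm, h1, sum_finset_fin_card k (fun i j => a i * b j), Finset.mul_sum]
  refine Finset.sum_congr rfl fun p hp => ?_
  have := inv_factorial_mul_choose (Finset.HasAntidiagonal.mem_antidiagonal.1 hp)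
  rw [expansionTerm, expansionTerm, ← Finset.HasAntidiagonal.mem_antidiagonal.1 hp, pow_add]
  rw [← Finset.HasAntidiagonal.mem_antidiagonal.1 hp] at this
  simp only [div_eq_mul_inv]
  calc _ = (-1) ^ p.1 * (-1) ^ p.2 * (((p.1 + p.2).factorial : ℝ)⁻¹ * ((p.1 + p.2).choose p.1))
        * (a p.1 * b p.2) := by ring
    _ = _ := by rw [this]; ring

/-! ### Absolutely convergent expansions -/

theorem ennreal_tsum_mul_tsum_eq_tsum_antidiagonal (f g : ℕ → ℝ≥0∞) :
    (∑' i, f i) * ∑' j, g j =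
      ∑' n, ∑ p ∈ Finset.HasAntidiagonal.antidiagonal n, f p.1 * g p.2 := by
  have h : ∀ n : ℕ, ∑ p ∈ Finset.HasAntidiagonal.antidiagonal n, f p.1 * g p.2 =
      ∑' p : Finset.HasAntidiagonal.antidiagonal n, f p.1.1 * g p.1.2 := fun n => by
    rw [tsum_fintype, ← Finset.sum_coe_sort]
  simp only [h]
  rw [← ENNReal.tsum_sigma' fun p : Σ n : ℕ, Finset.HasAntidiagonal.antidiagonal n =>
    f p.2.1.1 * g p.2.1.2]
  rw [← (Finset.HasAntidiagonal.sigmaAntidiagonalEquivProd (A := ℕ)).symm.tsum_eq (fun p :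
    (Σ n : ℕ, Finset.HasAntidiagonal.antidiagonal n) => f p.2.1.1 * g p.2.1.2), ENNReal.tsum_prod']
  simp only [Finset.HasAntidiagonal.sigmaAntidiagonalEquivProd_symm_apply_snd_coe, ENNReal.tsum_mul_left,
    ENNReal.tsum_mul_right]

theorem aestronglyMeasurable_fin_zero (f : (Fin 0 → Space d) → ℝ) :
    AEStronglyMeasurable f volume := by
  have : f = fun _ => f default := by funext y; rw [Subsingleton.elim y default]
  rw [this]
  exact aestronglyMeasurable_const

theorem absTerm_eq_zero_of_ae {F : Finset (Space d) → ℝ} {k : ℕ}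
    (h : ∀ᵐ y : Fin k → Space d, atPoints F y = 0) : absTerm F k = 0 := by
  rw [absTerm, lintegral_congr_ae (g := fun _ => 0) (by filter_upwards [h] with y hy; simp [hy])]
  simp

theorem atPoints_starOne_succ {k : ℕ} (y : Fin (k + 1) → Space d) : atPoints starOne y = 0 := by
  simp [atPoints, starOne, Finset.univ_nonempty.ne_empty]

theorem aemeas_starOne : AEMeas (starOne : Finset (Space d) → ℝ) := by
  intro k
  cases k with
  | zero => exact aestronglyMeasurable_fin_zero _
  | succ k => simp only [atPoints_starOne_succ]; exact aestronglyMeasurable_const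

theorem absTerm_starOne_succ (k : ℕ) : absTerm (starOne : Finset (Space d) → ℝ) (k + 1) = 0 :=
  absTerm_eq_zero_of_ae (by simp [atPoints_starOne_succ])

theorem AEMeas.sub {F G : Finset (Space d) → ℝ} (hF : AEMeas F) (hG : AEMeas G) :
    AEMeas fun η => F η - G η := fun k => (hF k).sub (hG k)

theorem AEMeas.add {F G : Finset (Space d) → ℝ} (hF : AEMeas F) (hG : AEMeas G) :
    AEMeas fun η => F η + G η := fun k => (hF k).add (hG k)

theorem AEMeas.const_mul {F : Finset (Space d) → ℝ} (hF : AEMeas F) (c : ℝ) :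
    AEMeas fun η => c * F η := fun k => (hF k).const_mul c

theorem aemeas_starPow [Nontrivial (Space d)] {F : Finset (Space d) → ℝ} (hF : AEMeas F) (n : ℕ) :
    AEMeas (starPow F n) := by
  induction n with
  | zero => exact aemeas_starOne
  | succ n ih => exact aemeas_starMul hF ih

theorem absTerm_add_le {F G : Finset (Space d) → ℝ} (hF : AEMeas F) (k : ℕ) :
    absTerm (fun η => F η + G η) k ≤ absTerm F k + absTerm G k := by
  rw [absTerm, absTerm, absTerm, ← mul_add]
  gcongr
  rw [← lintegral_add_left' (hF k).enorm]
  exact lintegral_mono fun y => enorm_add_le _ _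

theorem absTerm_sub_le {F G : Finset (Space d) → ℝ} (hF : AEMeas F) (k : ℕ) :
    absTerm (fun η => F η - G η) k ≤ absTerm F k + absTerm G k := by
  rw [absTerm, absTerm, absTerm, ← mul_add]
  gcongr
  rw [← lintegral_add_left' (hF k).enorm]
  exact lintegral_mono fun y => enorm_sub_le

theorem absTerm_const_mul (c : ℝ) (F : Finset (Space d) → ℝ) (k : ℕ) :
    absTerm (fun η => c * F η) k = ‖c‖ₑ * absTerm F k := by
  have : ∀ y : Fin k → Space d, ‖atPoints (fun η => c * F η) y‖ₑ = ‖c‖ₑ * ‖atPoints F y‖ₑ :=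
    fun y => enorm_mul _ _
  simp only [absTerm, this]
  rw [lintegral_const_mul' _ _ enorm_ne_top]
  ring

/-- Absolute convergence of the expansion `∑ (-1)^k / k! ∫ F^(k)`. -/
structure AbsConv (F : Finset (Space d) → ℝ) : Prop where
  aemeas : AEMeas F
  tsum_ne_top : ∑' k, absTerm F k ≠ ∞

/-- The value of the expansion `∑ (-1)^k / k! ∫ F^(k)`. -/
def expansion (F : Finset (Space d) → ℝ) : ℝ := ∑' k, expansionTerm F k

theorem AbsConv.absTerm_ne_top {F : Finset (Space d) → ℝ} (h : AbsConv F) (k : ℕ) :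
    absTerm F k ≠ ∞ := ENNReal.ne_top_of_tsum_ne_top h.tsum_ne_top k

theorem AbsConv.integrable {F : Finset (Space d) → ℝ} (h : AbsConv F) (k : ℕ) :
    Integrable (fun y : Fin k → Space d => atPoints F y) :=
  integrable_atPoints h.aemeas (h.absTerm_ne_top k)

theorem norm_expansionTerm_le {F : Finset (Space d) → ℝ} {k : ℕ} (h : absTerm F k ≠ ∞) :
    ‖expansionTerm F k‖ ≤ (absTerm F k).toReal := by
  have := ENNReal.toReal_mono h (enorm_expansionTerm_le F k)
  rwa [toReal_enorm] at this

theorem AbsConv.summable_norm {F : Finset (Space d) → ℝ} (h : AbsConv F) :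
    Summable fun k => ‖expansionTerm F k‖ :=
  Summable.of_nonneg_of_le (fun _ => norm_nonneg _)
    (fun k => norm_expansionTerm_le (h.absTerm_ne_top k)) (ENNReal.summable_toReal h.tsum_ne_top)

theorem AbsConv.summable {F : Finset (Space d) → ℝ} (h : AbsConv F) :
    Summable fun k => expansionTerm F k := h.summable_norm.of_norm

theorem AbsConv.expansion_eq_add {F : Finset (Space d) → ℝ} (h : AbsConv F) :
    expansion F = F ∅ + ∑' k, expansionTerm F (k + 1) := by
  rw [expansion, h.summable.tsum_eq_zero_add, expansionTerm_zero]

theorem EqOff.expansion_eq [Nontrivial (Space d)] {Z : Finset (Space d)}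
    {F G : Finset (Space d) → ℝ} (h : EqOff Z F G) : expansion F = expansion G := by
  simp only [expansion, h.expansionTerm_eq]

theorem tsum_absTerm_starMul_le [Nontrivial (Space d)] {Ψ Φ : Finset (Space d) → ℝ}
    (hΨ : AEMeas Ψ) (hΦ : AEMeas Φ) :
    ∑' k, absTerm (starMul Ψ Φ) k ≤ (∑' k, absTerm Ψ k) * ∑' k, absTerm Φ k := by
  rw [ennreal_tsum_mul_tsum_eq_tsum_antidiagonal]
  exact ENNReal.tsum_le_tsum fun k => absTerm_starMul_le hΨ hΦ k

theorem AbsConv.starMul [Nontrivial (Space d)] {Ψ Φ : Finset (Space d) → ℝ}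
    (hΨ : AbsConv Ψ) (hΦ : AbsConv Φ) : AbsConv (starMul Ψ Φ) :=
  ⟨aemeas_starMul hΨ.aemeas hΦ.aemeas, ne_top_of_le_ne_top
    (ENNReal.mul_ne_top hΨ.tsum_ne_top hΦ.tsum_ne_top)
    (tsum_absTerm_starMul_le hΨ.aemeas hΦ.aemeas)⟩

theorem AbsConv.expansion_starMul [Nontrivial (Space d)] {Ψ Φ : Finset (Space d) → ℝ}
    (hΨ : AbsConv Ψ) (hΦ : AbsConv Φ) :
    expansion (InverseGibbs.starMul Ψ Φ) = expansion Ψ * expansion Φ := by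
  rw [expansion, expansion, expansion,
    tsum_mul_tsum_eq_tsum_sum_antidiagonal_of_summable_norm hΨ.summable_norm hΦ.summable_norm]
  exact tsum_congr fun k => expansionTerm_starMul hΨ.aemeas hΦ.aemeas hΨ.absTerm_ne_top
    hΦ.absTerm_ne_top k

theorem AbsConv.add {F G : Finset (Space d) → ℝ} (hF : AbsConv F) (hG : AbsConv G) :
    AbsConv fun η => F η + G η := by
  refine ⟨hF.aemeas.add hG.aemeas, ne_top_of_le_ne_top
    (ENNReal.add_ne_top.2 ⟨hF.tsum_ne_top, hG.tsum_ne_top⟩) ?_⟩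
  rw [← ENNReal.tsum_add]
  exact ENNReal.tsum_le_tsum fun k => absTerm_add_le hF.aemeas k

theorem AbsConv.expansion_add {F G : Finset (Space d) → ℝ} (hF : AbsConv F) (hG : AbsConv G) :
    expansion (fun η => F η + G η) = expansion F + expansion G := by
  rw [expansion, expansion, expansion, ← hF.summable.tsum_add hG.summable]
  refine tsum_congr fun k => ?_
  rw [expansionTerm, expansionTerm, expansionTerm, ← mul_add,
    ← integral_add (hF.integrable k) (hG.integrable k)]
  rfl

theorem AbsConv.const_mul {F : Finset (Space d) → ℝ} (hF : AbsConv F) (c : ℝ) :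
    AbsConv fun η => c * F η := by
  refine ⟨hF.aemeas.const_mul c, ?_⟩
  simp only [absTerm_const_mul]
  rw [ENNReal.tsum_mul_left]
  exact ENNReal.mul_ne_top enorm_ne_top hF.tsum_ne_top

theorem expansionTerm_const_mul (c : ℝ) (F : Finset (Space d) → ℝ) (k : ℕ) :
    expansionTerm (fun η => c * F η) k = c * expansionTerm F k := by
  have : ∀ y : Fin k → Space d, atPoints (fun η => c * F η) y = c * atPoints F y := fun y => rfl
  simp only [expansionTerm, this]
  rw [integral_const_mul]
  ring

theorem expansion_const_mul (c : ℝ) (F : Finset (Space d) → ℝ) :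
    expansion (fun η => c * F η) = c * expansion F := by
  simp only [expansion, expansionTerm_const_mul]
  rw [tsum_mul_left]

theorem tsum_absTerm_starOne : ∑' k, absTerm (starOne : Finset (Space d) → ℝ) k = 1 := by
  rw [tsum_eq_zero_add' ENNReal.summable]
  simp [absTerm_starOne_succ, absTerm_zero, starOne]

theorem absConv_starOne : AbsConv (starOne : Finset (Space d) → ℝ) :=
  ⟨aemeas_starOne, by simp [tsum_absTerm_starOne]⟩

theorem expansion_starOne : expansion (starOne : Finset (Space d) → ℝ) = 1 := by
  rw [absConv_starOne.expansion_eq_add]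
  simp [expansionTerm, atPoints_starOne_succ, starOne]

theorem tsum_absTerm_starPow_le [Nontrivial (Space d)] {F : Finset (Space d) → ℝ}
    (hF : AEMeas F) (n : ℕ) :
    ∑' k, absTerm (starPow F n) k ≤ (∑' k, absTerm F k) ^ n := by
  induction n with
  | zero => simp [starPow, tsum_absTerm_starOne]
  | succ n ih =>
    rw [pow_succ']
    exact (tsum_absTerm_starMul_le hF (aemeas_starPow hF n)).trans (mul_le_mul_right ih _)

theorem AbsConv.starPow [Nontrivial (Space d)] {F : Finset (Space d) → ℝ}
    (hF : AbsConv F) (n : ℕ) : AbsConv (starPow F n) :=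
  ⟨aemeas_starPow hF.aemeas n, ne_top_of_le_ne_top (ENNReal.pow_ne_top hF.tsum_ne_top)
    (tsum_absTerm_starPow_le hF.aemeas n)⟩

theorem AbsConv.expansion_starPow [Nontrivial (Space d)] {F : Finset (Space d) → ℝ}
    (hF : AbsConv F) (n : ℕ) : expansion (InverseGibbs.starPow F n) = expansion F ^ n := by
  induction n with
  | zero => simp [InverseGibbs.starPow, expansion_starOne]
  | succ n ih =>
    rw [pow_succ', ← ih]
    exact hF.expansion_starMul (hF.starPow n)

theorem card_image_univ_lt {k : ℕ} (y : Fin k → Space d) : (Finset.univ.image y).card < k + 1 :=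
  Nat.lt_succ_of_le (Finset.card_image_le.trans (by simp))

theorem expansionTerm_starExp [Nontrivial (Space d)] {F : Finset (Space d) → ℝ} (hF : AbsConv F)
    (h0 : F ∅ = 0) (k : ℕ) :
    expansionTerm (starExp F) k = ∑' n : ℕ, (n.factorial : ℝ)⁻¹ * expansionTerm (starPow F n) k := by
  -- At order `k` only powers with `n ≤ k` contribute, so sum and integral can be exchanged freely.
  have hz : ∀ n ∉ Finset.range (k + 1),
      (n.factorial : ℝ)⁻¹ * expansionTerm (starPow F n) k = 0 := by
    intro n hn
    have : ∀ y : Fin k → Space d, atPoints (starPow F n) y = 0 := fun y =>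
      starPow_eq_zero h0 ((card_image_univ_lt y).trans_le (by simpa using hn))
    simp [expansionTerm, this]
  have hy : ∀ y : Fin k → Space d, atPoints (starExp F) y =
      ∑ n ∈ Finset.range (k + 1), (n.factorial : ℝ)⁻¹ * atPoints (starPow F n) y := fun y =>
    starExp_eq_sum h0 (card_image_univ_lt y)
  rw [tsum_eq_sum hz, expansionTerm]
  simp only [hy]
  rw [integral_finsetSum _ fun n _ => ((hF.starPow n).integrable k).const_mul _, Finset.mul_sum]
  refine Finset.sum_congr rfl fun n _ => ?_
  rw [integral_const_mul, expansionTerm]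
  ring

/-- The expansion turns star-exponentials into exponentials. -/
theorem AbsConv.expansion_starExp [Nontrivial (Space d)] {F : Finset (Space d) → ℝ}
    (hF : AbsConv F) (h0 : F ∅ = 0) : expansion (starExp F) = Real.exp (expansion F) := by
  -- The double series is dominated by the exponential series in `∑' k, absTerm F k`, by
  -- submultiplicativity of this norm. The order of summation can therefore be reversed.
  have hsum : Summable (Function.uncurry fun n k : ℕ =>
      (n.factorial : ℝ)⁻¹ * expansionTerm (InverseGibbs.starPow F n) k) := by
    rw [← summable_norm_iff, summable_prod_of_nonneg (fun _ => norm_nonneg _)]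
    have hn : ∀ n : ℕ, Summable fun k =>
        ‖(n.factorial : ℝ)⁻¹ * expansionTerm (InverseGibbs.starPow F n) k‖ := fun n => by
      simp only [norm_mul]
      exact (hF.starPow n).summable_norm.mul_left _
    refine ⟨hn, ?_⟩
    refine Summable.of_nonneg_of_le (fun n => tsum_nonneg fun _ => norm_nonneg _) (fun n => ?_)
      (Real.summable_pow_div_factorial (∑' k, absTerm F k).toReal)
    simp only [Function.uncurry_apply_pair, norm_mul]
    rw [tsum_mul_left, div_eq_inv_mul]
    gcongr
    · simp
    · rw [← ENNReal.toReal_pow]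
      refine le_trans ?_ (ENNReal.toReal_mono (ENNReal.pow_ne_top hF.tsum_ne_top)
        (tsum_absTerm_starPow_le hF.aemeas n))
      rw [ENNReal.tsum_toReal_eq (hF.starPow n).absTerm_ne_top]
      exact (hF.starPow n).summable_norm.tsum_le_tsum
        (fun k => norm_expansionTerm_le ((hF.starPow n).absTerm_ne_top k))
        (ENNReal.summable_toReal (hF.starPow n).tsum_ne_top)
  rw [expansion, tsum_congr fun k => expansionTerm_starExp hF h0 k, hsum.tsum_comm,
    Real.exp_eq_exp_ℝ, NormedSpace.exp_eq_tsum_div]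
  refine tsum_congr fun n => ?_
  rw [tsum_mul_left, div_eq_inv_mul, ← hF.expansion_starPow]
  rfl

theorem AbsConv.starExp [Nontrivial (Space d)] {F : Finset (Space d) → ℝ} (hF : AbsConv F)
    (h0 : F ∅ = 0) : AbsConv (starExp F) := by
  have hy : ∀ k, ∀ y : Fin k → Space d, atPoints (InverseGibbs.starExp F) y =
      ∑ n ∈ Finset.range (k + 1), (n.factorial : ℝ)⁻¹ * atPoints (InverseGibbs.starPow F n) y :=
    fun k y => starExp_eq_sum h0 (card_image_univ_lt y)
  have hpow : ∀ n k, AEStronglyMeasurable (fun y : Fin k → Space d =>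
      (n.factorial : ℝ)⁻¹ * atPoints (InverseGibbs.starPow F n) y) volume := fun n k =>
    ((hF.starPow n).aemeas k).const_mul _
  refine ⟨fun k => ?_, ?_⟩
  · simp only [hy]
    exact Finset.aestronglyMeasurable_fun_sum _ fun n _ => hpow n k
  have hk : ∀ k, absTerm (InverseGibbs.starExp F) k ≤
      ∑' n : ℕ, ‖(n.factorial : ℝ)⁻¹‖ₑ * absTerm (InverseGibbs.starPow F n) k := by
    intro k
    refine le_trans ?_ (ENNReal.sum_le_tsum (Finset.range (k + 1)))
    simp only [← absTerm_const_mul]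
    simp only [absTerm]
    rw [← Finset.mul_sum]
    gcongr
    refine (lintegral_mono fun y => ?_).trans
      (lintegral_finsetSum' _ fun n _ => (hpow n k).enorm).le
    rw [hy]
    exact enorm_sum_le _ _
  refine ne_top_of_le_ne_top ?_ (ENNReal.tsum_le_tsum hk)
  rw [ENNReal.tsum_comm]
  simp only [ENNReal.tsum_mul_left]
  refine ne_top_of_le_ne_top
    (Real.summable_pow_div_factorial (∑' k, absTerm F k).toReal).tsum_ofReal_ne_top
    (ENNReal.tsum_le_tsum fun n => ?_)
  refine (mul_le_mul_right (tsum_absTerm_starPow_le hF.aemeas n) _).trans (le_of_eq ?_)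
  rw [div_eq_inv_mul, ENNReal.ofReal_mul (by positivity), Real.enorm_eq_ofReal (by positivity),
    ENNReal.ofReal_pow ENNReal.toReal_nonneg, ENNReal.ofReal_toReal hF.tsum_ne_top]

/-! ### Division and logarithms in the star algebra -/

/-- Since `Ψ ∅ = 1`, the value of `Q` at a `k`-point configuration is `G` minus products involving
`Q` on fewer points; measurability follows by induction on `k`. -/
theorem aemeas_of_starMul [Nontrivial (Space d)] {Z : Finset (Space d)}
    {Q Ψ G : Finset (Space d) → ℝ} (h : EqOff Z (starMul Q Ψ) G) (h1 : Ψ ∅ = 1)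
    (hΨ : AEMeas Ψ) (hG : AEMeas G) : AEMeas Q := by
  intro k
  induction k using Nat.strong_induction_on with
  | _ k ih =>
    -- The cut-off has measurable components of every order: below `k` they are those of `Q`, and
    -- from `k` on they vanish almost everywhere. This allows `aemeas_starMul` to be applied to it.
    let Q' : Finset (Space d) → ℝ := fun η => if η.card < k then Q η else 0
    have hQ' : AEMeas Q' := by
      intro j
      rcases lt_or_ge j k with hj | hj
      · have : (fun y : Fin j → Space d => atPoints Q' y) = fun y => atPoints Q y := by
          funext y
          exact if_pos ((Nat.le_of_lt_succ (card_image_univ_lt y)).trans_lt hj)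
        rw [this]
        exact ih j hj
      · refine AEStronglyMeasurable.congr (f := fun _ => 0) aestronglyMeasurable_const ?_
        filter_upwards [ae_injective j] with y hy
        exact (if_neg (by rw [card_image_univ hy]; omega)).symm
    refine ((hG k).sub (aemeas_starMul hQ' hΨ k)).congr ?_
    filter_upwards [ae_injective k, ae_notMem_finset Z k] with y hy hyZ
    have e := starMul_sub_of_eq_ssubset Ψ (Ψ := Q) (Ψ' := Q') (η := Finset.univ.image y)
      fun γ hγ => by
        have := Finset.card_lt_card hγ
        rw [card_image_univ hy] at this
        exact (if_pos this).symm
    rw [h _ hyZ, h1] at e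
    have e' : Q' (Finset.univ.image y) = 0 := if_neg (by rw [card_image_univ hy]; omega)
    rw [e', sub_zero, mul_one] at e
    exact e

/-- Absorption argument: as `f` has no term of order zero and total mass at most `1/2`, the
convolution contributes at most half of the sum to be estimated, besides a term from `q 0`. The sum
is then moved to the other side. -/
theorem ennreal_tsum_le_of_convolution {q g f : ℕ → ℝ≥0∞} (hf0 : f 0 = 0) (hq0 : q 0 ≤ g 0)
    (hg0 : g 0 ≠ ∞) (h : ∀ k, q k ≤ g k +
      ∑ p ∈ Finset.HasAntidiagonal.antidiagonal k, q p.1 * f p.2)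
    (hf : ∑' k, f (k + 1) ≤ 2⁻¹) (hg : ∑' k, g (k + 1) ≠ ∞) :
    ∑' k, q (k + 1) ≤ 2 * (∑' k, g (k + 1) + g 0 * ∑' k, f (k + 1)) := by
  have hfne : ∀ k, f k ≠ ∞ := by
    intro k
    cases k with
    | zero => simp [hf0]
    | succ k => exact ne_top_of_le_ne_top (by simp) ((ENNReal.le_tsum k).trans hf)
  have hqne : ∀ k, q k ≠ ∞ := by
    intro k
    induction k using Nat.strong_induction_on with
    | _ k ih =>
      refine ne_top_of_le_ne_top (ENNReal.add_ne_top.2 ⟨?_, ?_⟩) (h k)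
      · cases k with
        | zero => exact hg0
        | succ k => exact ENNReal.ne_top_of_tsum_ne_top hg k
      · refine (ENNReal.sum_lt_top.2 fun p hp => lt_top_iff_ne_top.2 ?_).ne
        rcases Nat.eq_zero_or_pos p.2 with h2 | h2
        · simp [h2, hf0]
        · have := Finset.HasAntidiagonal.mem_antidiagonal.1 hp
          exact ENNReal.mul_ne_top (ih _ (by omega)) (hfne _)
  set f' := ∑' k, f (k + 1) with hf'
  refine ENNReal.tsum_le_of_sum_range_le fun K => ?_
  -- Absorption requires subtracting `S / 2`, hence a finite `S`; for this reason partial sums are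
  -- used.
  set S := ∑ k ∈ Finset.range K, q (k + 1) with hS
  have hSne : S ≠ ∞ := (ENNReal.sum_lt_top.2 fun k _ => lt_top_iff_ne_top.2 (hqne _)).ne
  have hconv : ∑ k ∈ Finset.range K, ∑ p ∈ Finset.HasAntidiagonal.antidiagonal k,
      q p.1 * f (p.2 + 1) ≤ (q 0 + S) * f' := by
    -- Truncating `q` leaves the convolutions of order below `K` unchanged and bounds them by a full
    -- product of series.
    let q' : ℕ → ℝ≥0∞ := fun i => if i < K then q i else 0
    have e1 : ∑ k ∈ Finset.range K, ∑ p ∈ Finset.HasAntidiagonal.antidiagonal k,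
        q p.1 * f (p.2 + 1) = ∑ k ∈ Finset.range K,
          ∑ p ∈ Finset.HasAntidiagonal.antidiagonal k, q' p.1 * f (p.2 + 1) := by
      refine Finset.sum_congr rfl fun k hk => Finset.sum_congr rfl fun p hp => ?_
      have := Finset.HasAntidiagonal.mem_antidiagonal.1 hp
      have := Finset.mem_range.1 hk
      simp only [q']
      rw [if_pos (by omega)]
    rw [e1]
    refine (ENNReal.sum_le_tsum _).trans ?_
    rw [← ennreal_tsum_mul_tsum_eq_tsum_antidiagonal q' fun j => f (j + 1)]
    gcongr
    rw [tsum_eq_sum (s := Finset.range K) fun i hi => if_neg (by simpa using hi)]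
    calc ∑ i ∈ Finset.range K, q' i ≤ ∑ i ∈ Finset.range (K + 1), q i := by
          rw [Finset.sum_range_succ]
          refine le_add_right (Finset.sum_le_sum fun i _ => ?_)
          simp only [q']; split_ifs <;> simp
      _ = q 0 + S := by rw [Finset.sum_range_succ', add_comm]
  have hle : S ≤ ∑' k, g (k + 1) + (q 0 + S) * f' := by
    calc S ≤ ∑ k ∈ Finset.range K, (g (k + 1) +
          ∑ p ∈ Finset.HasAntidiagonal.antidiagonal k, q p.1 * f (p.2 + 1)) := by
          refine Finset.sum_le_sum fun k _ => (h (k + 1)).trans (le_of_eq ?_)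
          rw [Finset.Nat.sum_antidiagonal_succ']
          simp [hf0]
      _ ≤ _ := by
          rw [Finset.sum_add_distrib]
          exact add_le_add (ENNReal.sum_le_tsum _) hconv
  have hle2 : S ≤ (∑' k, g (k + 1) + g 0 * f') + S * 2⁻¹ := by
    refine hle.trans ?_
    rw [add_mul, ← add_assoc]
    gcongr
  have hS2 : S * 2⁻¹ + S * 2⁻¹ = S := by rw [← mul_add, ENNReal.inv_two_add_inv_two, mul_one]
  have hle3 : S * 2⁻¹ ≤ ∑' k, g (k + 1) + g 0 * f' := by
    refine ENNReal.le_of_add_le_add_right (a := S * 2⁻¹) (ENNReal.mul_ne_top hSne (by simp)) ?_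
    rwa [hS2]
  calc S = 2 * (S * 2⁻¹) := by rw [two_mul, hS2]
    _ ≤ _ := by gcongr

/-- The weighted norm `∑_{k ≥ 1} (t^k / k!) ∫ |F^(k)|` without the term of order zero. -/
def tailNorm (t : ℝ≥0∞) (F : Finset (Space d) → ℝ) : ℝ≥0∞ :=
  ∑' k, t ^ (k + 1) * absTerm F (k + 1)

/-- Division in the star algebra: with `F = Ψ - 𝟙`, the quotient solves `Q = G - Q ∗ F` off `Z`, and
`F` is small in the weighted norm. The weight `t ^ k` is compatible with convolution. -/
theorem tailNorm_le_of_starMul [Nontrivial (Space d)] {Z : Finset (Space d)}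
    {Q Ψ G : Finset (Space d) → ℝ} (h : EqOff Z (starMul Q Ψ) G) (h1 : Ψ ∅ = 1)
    (hΨ : AEMeas Ψ) (hG : AEMeas G) {t : ℝ≥0∞} (hf : tailNorm t Ψ ≤ 2⁻¹)
    (hGt : tailNorm t G ≠ ∞) :
    tailNorm t Q ≤ 2 * (tailNorm t G + ‖G ∅‖ₑ * tailNorm t Ψ) := by
  have hQ := aemeas_of_starMul h h1 hΨ hG
  let F : Finset (Space d) → ℝ := fun η => Ψ η - starOne η
  have hF : AEMeas F := hΨ.sub aemeas_starOne
  have hF0 : F ∅ = 0 := by simp [F, h1, starOne]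
  have hFs : ∀ k, absTerm F (k + 1) = absTerm Ψ (k + 1) := by
    intro k
    have : ∀ y : Fin (k + 1) → Space d, atPoints F y = atPoints Ψ y := fun y => by
      have := atPoints_starOne_succ y
      simp only [atPoints, F] at *
      rw [this, sub_zero]
    simp only [absTerm, this]
  have hQG : Q ∅ = G ∅ := by
    have := h ∅ (Finset.disjoint_empty_left _)
    rwa [starMul_empty, h1, mul_one] at this
  have hk : ∀ k, absTerm Q k ≤ absTerm G k +
      ∑ p ∈ Finset.HasAntidiagonal.antidiagonal k, absTerm Q p.1 * absTerm F p.2 := by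
    intro k
    have e : EqOff Z Q fun η => G η - starMul Q F η := by
      intro η hη
      change Q η = G η - starMul Q F η
      rw [← h η hη, starMul_comm Q Ψ, starMul_comm Q F, ← starMul_sub_left]
      have : (fun γ => Ψ γ - F γ) = (starOne : Finset (Space d) → ℝ) := by
        funext γ; simp [F]
      rw [this, starOne_starMul]
    rw [e.absTerm_eq]
    exact (absTerm_sub_le hG k).trans (add_le_add le_rfl (absTerm_starMul_le hQ hF k))
  have := ennreal_tsum_le_of_convolution (q := fun k => t ^ k * absTerm Q k)
    (g := fun k => t ^ k * absTerm G k) (f := fun k => t ^ k * absTerm F k)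
    (by simp [absTerm_zero, hF0]) (by simp [absTerm_zero, hQG]) (by simp [absTerm_zero])
    (fun k => by
      refine (mul_le_mul_right (hk k) _).trans (le_of_eq ?_)
      rw [mul_add, Finset.mul_sum]
      congr 1
      refine Finset.sum_congr rfl fun p hp => ?_
      rw [← Finset.HasAntidiagonal.mem_antidiagonal.1 hp, pow_add]
      ring) (by simpa only [hFs, tailNorm] using hf) hGt
  simpa [hFs, absTerm_zero, tailNorm] using this

theorem ae_atPoints_numberOp [Nontrivial (Space d)] (F : Finset (Space d) → ℝ) (k : ℕ) :
    (fun y : Fin k → Space d => atPoints (numberOp F) y) =ᵐ[volume]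
      fun y => (k : ℝ) * atPoints F y := by
  filter_upwards [ae_injective k] with y hy
  simp [atPoints, numberOp, card_image_univ hy]

theorem aemeas_numberOp [Nontrivial (Space d)] {F : Finset (Space d) → ℝ} (hF : AEMeas F) :
    AEMeas (numberOp F) := fun k =>
  ((hF k).const_mul _).congr (ae_atPoints_numberOp F k).symm

theorem aemeas_of_numberOp [Nontrivial (Space d)] {F : Finset (Space d) → ℝ}
    (hF : AEMeas (numberOp F)) : AEMeas F := by
  intro k
  cases k with
  | zero => exact aestronglyMeasurable_fin_zero _
  | succ k =>
    refine ((hF (k + 1)).const_mul ((k + 1 : ℕ) : ℝ)⁻¹).congr ?_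
    filter_upwards [ae_atPoints_numberOp F (k + 1)] with y hy
    rw [hy, ← mul_assoc, inv_mul_cancel₀ (by positivity), one_mul]

theorem absTerm_numberOp [Nontrivial (Space d)] (F : Finset (Space d) → ℝ) (k : ℕ) :
    absTerm (numberOp F) k = k * absTerm F k := by
  have : (k : ℝ≥0∞) * absTerm F k = ‖(k : ℝ)‖ₑ * absTerm F k := by simp
  rw [this, ← absTerm_const_mul, absTerm, absTerm]
  congr 1
  refine lintegral_congr_ae ?_
  filter_upwards [ae_atPoints_numberOp F k] with y hy
  rw [hy]
  rfl

theorem absConv_of_tailNorm {F : Finset (Space d) → ℝ} (hF : AEMeas F)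
    (h : tailNorm 1 F ≠ ∞) : AbsConv F := by
  refine ⟨hF, ?_⟩
  rw [tsum_eq_zero_add' ENNReal.summable, absTerm_zero]
  simp only [tailNorm, one_pow, one_mul] at h
  simpa using h

theorem tailNorm_mono {s t : ℝ≥0∞} (h : s ≤ t) (F : Finset (Space d) → ℝ) :
    tailNorm s F ≤ tailNorm t F := by
  unfold tailNorm
  gcongr

/-- The star-logarithm of a function near the unit has an absolutely convergent expansion. -/
theorem absConv_of_starExp [Nontrivial (Space d)] {ω : Finset (Space d) → ℝ} (h0 : ω ∅ = 0)
    (hm : AEMeas (starExp ω)) (ht : tailNorm 2 (starExp ω) ≤ 2⁻¹) : AbsConv ω := by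
  -- Logarithmic derivative: `numberOp ω` is the quotient of `numberOp (starExp ω)` by `starExp ω`.
  have hmul : EqOff ∅ (starMul (numberOp ω) (starExp ω)) (numberOp (starExp ω)) :=
    fun η _ => by rw [numberOp_starExp h0]
  -- The weight `2 ^ k` absorbs the factor `k` produced by `numberOp`.
  have hle : tailNorm 1 (numberOp (starExp ω)) ≤ tailNorm 2 (starExp ω) := by
    refine ENNReal.tsum_le_tsum fun k => ?_
    rw [absTerm_numberOp, one_pow, one_mul]
    gcongr
    exact_mod_cast (Nat.lt_two_pow_self (n := k + 1)).le
  have hne : tailNorm 1 (numberOp (starExp ω)) ≠ ∞ :=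
    ne_top_of_le_ne_top (by simp) (hle.trans ht)
  have ht1 : tailNorm 1 (starExp ω) ≤ 2⁻¹ := (tailNorm_mono (by norm_num) _).trans ht
  have hω := aemeas_of_numberOp (aemeas_of_starMul hmul (starExp_empty h0) hm (aemeas_numberOp hm))
  refine absConv_of_tailNorm hω ?_
  have key := tailNorm_le_of_starMul hmul (starExp_empty h0) hm (aemeas_numberOp hm) ht1 hne
  refine ne_top_of_le_ne_top ?_ (le_trans ?_ key)
  · refine ENNReal.mul_ne_top (by simp) (ENNReal.add_ne_top.2 ⟨hne, ENNReal.mul_ne_top (by simp)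
      (ne_top_of_le_ne_top (by simp) ht1)⟩)
  · refine ENNReal.tsum_le_tsum fun k => ?_
    rw [absTerm_numberOp, one_pow, one_mul, one_mul]
    exact le_mul_of_one_le_left' (by exact_mod_cast Nat.succ_le_succ (Nat.zero_le k))

/-! ### Restriction to a region -/

/-- The restriction of a function on configurations to the configurations in `Λ`. -/
def res (Λ : Set (Space d)) (F : Finset (Space d) → ℝ) (η : Finset (Space d)) : ℝ :=
  if (η : Set (Space d)) ⊆ Λ then F η else 0

theorem res_empty (Λ : Set (Space d)) (F : Finset (Space d) → ℝ) : res Λ F ∅ = F ∅ := by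
  simp [res]

/-- A configuration lies in `Λ` exactly when both parts of any splitting of it do. -/
theorem res_starMul (Λ : Set (Space d)) (Ψ Φ : Finset (Space d) → ℝ) :
    res Λ (starMul Ψ Φ) = starMul (res Λ Ψ) (res Λ Φ) := by
  funext η
  by_cases h : (η : Set (Space d)) ⊆ Λ
  · rw [res, if_pos h]
    have : ∀ F : Finset (Space d) → ℝ, ∀ γ ⊆ η, F γ = res Λ F γ := fun F γ hγ =>
      (if_pos ((Finset.coe_subset.2 hγ).trans h)).symm
    exact starMul_congr (this Ψ) (this Φ)
  · rw [res, if_neg h]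
    symm
    refine Finset.sum_eq_zero fun γ hγ => ?_
    by_cases h1 : (γ : Set (Space d)) ⊆ Λ
    · have h2 : ¬ ((η \ γ : Finset (Space d)) : Set (Space d)) ⊆ Λ := by
        intro h2
        refine h ?_
        rw [← Finset.union_sdiff_of_subset (Finset.mem_powerset.1 hγ), Finset.coe_union]
        exact Set.union_subset h1 h2
      rw [res, res, if_neg h2, mul_zero]
    · rw [res, if_neg h1, zero_mul]

theorem res_starPow (Λ : Set (Space d)) (F : Finset (Space d) → ℝ) (n : ℕ) :
    res Λ (starPow F n) = starPow (res Λ F) n := by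
  induction n with
  | zero =>
    funext η
    rcases η.eq_empty_or_nonempty with rfl | h
    · simp [res, starPow]
    · simp [res, starPow, starOne, h.ne_empty]
  | succ n ih => rw [starPow, res_starMul, ih, starPow]

theorem res_starExp (Λ : Set (Space d)) (F : Finset (Space d) → ℝ) :
    res Λ (starExp F) = starExp (res Λ F) := by
  funext η
  have : ∀ n, starPow (res Λ F) n η = res Λ (starPow F n) η := fun n => by rw [res_starPow]
  simp only [starExp, this, res]
  split_ifs with h
  · rfl
  · simp

theorem atPoints_res (Λ : Set (Space d)) (F : Finset (Space d) → ℝ) (k : ℕ) :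
    (fun y : Fin k → Space d => atPoints (res Λ F) y) =
      (Set.univ.pi fun _ => Λ).indicator fun y => atPoints F y := by
  funext y
  have : ((Finset.univ.image y : Finset (Space d)) : Set (Space d)) ⊆ Λ ↔
      y ∈ Set.univ.pi fun _ : Fin k => Λ := by
    simp [Set.range_subset_iff]
  simp only [atPoints, res, this, Set.indicator]

theorem measurableSet_univ_pi {Λ : Set (Space d)} (hΛ : MeasurableSet Λ) (k : ℕ) :
    MeasurableSet (Set.univ.pi fun _ : Fin k => Λ) :=
  MeasurableSet.univ_pi fun _ => hΛ

theorem AEMeas.res {Λ : Set (Space d)} (hΛ : MeasurableSet Λ) {F : Finset (Space d) → ℝ}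
    (hF : AEMeas F) : AEMeas (res Λ F) := fun k => by
  rw [atPoints_res]
  exact (hF k).indicator (measurableSet_univ_pi hΛ k)

theorem absTerm_res {Λ : Set (Space d)} (hΛ : MeasurableSet Λ) (F : Finset (Space d) → ℝ)
    (k : ℕ) : absTerm (res Λ F) k = ENNReal.ofReal (k.factorial : ℝ)⁻¹ *
      ∫⁻ y in Set.univ.pi fun _ : Fin k => Λ, ‖atPoints F y‖ₑ := by
  rw [absTerm, ← lintegral_indicator (measurableSet_univ_pi hΛ k)]
  congr 2
  funext y
  rw [congrFun (atPoints_res Λ F k) y, enorm_indicator_eq_indicator_enorm]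

theorem expansionTerm_res {Λ : Set (Space d)} (hΛ : MeasurableSet Λ) (F : Finset (Space d) → ℝ)
    (k : ℕ) : expansionTerm (res Λ F) k = (-1) ^ k / (k.factorial : ℝ) *
      ∫ y in Set.univ.pi fun _ : Fin k => Λ, atPoints F y := by
  rw [expansionTerm, ← integral_indicator (measurableSet_univ_pi hΛ k), atPoints_res]

theorem absTerm_res_le {Λ : Set (Space d)} (hΛ : MeasurableSet Λ) (F : Finset (Space d) → ℝ)
    (k : ℕ) : absTerm (res Λ F) k ≤ absTerm F k := by
  rw [absTerm_res hΛ, absTerm]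
  gcongr
  exact Measure.restrict_le_self

theorem AbsConv.res {Λ : Set (Space d)} (hΛ : MeasurableSet Λ) {F : Finset (Space d) → ℝ}
    (hF : AbsConv F) : AbsConv (res Λ F) :=
  ⟨hF.aemeas.res hΛ, ne_top_of_le_ne_top hF.tsum_ne_top
    (ENNReal.tsum_le_tsum fun k => absTerm_res_le hΛ F k)⟩

/-- Dominated convergence is used twice, for the series and for each integral: a given tuple of
points eventually lies in `Λ i`, and absolute convergence in the whole space supplies the bounds. -/
theorem AbsConv.tendsto_expansion_res {Λ : ℕ → Set (Space d)} (hmono : Monotone Λ)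
    (hm : ∀ i, MeasurableSet (Λ i)) (hU : (⋃ i, Λ i) = Set.univ) {F : Finset (Space d) → ℝ}
    (hF : AbsConv F) :
    Tendsto (fun i => expansion (InverseGibbs.res (Λ i) F)) atTop (𝓝 (expansion F)) := by
  refine tendsto_tsum_of_dominated_convergence (bound := fun k => (absTerm F k).toReal)
    (ENNReal.summable_toReal hF.tsum_ne_top) (fun k => ?_) (Eventually.of_forall fun i k => ?_)
  · simp only [expansionTerm]
    refine Tendsto.const_mul _ ?_
    refine tendsto_integral_of_dominated_convergence (fun y => ‖atPoints F y‖)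
      (fun i => hF.aemeas.res (hm i) k) (hF.integrable k).norm (fun i => ?_) ?_
    · refine Eventually.of_forall fun y => ?_
      rw [congrFun (atPoints_res (Λ i) F k) y]
      exact norm_indicator_le_norm_self _ _
    · refine Eventually.of_forall fun y => ?_
      have : ∀ᶠ i in atTop, ∀ j : Fin k, y j ∈ Λ i := by
        rw [eventually_all]
        intro j
        obtain ⟨i, hi⟩ := Set.mem_iUnion.1 (hU ▸ Set.mem_univ (y j))
        filter_upwards [eventually_ge_atTop i] with i' hi' using hmono hi' hi
      refine tendsto_const_nhds.congr' ?_
      filter_upwards [this] with i hi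
      rw [congrFun (atPoints_res (Λ i) F k) y, Set.indicator_of_mem]
      simpa using hi
  · have h1 := (hF.res (hm i)).absTerm_ne_top k
    exact (norm_expansionTerm_le h1).trans
      (ENNReal.toReal_mono (hF.absTerm_ne_top k) (absTerm_res_le (hm i) F k))

/-! ### Measurability on the configuration space -/

theorem measurable_count {Δ : Set (Space d)} (hb : Bornology.IsBounded Δ) (hm : MeasurableSet Δ) :
    Measurable fun η : Configuration d => (η.1 ∩ Δ).ncard :=
  measurable_to_countable' fun m => MeasurableSpace.measurableSet_generateFrom ⟨Δ, m, hb, hm, rfl⟩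

theorem measurable_configuration {α : Type*} [MeasurableSpace α] {f : α → Configuration d}
    (h : ∀ Δ : Set (Space d), Bornology.IsBounded Δ → MeasurableSet Δ →
      Measurable fun a => ((f a).1 ∩ Δ).ncard) : Measurable f := by
  refine measurable_generateFrom ?_
  rintro _ ⟨Δ, m, hb, hm, rfl⟩
  exact h Δ hb hm (measurableSet_singleton m)

theorem Configuration.isClosed (η : Configuration d) : IsClosed η.1 := by
  refine isClosed_of_closure_subset fun x hx => ?_
  have hfin := η.2 (Metric.ball x 1) Metric.isBounded_ball
  have : x ∈ closure (η.1 ∩ Metric.ball x 1) :=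
    (mem_closure_iff_nhds.2 fun t ht => by
      obtain ⟨y, hy, hyη⟩ := mem_closure_iff_nhds.1 hx _ (Filter.inter_mem ht
        (Metric.ball_mem_nhds x one_pos))
      exact ⟨y, hy.1, hyη, hy.2⟩)
  rw [hfin.isClosed.closure_eq] at this
  exact this.1

/-- Since configurations are closed, membership is a countable condition on counts in small balls
with centres in a dense sequence. This yields joint measurability in the point and the
configuration. -/
theorem mem_configuration_iff (x : Space d) (η : Configuration d) :
    x ∈ η.1 ↔ ∀ n : ℕ, ∃ m : ℕ, dist x (TopologicalSpace.denseSeq (Space d) m) < 1 / ((n : ℝ) + 1) ∧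
      (η.1 ∩ Metric.ball (TopologicalSpace.denseSeq (Space d) m) (1 / ((n : ℝ) + 1))).ncard ≠ 0 := by
  constructor
  · intro hx n
    have hpos : (0 : ℝ) < 1 / ((n : ℝ) + 1) := by positivity
    obtain ⟨m, hm⟩ := (TopologicalSpace.denseRange_denseSeq (Space d)).exists_dist_lt x hpos
    refine ⟨m, hm, ?_⟩
    rw [Ne, Set.ncard_eq_zero (η.2 _ Metric.isBounded_ball)]
    exact Set.Nonempty.ne_empty ⟨x, hx, hm⟩
  · intro h
    rw [← η.isClosed.closure_eq, Metric.mem_closure_iff]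
    intro ε hε
    obtain ⟨n, hn⟩ := exists_nat_one_div_lt (half_pos hε)
    obtain ⟨m, hm, hne⟩ := h n
    rw [Ne, Set.ncard_eq_zero (η.2 _ Metric.isBounded_ball), ← Ne, ← Set.nonempty_iff_ne_empty] at hne
    obtain ⟨y, hyη, hy⟩ := hne
    refine ⟨y, hyη, ?_⟩
    rw [Metric.mem_ball, dist_comm] at hy
    linarith [dist_triangle x (TopologicalSpace.denseSeq (Space d) m) y]

theorem measurableSet_mem_configuration {α : Type*} [MeasurableSpace α] {g : α → Space d}
    {f : α → Configuration d} (hg : Measurable g) (hf : Measurable f) :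
    MeasurableSet {a | g a ∈ (f a).1} := by
  simp only [mem_configuration_iff, Set.ofPred_forall, Set.ofPred_exists]
  refine MeasurableSet.iInter fun n => MeasurableSet.iUnion fun m => ?_
  refine MeasurableSet.inter (measurableSet_lt (hg.dist measurable_const) measurable_const) ?_
  exact (((measurable_count Metric.isBounded_ball measurableSet_ball).comp hf)
    (measurableSet_singleton 0)).compl

theorem ncard_addPoints_singleton (η : Configuration d) (x : Space d) {Δ : Set (Space d)}
    (hb : Bornology.IsBounded Δ) :
    ((η.addPoints {x}).1 ∩ Δ).ncard =
      (η.1 ∩ Δ).ncard + if x ∈ Δ ∧ x ∉ η.1 then 1 else 0 := by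
  have e : (η.addPoints {x}).1 = insert x η.1 := by
    simp [Configuration.addPoints]
  rw [e]
  split_ifs with h
  · rw [Set.insert_inter_of_mem h.1, Set.ncard_insert_of_notMem (fun h' => h.2 h'.1) (η.2 Δ hb)]
  · by_cases hx : x ∈ Δ
    · have : x ∈ η.1 := by by_contra hc; exact h ⟨hx, hc⟩
      rw [Set.insert_eq_of_mem this, add_zero]
    · rw [Set.insert_inter_of_notMem hx, add_zero]

theorem measurable_addPoints_singleton {α : Type*} [MeasurableSpace α] {g : α → Space d}
    {f : α → Configuration d} (hg : Measurable g) (hf : Measurable f) :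
    Measurable fun a => (f a).addPoints {g a} := by
  refine measurable_configuration fun Δ hb hm => ?_
  simp only [ncard_addPoints_singleton _ _ hb]
  refine ((measurable_count hb hm).comp hf).add (Measurable.ite ?_ measurable_const
    measurable_const)
  exact (hg hm).inter (measurableSet_mem_configuration hg hf).compl

theorem measurable_addPoints_image {α ι : Type*} [MeasurableSpace α] {y : α → ι → Space d}
    {f : α → Configuration d} (hy : ∀ i, Measurable fun a => y a i) (hf : Measurable f)
    (s : Finset ι) : Measurable fun a => (f a).addPoints (s.image (y a)) := by
  induction s using Finset.induction_on with
  | empty =>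
    have : ∀ a, (f a).addPoints ((∅ : Finset ι).image (y a)) = f a := fun a =>
      Subtype.ext (by simp [Configuration.addPoints])
    simpa only [this] using hf
  | insert i s _ ih =>
    have : ∀ a, (f a).addPoints ((insert i s).image (y a)) =
        ((f a).addPoints (s.image (y a))).addPoints {y a i} := fun a => Subtype.ext (by
          simp only [Configuration.addPoints, Finset.image_insert, Finset.coe_insert,
            Finset.coe_singleton]
          ext z; simp)
    simp only [this]
    exact measurable_addPoints_singleton (hy i) ih

theorem measurable_addPoints (γ : Finset (Space d)) :
    Measurable fun η : Configuration d => η.addPoints γ := by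
  have := measurable_addPoints_image (y := fun (_ : Configuration d) (z : Space d) => z)
    (fun _ => measurable_const) measurable_id γ
  simpa using this

theorem Configuration.mem_inBall {η : Configuration d} {a : Space d} {R : ℝ} {z : Space d} :
    z ∈ η.inBall a R ↔ z ∈ η.1 ∧ dist z a ≤ R := by
  simp [Configuration.inBall]

theorem measurable_ofFinset_inBall (a : Space d) (R : ℝ) :
    Measurable fun η : Configuration d => Configuration.ofFinset (η.inBall a R) := by
  refine measurable_configuration fun Δ hb hm => ?_
  have : ∀ η : Configuration d, (Configuration.ofFinset (η.inBall a R)).1 ∩ Δ =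
      η.1 ∩ (Metric.closedBall a R ∩ Δ) := fun η => by
    ext z; simp [Configuration.ofFinset, Configuration.mem_inBall, and_assoc]
  simp only [this]
  exact measurable_count (hb.subset Set.inter_subset_right)
    (Metric.isClosed_closedBall.measurableSet.inter hm)

/-- The σ-algebra only provides counts in bounded sets, so the total number of points is obtained as
a limit of counts in growing balls. -/
theorem measurable_card_of_ofFinset {α : Type*} [MeasurableSpace α] {g : α → Finset (Space d)}
    (hg : Measurable fun a => Configuration.ofFinset (g a)) : Measurable fun a => (g a).card := by
  refine measurable_of_tendsto_metrizable (f := fun (n : ℕ) a =>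
    ((Configuration.ofFinset (g a)).1 ∩ Metric.closedBall 0 n).ncard)
    (fun n => (measurable_count Metric.isBounded_closedBall
      Metric.isClosed_closedBall.measurableSet).comp hg) ?_
  rw [tendsto_pi_nhds]
  intro a
  have : ∀ᶠ n : ℕ in atTop, ∀ z ∈ g a, z ∈ Metric.closedBall (0 : Space d) n := by
    rw [Finset.eventually_all]
    intro z _
    obtain ⟨N, hN⟩ := exists_nat_ge ‖z‖
    filter_upwards [eventually_ge_atTop N] with n hn
    simp only [Metric.mem_closedBall, dist_zero_right]
    exact hN.trans (by exact_mod_cast hn)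
  refine tendsto_const_nhds.congr' ?_
  filter_upwards [this] with n hn
  have e : (Configuration.ofFinset (g a)).1 ∩ Metric.closedBall 0 n = (g a : Set (Space d)) :=
    Set.inter_eq_left.2 fun z hz => hn z hz
  rw [e, Set.ncard_coe_finset]

theorem IsHamiltonian.measurable_comp {H : Finset (Space d) → EReal} (hH : IsHamiltonian H)
    {α : Type*} [MeasurableSpace α] {g : α → Finset (Space d)}
    (hg : Measurable fun a => Configuration.ofFinset (g a)) : Measurable fun a => H (g a) := by
  have h1 : Measurable[_, MeasurableSpace.comap Configuration.ofFinset inferInstance] g :=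
    measurable_comap_iff.2 hg
  exact @Measurable.comp _ _ _ _
    (MeasurableSpace.comap Configuration.ofFinset inferInstance) _ _ _ hH.measurable h1

theorem measurable_boltzmann {μ : ℝ} {H : Finset (Space d) → EReal} (hH : IsHamiltonian H)
    {α : Type*} [MeasurableSpace α] {k : ℕ} {y : α → Fin k → Space d} {f : α → Configuration d}
    (hy : Measurable y) (hf : Measurable f) (γ : Finset (Space d)) :
    Measurable fun a => boltzmann μ H (γ ∪ Finset.univ.image (y a)) (f a) := by
  have hyi : ∀ i, Measurable fun a => y a i := fun i => (measurable_pi_apply i).comp hy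
  have key : ∀ η : α → Finset (Space d), (Measurable fun a => Configuration.ofFinset (η a)) →
      Measurable fun a => Configuration.ofFinset (γ ∪ Finset.univ.image (y a) ∪ η a) := by
    intro η hη
    have := measurable_addPoints_image hyi ((measurable_addPoints γ).comp hη) Finset.univ
    convert this using 2 with a
    refine Subtype.ext ?_
    ext z
    change z ∈ ((γ ∪ Finset.univ.image (y a) ∪ η a : Finset (Space d)) : Set (Space d)) ↔
      z ∈ ((η a : Set (Space d)) ∪ γ) ∪ (Finset.univ.image (y a) : Finset (Space d))
    simp
    tauto
  have hx : Measurable fun a => Configuration.ofFinset (γ ∪ Finset.univ.image (y a)) := by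
    simpa using key (fun _ => ∅) measurable_const
  have hHx := hH.measurable_comp hx
  have hball : ∀ n : ℕ, Measurable fun a => Configuration.ofFinset ((f a).inBall 0 n) :=
    fun n => (measurable_ofFinset_inBall 0 n).comp hf
  refine EReal.measurable_exp.comp ?_
  refine Measurable.sub (Measurable.sub ?_ hHx) ?_
  · refine measurable_coe_real_ereal.comp (Measurable.mul_const ?_ μ)
    exact (measurable_from_top (f := fun n : ℕ => (n : ℝ))).comp (measurable_card_of_ofFinset hx)
  · refine Measurable.liminf fun n => ?_
    have h2 := hH.measurable_comp (hball n)
    refine Measurable.ite ?_ measurable_const ?_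
    · exact (hHx (measurableSet_singleton ⊤)).union (h2 (measurableSet_singleton ⊤))
    · exact ((hH.measurable_comp (key _ (hball n))).sub hHx).sub h2

theorem measurable_boltzmann_right {μ : ℝ} {H : Finset (Space d) → EReal} (hH : IsHamiltonian H)
    (γ : Finset (Space d)) : Measurable (boltzmann μ H γ) := by
  simpa using measurable_boltzmann (μ := μ) hH (y := fun (_ : Configuration d) (i : Fin 0) => i.elim0)
    measurable_const measurable_id γ

theorem measurable_correlation {μ : ℝ} {H : Finset (Space d) → EReal} (hH : IsHamiltonian H)
    (P : Measure (Configuration d)) [SFinite P] (γ : Finset (Space d)) (k : ℕ) :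
    Measurable fun y : Fin k → Space d => correlation μ H P (γ ∪ Finset.univ.image y) :=
  (measurable_boltzmann (μ := μ) hH measurable_fst measurable_snd γ).lintegral_prod_right'

theorem measurable_translate (a : Space d) : Measurable (Configuration.translate a) := by
  refine measurable_configuration fun Δ hb hm => ?_
  have hinj : Function.Injective fun y : Space d => y + a := add_left_injective a
  have : ∀ η : Configuration d, ((η.translate a).1 ∩ Δ).ncard =
      (η.1 ∩ (fun y => y + a) ⁻¹' Δ).ncard := fun η => by
    rw [Configuration.translate, ← Set.image_inter_preimage, Set.ncard_image_of_injective _ hinj]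
  simp only [this]
  refine measurable_count ?_ (measurable_add_const a hm)
  obtain ⟨C, hC⟩ := isBounded_iff_forall_norm_le.1 hb
  refine isBounded_iff_forall_norm_le.2 ⟨C + ‖a‖, fun y hy => ?_⟩
  calc ‖y‖ = ‖y + a - a‖ := by simp
    _ ≤ ‖y + a‖ + ‖a‖ := norm_sub_le _ _
    _ ≤ C + ‖a‖ := by linarith [hC _ hy]

/-! ### The interaction energy on tempered configurations -/

theorem IsHamiltonian.ne_bot {H : Finset (Space d) → EReal} (hH : IsHamiltonian H)
    (x : Finset (Space d)) : H x ≠ ⊥ := by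
  obtain ⟨B, _, hB⟩ := hH.stable
  intro h
  have := hB x
  rw [h] at this
  exact EReal.coe_ne_bot _ (le_bot_iff.1 this)

theorem ereal_coe_sub_top (a : ℝ) : (a : EReal) - ⊤ = ⊥ := rfl

/-- With `⊥` excluded, an infinite `w₁` or `w₂` forces `w₃ = ⊤`, and both sides are then `⊥`;
otherwise everything is real. -/
theorem ereal_sub_eq_of_add_eq {s s' h h' : ℝ} {w₁ w₂ w₃ : EReal} (hw₁ : w₁ ≠ ⊥) (hw₂ : w₂ ≠ ⊥)
    (hw₃ : w₃ ≠ ⊥) (h3 : w₃ + h' = w₂ + w₁ + h) :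
    ((s + s' : ℝ) : EReal) - h' - w₃ = (s - h - w₂) + (s' - w₁) := by
  induction w₁ with
  | bot => exact absurd rfl hw₁
  | top =>
    have : w₃ = ⊤ := by
      rw [EReal.add_top_of_ne_bot hw₂, EReal.top_add_coe] at h3
      induction w₃ with
      | bot => exact absurd rfl hw₃
      | top => rfl
      | coe w => exact absurd h3 (by rw [← EReal.coe_add]; exact EReal.coe_ne_top _)
    rw [this, ereal_coe_sub_top, EReal.add_bot, ← EReal.coe_sub, ereal_coe_sub_top]
  | coe a₁ =>
    induction w₂ with
    | bot => exact absurd rfl hw₂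
    | top =>
      have : w₃ = ⊤ := by
        rw [EReal.top_add_coe, EReal.top_add_coe] at h3
        induction w₃ with
        | bot => exact absurd rfl hw₃
        | top => rfl
        | coe w => exact absurd h3 (by rw [← EReal.coe_add]; exact EReal.coe_ne_top _)
      rw [this, ← EReal.coe_sub, ereal_coe_sub_top, ← EReal.coe_sub, ereal_coe_sub_top,
        EReal.bot_add]
    | coe a₂ =>
      induction w₃ with
      | bot => exact absurd rfl hw₃
      | top =>
        rw [EReal.top_add_coe] at h3
        exact absurd h3.symm (by rw [← EReal.coe_add, ← EReal.coe_add]; exact EReal.coe_ne_top _)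
      | coe a₃ =>
        have h4 : a₃ + h' = a₂ + a₁ + h := by exact_mod_cast h3
        have : s + s' - h' - a₃ = (s - h - a₂) + (s' - a₁) := by linarith
        exact_mod_cast this

theorem inBall_addPoints_singleton (η : Configuration d) (x : Space d) :
    ∀ᶠ n : ℕ in atTop, (η.addPoints {x}).inBall 0 n = insert x (η.inBall 0 n) := by
  obtain ⟨N, hN⟩ := exists_nat_ge ‖x‖
  filter_upwards [eventually_ge_atTop N] with n hn
  have hx : dist x 0 ≤ n := by
    rw [dist_zero_right]; exact hN.trans (by exact_mod_cast hn)
  ext z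
  rw [Configuration.mem_inBall, Finset.mem_insert, Configuration.mem_inBall]
  simp only [Configuration.addPoints, Set.mem_union, Finset.coe_singleton, Set.mem_singleton_iff]
  constructor
  · rintro ⟨h | h, h'⟩
    · exact Or.inr ⟨h, h'⟩
    · exact Or.inl h
  · rintro (rfl | h)
    · exact ⟨Or.inr rfl, hx⟩
    · exact ⟨Or.inl h.1, h.2⟩

theorem inBall_mono (η : Configuration d) (a : Space d) : Monotone fun n : ℕ => η.inBall a n := by
  intro m n hmn z hz
  rw [Configuration.mem_inBall] at hz ⊢
  exact ⟨hz.1, hz.2.trans (by exact_mod_cast hmn)⟩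

theorem finiteInteraction_eq_top {H : Finset (Space d) → EReal} (hH : IsHamiltonian H)
    {x η : Finset (Space d)} (h : H (x ∪ η) = ⊤) : finiteInteraction H x η = ⊤ := by
  rw [finiteInteraction]
  split_ifs with hc
  · rfl
  · push Not at hc
    lift H x to ℝ using ⟨hc.1, hH.ne_bot x⟩ with hx
    lift H η to ℝ using ⟨hc.2, hH.ne_bot η⟩ with hη
    rw [h, EReal.top_sub_coe, EReal.top_sub_coe]

/-- The multiplicative form of `H(x ∪ γ ∪ η) - H(η) = (H(x ∪ γ ∪ η) - H(x ∪ η)) + (H(x ∪ η) - H(η))`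
for an infinite configuration `η`. -/
theorem boltzmann_insert {μ : ℝ} {H : Finset (Space d) → EReal} (hH : IsHamiltonian H)
    {T : Set (Configuration d)} (hT : IsTemperedSet H T) {η : Configuration d} (hη : η ∈ T)
    (hfin : ∀ n : ℕ, H (η.inBall 0 n) ≠ ⊤) {γ : Finset (Space d)} {x : Space d} (hxγ : x ∉ γ)
    (hxη : x ∉ η.1) (hγη : Disjoint (γ : Set (Space d)) η.1) :
    boltzmann μ H (insert x γ) η =
      boltzmann μ H γ (η.addPoints {x}) * EReal.exp ((μ : EReal) - interaction H {x} η) := by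
  obtain ⟨w₁, hw₁, ht₁⟩ := hT.limit η hη {x} (by simpa using hxη)
  obtain ⟨w₂, hw₂, ht₂⟩ := hT.limit (η.addPoints {x}) (hT.addPoints η hη {x}) γ (by
    rw [Configuration.addPoints, Set.disjoint_union_right]
    exact ⟨hγη, by simpa using hxγ⟩)
  obtain ⟨w₃, hw₃, ht₃⟩ := hT.limit η hη (insert x γ) (by
    rw [Finset.coe_insert, Set.insert_eq, Set.disjoint_union_left]
    exact ⟨by simpa using hxη, hγη⟩)
  replace ht₁ := ht₁ 0
  replace ht₂ := ht₂ 0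
  replace ht₃ := ht₃ 0
  have ht₂' : Tendsto (fun n : ℕ => finiteInteraction H γ (insert x (η.inBall 0 n))) atTop
      (𝓝 w₂) := ht₂.congr' (by
    filter_upwards [inBall_addPoints_singleton η x] with n hn
    rw [hn])
  rw [boltzmann, boltzmann, interaction, interaction, interaction, ht₁.liminf_eq, ht₂.liminf_eq,
    ht₃.liminf_eq]
  have hsub : ∀ n : ℕ, insert x γ ∪ η.inBall 0 n = γ ∪ insert x (η.inBall 0 n) := fun n => by
    ext z; simp only [Finset.mem_union, Finset.mem_insert]; tauto
  have htop : ∀ {w : EReal} {f : ℕ → EReal}, Tendsto f atTop (𝓝 w) → (∀ᶠ n in atTop, f n = ⊤) →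
      w = ⊤ := fun hw hf => tendsto_nhds_unique hw (tendsto_const_nhds.congr' (by
        filter_upwards [hf] with n hn using hn.symm))
  -- The additive identity is meaningful only when the subtracted energies are finite. In the three
  -- exceptional cases both sides vanish, by heredity of infinite energy.
  by_cases hγ : H γ = ⊤
  · rw [hH.hereditary γ (insert x γ) (Finset.subset_insert _ _) hγ, hγ, ereal_coe_sub_top,
      ereal_coe_sub_top, EReal.bot_sub, EReal.bot_sub, EReal.exp_bot, zero_mul]
  by_cases hxγ' : H (insert x γ) = ⊤
  · have h2 : w₂ = ⊤ := htop ht₂' (Eventually.of_forall fun n => finiteInteraction_eq_top hH (by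
      rw [← hsub]
      exact hH.hereditary _ _ Finset.subset_union_left hxγ'))
    rw [hxγ', h2]
    lift H γ to ℝ using ⟨hγ, hH.ne_bot γ⟩ with h
    rw [← EReal.coe_sub, ereal_coe_sub_top, ereal_coe_sub_top, EReal.bot_sub, EReal.exp_bot,
      zero_mul]
  by_cases ha : ∃ n₀ : ℕ, H (insert x (η.inBall 0 n₀)) = ⊤
  · obtain ⟨n₀, hn₀⟩ := ha
    have hn : ∀ n ≥ n₀, H (insert x (η.inBall 0 n)) = ⊤ := fun n hn =>
      hH.hereditary _ _ (Finset.insert_subset_insert _ (inBall_mono η 0 hn)) hn₀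
    have h1 : w₁ = ⊤ := htop ht₁ (by
      filter_upwards [eventually_ge_atTop n₀] with n h
      refine finiteInteraction_eq_top hH ?_
      rw [← Finset.insert_eq]
      exact hn n h)
    have h3 : w₃ = ⊤ := htop ht₃ (by
      filter_upwards [eventually_ge_atTop n₀] with n h
      refine finiteInteraction_eq_top hH ?_
      rw [hsub]
      exact hH.hereditary _ _ Finset.subset_union_right (hn n h))
    rw [h1, h3]
    lift H (insert x γ) to ℝ using ⟨hxγ', hH.ne_bot _⟩ with h
    rw [← EReal.coe_sub, ereal_coe_sub_top, ereal_coe_sub_top, EReal.exp_bot, mul_zero]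
  push Not at ha
  have hadd : w₃ + H (insert x γ) = w₂ + w₁ + H γ := by
    have hcoe : ∀ {w : EReal} {f : ℕ → EReal} (h : ℝ), Tendsto f atTop (𝓝 w) →
        Tendsto (fun n => f n + (h : EReal)) atTop (𝓝 (w + h)) := fun h hf =>
      (EReal.continuousAt_add (Or.inr (EReal.coe_ne_bot h))
        (Or.inr (EReal.coe_ne_top h))).tendsto.comp (hf.prodMk_nhds tendsto_const_nhds)
    have h21 : Tendsto (fun n : ℕ => finiteInteraction H γ (insert x (η.inBall 0 n)) +
        finiteInteraction H {x} (η.inBall 0 n)) atTop (𝓝 (w₂ + w₁)) :=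
      (EReal.continuousAt_add (Or.inr hw₁) (Or.inl hw₂)).tendsto.comp (ht₂'.prodMk_nhds ht₁)
    -- Telescoping in finite volume; only the energy of the full union may still be infinite, and
    -- then both sides are `⊤`.
    have hfi : ∀ n : ℕ, finiteInteraction H (insert x γ) (η.inBall 0 n) + H (insert x γ) =
        finiteInteraction H γ (insert x (η.inBall 0 n)) +
          finiteInteraction H {x} (η.inBall 0 n) + H γ := by
      intro n
      have hx0 : H {x} ≠ ⊤ := by rw [hH.singleton]; exact EReal.zero_ne_top
      rw [finiteInteraction, finiteInteraction, finiteInteraction, if_neg (by simp [hxγ', hfin n]),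
        if_neg (by simp [hγ, ha n]), if_neg (by simp [hx0, hfin n]), hsub n, ← Finset.insert_eq,
        hH.singleton]
      have hbot := hH.ne_bot (γ ∪ insert x (η.inBall 0 n))
      generalize H (γ ∪ insert x (η.inBall 0 n)) = c at hbot ⊢
      lift H (insert x γ) to ℝ using ⟨hxγ', hH.ne_bot _⟩ with h'
      lift H γ to ℝ using ⟨hγ, hH.ne_bot _⟩ with h
      have hu := hfin n
      have hu' := hH.ne_bot (η.inBall 0 n)
      have hv := ha n
      have hv' := hH.ne_bot (insert x (η.inBall 0 n))
      generalize H (insert x (η.inBall 0 n)) = v at hv hv' ⊢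
      generalize H (η.inBall 0 n) = u at hu hu' ⊢
      lift v to ℝ using ⟨hv, hv'⟩
      lift u to ℝ using ⟨hu, hu'⟩
      induction c with
      | bot => exact absurd rfl hbot
      | top =>
        rw [EReal.top_sub_coe, EReal.top_sub_coe, EReal.top_add_coe, EReal.top_sub_coe,
          EReal.top_sub_coe, sub_zero, ← EReal.coe_sub, EReal.top_add_coe, EReal.top_add_coe]
      | coe c =>
        have : c - h' - u + h' = (c - h - v) + (v - 0 - u) + h := by ring
        exact_mod_cast this
    lift H (insert x γ) to ℝ using ⟨hxγ', hH.ne_bot _⟩ with h'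
    lift H γ to ℝ using ⟨hγ, hH.ne_bot _⟩ with h
    refine tendsto_nhds_unique (hcoe h' ht₃) ?_
    simp only [hfi]
    exact hcoe h h21
  rw [← EReal.exp_add]
  congr 1
  lift H (insert x γ) to ℝ using ⟨hxγ', hH.ne_bot _⟩ with h'
  lift H γ to ℝ using ⟨hγ, hH.ne_bot _⟩ with h
  have hcard : ((insert x γ).card * μ : ℝ) = γ.card * μ + μ := by
    rw [Finset.card_insert_of_notMem hxγ]
    push_cast
    ring
  rw [hcard]
  exact ereal_sub_eq_of_add_eq hw₁ hw₂ hw₃ hadd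

section Gibbs

variable {μ : ℝ} {H : Finset (Space d) → EReal} {P : Measure (Configuration d)}

/-- The GNZ equation is tested with the indicator of the single position `z`: its right-hand side
vanishes because `{z}` is a Lebesgue null set. -/
theorem IsGibbs.ae_notMem [Nontrivial (Space d)] (hG : IsGibbs μ H P) (z : Space d) :
    ∀ᵐ η ∂P, z ∉ η.1 := by
  have hz : MeasurableSet {η : Configuration d | z ∈ η.1} :=
    measurableSet_mem_configuration measurable_const measurable_id
  let G : Space d → Configuration d → ℝ≥0∞ := fun x _ => if x = z then 1 else 0
  have hGm : Measurable (Function.uncurry G) :=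
    Measurable.ite (measurable_fst (measurableSet_singleton z)) measurable_const measurable_const
  have h := hG.gnz G hGm
  have hr : ∫⁻ x : Space d, ∫⁻ η, G x (η.addPoints {x}) *
      EReal.exp ((μ : EReal) - interaction H {x} η) ∂P = 0 := by
    rw [lintegral_congr_ae (g := fun _ => 0), lintegral_zero]
    have : ∀ᵐ x : Space d, x ≠ z := by simp [ae_iff]
    filter_upwards [this] with x hx
    simp [G, hx]
  rw [hr] at h
  have hl : ∀ η : Configuration d, {η : Configuration d | z ∈ η.1}.indicator 1 η ≤
      ∑' x : η.1, G x η := by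
    intro η
    by_cases hη : z ∈ η.1
    · rw [Set.indicator_of_mem (by exact hη)]
      refine le_trans ?_ (ENNReal.le_tsum (⟨z, hη⟩ : η.1))
      simp [G]
    · rw [Set.indicator_of_notMem (by exact hη)]
      exact zero_le
  have h0 : P {η : Configuration d | z ∈ η.1} = 0 := by
    rw [← lintegral_indicator_one hz]
    exact le_antisymm ((lintegral_mono hl).trans h.le) zero_le
  rw [ae_iff]
  simpa using h0

theorem IsGibbs.ae_disjoint [Nontrivial (Space d)] (hG : IsGibbs μ H P) (γ : Finset (Space d)) :
    ∀ᵐ η ∂P, Disjoint (γ : Set (Space d)) η.1 := by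
  have : ∀ᵐ η ∂P, ∀ z ∈ γ, z ∉ η.1 := by
    rw [Finset.eventually_all]
    exact fun z _ => hG.ae_notMem z
  filter_upwards [this] with η hη
  exact Set.disjoint_left.2 fun z hz => hη z hz

theorem IsGibbs.correlation_empty [IsProbabilityMeasure P] (hH : IsHamiltonian H)
    (hG : IsGibbs μ H P) : correlation μ H P ∅ = 1 := by
  rw [correlation, lintegral_congr_ae (g := fun _ => 1)]
  · simp
  · filter_upwards [hG.finite_energy] with η hη
    have hi : interaction H ∅ η = 0 := by
      have : ∀ n : ℕ, finiteInteraction H ∅ (η.inBall 0 n) = 0 := by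
        intro n
        rw [finiteInteraction, hH.empty, if_neg (by simp [hη n]), Finset.empty_union, sub_zero]
        exact EReal.sub_self (hη n) (hH.ne_bot _)
      simp [interaction, this]
    simp [boltzmann, hi, hH.empty]

theorem translate_inBall (η : Configuration d) (x : Space d) (n : ℕ) :
    (η.translate (-x)).inBall 0 n = (η.inBall x n).image fun y => y + -x := by
  ext z
  rw [Configuration.mem_inBall, Finset.mem_image]
  simp only [Configuration.mem_inBall, Configuration.translate, Set.mem_image]
  constructor
  · rintro ⟨⟨y, hy, rfl⟩, h⟩
    refine ⟨y, ⟨hy, ?_⟩, rfl⟩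
    rwa [dist_zero_right, ← sub_eq_add_neg, ← dist_eq_norm] at h
  · rintro ⟨y, ⟨hy, h⟩, rfl⟩
    refine ⟨⟨y, hy, rfl⟩, ?_⟩
    rwa [dist_zero_right, ← sub_eq_add_neg, ← dist_eq_norm]

/-- After translation by `-x`, balls around the origin become balls around `x`. Temperedness makes
the limit independent of the centre, so the interaction energy is invariant almost surely. -/
theorem IsGibbs.correlation_singleton [Nontrivial (Space d)] (hH : IsHamiltonian H)
    (hG : IsGibbs μ H P) (hP : TranslationInvariant P) (x : Space d) :
    correlation μ H P {x} = correlation μ H P {0} := by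
  have hmap : P.map (Configuration.translate (-x)) = P := by
    ext S hS
    rw [Measure.map_apply (measurable_translate _) hS, hP _ S hS]
  obtain ⟨T, hT, hPT⟩ := hG.tempered
  rw [correlation, correlation]
  conv_rhs => rw [← hmap]
  rw [lintegral_map (measurable_boltzmann_right hH _) (measurable_translate _)]
  refine lintegral_congr_ae ?_
  filter_upwards [hPT, hG.ae_notMem x] with η hη hx
  obtain ⟨w, -, hw⟩ := hT.limit η hη {x} (by simpa using hx)
  have h1 : interaction H {x} η = w := (hw 0).liminf_eq
  have h2 : interaction H {0} (η.translate (-x)) = w := by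
    have : ∀ n : ℕ, finiteInteraction H {0} ((η.translate (-x)).inBall 0 n) =
        finiteInteraction H {x} (η.inBall x n) := by
      intro n
      have e0 : ({0} : Finset (Space d)) = ({x} : Finset (Space d)).image fun y => y + -x := by
        simp
      rw [finiteInteraction, finiteInteraction, translate_inBall, e0, ← Finset.image_union,
        hH.translate, hH.translate, hH.translate]
    rw [interaction]
    simp only [this]
    exact (hw x).liminf_eq
  rw [boltzmann, boltzmann, h1, h2, hH.singleton, hH.singleton, Finset.card_singleton,
    Finset.card_singleton]

end Gibbs

/-! ### Expansion of the Janossy densities -/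

section Janossy

variable {μ : ℝ} {H : Finset (Space d) → EReal} {P : Measure (Configuration d)}
  {Λ : Set (Space d)}

/-- The factorial moments of the number of points in `Λ`, weighted with the Boltzmann factor of a
finite set of further points. -/
def factorialMoment (μ : ℝ) (H : Finset (Space d) → EReal) (P : Measure (Configuration d))
    (Λ : Set (Space d)) (k : ℕ) (γ : Finset (Space d)) : ℝ≥0∞ :=
  ∫⁻ η, ((η.1 ∩ Λ).ncard.descFactorial k : ℝ≥0∞) * boltzmann μ H γ η ∂P

theorem measurable_descFactorial_count (hb : Bornology.IsBounded Λ) (hm : MeasurableSet Λ)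
    (f : ℕ → ℕ) : Measurable fun η : Configuration d => (f (η.1 ∩ Λ).ncard : ℝ≥0∞) :=
  (measurable_from_top (f := fun n : ℕ => (f n : ℝ≥0∞))).comp (measurable_count hb hm)

theorem tsum_indicator_configuration (hb : Bornology.IsBounded Λ) (η : Configuration d)
    (c : ℝ≥0∞) : ∑' x : η.1, Λ.indicator (fun _ => c) (x : Space d) = (η.1 ∩ Λ).ncard * c := by
  rw [tsum_subtype η.1 (Λ.indicator fun _ => c), Set.indicator_indicator,
    ← tsum_subtype (η.1 ∩ Λ) fun _ => c, ENNReal.tsum_set_const,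
    ← (η.2 Λ hb).cast_ncard_eq]
  simp

/-- The GNZ equation trades one factor of the falling factorial for an integral over a new point.
Its Boltzmann weight merges with that of `γ` by `boltzmann_insert`. -/
theorem IsGibbs.factorialMoment_succ [Nontrivial (Space d)] (hH : IsHamiltonian H)
    (hG : IsGibbs μ H P) (hb : Bornology.IsBounded Λ) (hm : MeasurableSet Λ) (k : ℕ)
    (γ : Finset (Space d)) :
    factorialMoment μ H P Λ (k + 1) γ = ∫⁻ x in Λ, factorialMoment μ H P Λ k (insert x γ) := by
  obtain ⟨T, hT, hPT⟩ := hG.tempered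
  -- The point summed over belongs to `η`, hence the `- 1`: summation over the points in `Λ`
  -- restores the falling factorial of order `k + 1`, while on the other side the added point
  -- compensates the shift.
  let c : Configuration d → ℝ≥0∞ := fun η =>
    (((η.1 ∩ Λ).ncard - 1).descFactorial k : ℝ≥0∞) * boltzmann μ H γ η
  have hc : Measurable c := (measurable_descFactorial_count hb hm
    fun n => (n - 1).descFactorial k).mul (measurable_boltzmann_right hH γ)
  let G : Space d → Configuration d → ℝ≥0∞ := fun x η => Λ.indicator (fun _ => c η) x
  have hGm : Measurable (Function.uncurry G) := by
    have : Function.uncurry G = (Prod.fst ⁻¹' Λ).indicator fun p => c p.2 := by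
      funext p
      rfl
    rw [this]
    exact (hc.comp measurable_snd).indicator (measurable_fst hm)
  have hgnz := hG.gnz G hGm
  have hleft : ∫⁻ η, ∑' x : η.1, G x η ∂P = factorialMoment μ H P Λ (k + 1) γ := by
    refine lintegral_congr fun η => ?_
    simp only [G]
    rw [tsum_indicator_configuration hb η (c η), ← mul_assoc]
    congr 1
    cases (η.1 ∩ Λ).ncard with
    | zero => simp
    | succ n => rw [Nat.succ_descFactorial_succ]; simp
  rw [← hleft, hgnz, ← lintegral_indicator hm]
  refine lintegral_congr_ae ?_
  have hxγ : ∀ᵐ x : Space d, x ∉ γ := by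
    rw [ae_iff]
    simpa using γ.finite_toSet.measure_zero volume
  filter_upwards [hxγ] with x hx
  by_cases hxΛ : x ∈ Λ
  · rw [Set.indicator_of_mem hxΛ]
    refine lintegral_congr_ae ?_
    filter_upwards [hPT, hG.finite_energy, hG.ae_notMem x, hG.ae_disjoint γ] with η h1 h2 h3 h4
    simp only [G, Set.indicator_of_mem hxΛ, c]
    rw [boltzmann_insert hH hT h1 h2 hx h3 h4, ncard_addPoints_singleton _ _ hb,
      if_pos ⟨hxΛ, h3⟩, Nat.add_sub_cancel, mul_assoc]
  · simp [G, hxΛ]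

theorem lintegral_pi_succ {k : ℕ} {f : (Fin (k + 1) → Space d) → ℝ≥0∞} (hf : Measurable f) :
    ∫⁻ y in Set.univ.pi fun _ => Λ, f y =
      ∫⁻ x in Λ, ∫⁻ y in Set.univ.pi fun _ : Fin k => Λ, f (Fin.cons x y) := by
  rw [volume_pi, volume_pi, Measure.restrict_pi_pi, Measure.restrict_pi_pi]
  have hmp := measurePreserving_piFinSuccAbove
    (fun _ : Fin (k + 1) => (volume : Measure (Space d)).restrict Λ) 0
  rw [← hmp.symm.lintegral_comp hf,
    lintegral_prod (fun a => f ((MeasurableEquiv.piFinSuccAbove (fun _ => Space d) 0).symm a))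
      (hf.comp (MeasurableEquiv.measurable _)).aemeasurable]
  exact lintegral_congr fun x => lintegral_congr fun y => congrArg f (Fin.insertNth_zero' x y)

theorem IsGibbs.factorialMoment_eq [Nontrivial (Space d)] [SFinite P] (hH : IsHamiltonian H)
    (hG : IsGibbs μ H P) (hb : Bornology.IsBounded Λ) (hm : MeasurableSet Λ) (k : ℕ)
    (γ : Finset (Space d)) :
    factorialMoment μ H P Λ k γ = ∫⁻ y in Set.univ.pi fun _ : Fin k => Λ,
      correlation μ H P (γ ∪ Finset.univ.image y) := by
  induction k generalizing γ with
  | zero =>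
    have : (Set.univ.pi fun _ : Fin 0 => Λ) = Set.univ := by ext; simp
    rw [this, Measure.restrict_univ, lintegral_fin_zero]
    simp [factorialMoment, correlation]
  | succ k ih =>
    rw [hG.factorialMoment_succ hH hb hm, lintegral_pi_succ (measurable_correlation hH P γ (k + 1))]
    refine lintegral_congr fun x => ?_
    rw [ih]
    refine lintegral_congr fun y => ?_
    congr 1
    ext z
    simp only [Finset.mem_union, Finset.mem_insert, Finset.mem_image, Finset.mem_univ, true_and,
      Fin.exists_fin_succ, Fin.cons_zero, Fin.cons_succ]
    rw [eq_comm (a := z)]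
    tauto

theorem correlation_le [IsProbabilityMeasure P] (hH : IsHamiltonian H) (hG : IsGibbs μ H P)
    (hR : RuelleBound μ H P) : ∃ ξ : ℝ, 0 < ξ ∧ ∀ x : Finset (Space d),
      correlation μ H P x ≤ ENNReal.ofReal (ξ ^ x.card) := by
  obtain ⟨ξ, hξ, h⟩ := hR
  refine ⟨ξ, hξ, fun x => ?_⟩
  rcases x.eq_empty_or_nonempty with rfl | hx
  · simp [hG.correlation_empty hH]
  · exact h x hx

theorem atPoints_dOp_ae [Nontrivial (Space d)] (γ : Finset (Space d))
    (F : Finset (Space d) → ℝ) (k : ℕ) :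
    (fun y : Fin k → Space d => atPoints (dOp γ F) y) =ᵐ[volume]
      fun y => F (γ ∪ Finset.univ.image y) := by
  filter_upwards [ae_notMem_finset γ k] with y hy
  rw [atPoints, dOp, if_pos hy, Finset.union_comm]

theorem aemeas_dOp_rho [Nontrivial (Space d)] [SFinite P] (hH : IsHamiltonian H)
    (γ : Finset (Space d)) : AEMeas (dOp γ (rho μ H P)) := fun k =>
  ((measurable_correlation (μ := μ) hH P γ k).ennreal_toReal.aestronglyMeasurable).congr
    (atPoints_dOp_ae γ (rho μ H P) k).symm

theorem factorialMoment_le [Nontrivial (Space d)] [IsProbabilityMeasure P] (hH : IsHamiltonian H)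
    (hG : IsGibbs μ H P) {ξ : ℝ} (hξ : 0 < ξ)
    (hR : ∀ x : Finset (Space d), correlation μ H P x ≤ ENNReal.ofReal (ξ ^ x.card))
    (hb : Bornology.IsBounded Λ) (hm : MeasurableSet Λ) (k : ℕ) (γ : Finset (Space d)) :
    factorialMoment μ H P Λ k γ ≤
      ENNReal.ofReal (ξ ^ γ.card * (ξ * (volume Λ).toReal) ^ k) := by
  rw [hG.factorialMoment_eq hH hb hm]
  have hle : ∀ᵐ y : Fin k → Space d, correlation μ H P (γ ∪ Finset.univ.image y) ≤
      ENNReal.ofReal (ξ ^ (γ.card + k)) := by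
    filter_upwards [ae_injective k, ae_notMem_finset γ k] with y hy hyγ
    refine (hR _).trans (le_of_eq ?_)
    rw [Finset.card_union_of_disjoint hyγ.symm, card_image_univ hy]
  refine (lintegral_mono_ae (ae_restrict_of_ae hle)).trans (le_of_eq ?_)
  rw [lintegral_const, Measure.restrict_apply_univ, volume_pi_pi, Finset.prod_const,
    Finset.card_univ, Fintype.card_fin, mul_pow, ← mul_assoc, ← pow_add,
    ENNReal.ofReal_mul (by positivity), ENNReal.ofReal_pow (p := (volume Λ).toReal)
      ENNReal.toReal_nonneg, ENNReal.ofReal_toReal hb.measure_lt_top.ne]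

theorem absTerm_res_dOp_rho [Nontrivial (Space d)] [IsProbabilityMeasure P]
    (hH : IsHamiltonian H) (hG : IsGibbs μ H P)
    (hfin : ∀ x : Finset (Space d), correlation μ H P x ≠ ∞)
    (hb : Bornology.IsBounded Λ) (hm : MeasurableSet Λ) (k : ℕ) (γ : Finset (Space d)) :
    absTerm (res Λ (dOp γ (rho μ H P))) k =
      ENNReal.ofReal (k.factorial : ℝ)⁻¹ * factorialMoment μ H P Λ k γ := by
  rw [absTerm_res hm, hG.factorialMoment_eq hH hb hm]
  congr 1
  refine lintegral_congr_ae (ae_restrict_of_ae ?_)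
  filter_upwards [atPoints_dOp_ae γ (rho μ H P) k] with y hy
  rw [hy, rho, Real.enorm_eq_ofReal ENNReal.toReal_nonneg, ENNReal.ofReal_toReal (hfin _)]

theorem absConv_res_dOp_rho [Nontrivial (Space d)] [IsProbabilityMeasure P]
    (hH : IsHamiltonian H) (hG : IsGibbs μ H P) (hR : RuelleBound μ H P)
    (hb : Bornology.IsBounded Λ) (hm : MeasurableSet Λ) (γ : Finset (Space d)) :
    AbsConv (res Λ (dOp γ (rho μ H P))) := by
  obtain ⟨ξ, hξ, hR⟩ := correlation_le hH hG hR
  refine ⟨(aemeas_dOp_rho hH γ).res hm, ?_⟩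
  have hfin : ∀ x : Finset (Space d), correlation μ H P x ≠ ∞ := fun x =>
    ne_top_of_le_ne_top ENNReal.ofReal_ne_top (hR x)
  have hs : Summable fun k : ℕ =>
      ξ ^ γ.card * ((ξ * (volume Λ).toReal) ^ k / (k.factorial : ℝ)) :=
    (Real.summable_pow_div_factorial _).mul_left _
  refine ne_top_of_le_ne_top hs.tsum_ofReal_ne_top (ENNReal.tsum_le_tsum fun k => ?_)
  rw [absTerm_res_dOp_rho hH hG hfin hb hm]
  refine (mul_le_mul_right (factorialMoment_le hH hG hξ hR hb hm k γ) _).trans (le_of_eq ?_)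
  rw [← ENNReal.ofReal_mul (by positivity)]
  congr 1
  ring

/-- Binomial expansion of `(1 - 1)^n`. Applied to the number of points in `Λ`, it produces the
indicator of the event that `Λ` is empty. -/
theorem tsum_alternating_choose (n : ℕ) :
    ∑' k : ℕ, (-1 : ℝ) ^ k / (k.factorial : ℝ) * (n.descFactorial k : ℝ) =
      if n = 0 then 1 else 0 := by
  have h : ∀ k : ℕ, (-1 : ℝ) ^ k / (k.factorial : ℝ) * (n.descFactorial k : ℝ) =
      (-1) ^ k * (n.choose k : ℝ) := fun k => by
    rw [Nat.descFactorial_eq_factorial_mul_choose]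
    have : (k.factorial : ℝ) ≠ 0 := by positivity
    push_cast
    field_simp
  simp only [h]
  rw [tsum_eq_sum (s := Finset.range (n + 1)) fun k hk => by
    rw [Nat.choose_eq_zero_of_lt (by simpa using hk)]; simp]
  have := @Int.alternating_sum_range_choose n
  exact_mod_cast congrArg (Int.cast : ℤ → ℝ) this

/-- The Janossy densities are given by the expansion of the correlation functions. -/
theorem janossy_eq_expansion [Nontrivial (Space d)] [IsProbabilityMeasure P]
    (hH : IsHamiltonian H) (hG : IsGibbs μ H P) (hR : RuelleBound μ H P)
    (hb : Bornology.IsBounded Λ) (hm : MeasurableSet Λ) (γ : Finset (Space d)) :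
    janossy μ H P Λ γ = expansion (res Λ (dOp γ (rho μ H P))) := by
  have hconv := absConv_res_dOp_rho hH hG hR hb hm γ
  obtain ⟨ξ, hξ, hR⟩ := correlation_le hH hG hR
  have hfin : ∀ x : Finset (Space d), correlation μ H P x ≠ ∞ := fun x =>
    ne_top_of_le_ne_top ENNReal.ofReal_ne_top (hR x)
  have hbm := measurable_boltzmann_right (μ := μ) hH γ
  have hbfin : ∀ᵐ η ∂P, boltzmann μ H γ η < ∞ := ae_lt_top hbm (hfin γ)
  let g : ℕ → Configuration d → ℝ≥0∞ := fun k η =>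
    ((η.1 ∩ Λ).ncard.descFactorial k : ℝ≥0∞) * boltzmann μ H γ η
  have hgm : ∀ k, Measurable (g k) := fun k =>
    (measurable_descFactorial_count hb hm fun n => n.descFactorial k).mul hbm
  have hgfin : ∀ k, ∫⁻ η, g k η ∂P ≠ ∞ := fun k =>
    ne_top_of_le_ne_top ENNReal.ofReal_ne_top (factorialMoment_le hH hG hξ hR hb hm k γ)
  have hgint : ∀ k, Integrable (fun η => (g k η).toReal) P := fun k =>
    integrable_toReal_of_lintegral_ne_top (hgm k).aemeasurable (hgfin k)
  have hgI : ∀ k, ∫ η, (g k η).toReal ∂P = (factorialMoment μ H P Λ k γ).toReal := fun k =>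
    integral_toReal (hgm k).aemeasurable (ae_lt_top (hgm k) (hgfin k))
  let F : ℕ → Configuration d → ℝ := fun k η => (-1 : ℝ) ^ k / (k.factorial : ℝ) * (g k η).toReal
  have hFint : ∀ k, Integrable (F k) P := fun k => (hgint k).const_mul _
  have hterm : ∀ k, expansionTerm (res Λ (dOp γ (rho μ H P))) k = ∫ η, F k η ∂P := by
    intro k
    rw [expansionTerm_res hm, integral_const_mul, hgI, hG.factorialMoment_eq hH hb hm]
    congr 1
    rw [integral_congr_ae (ae_restrict_of_ae (atPoints_dOp_ae γ (rho μ H P) k))]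
    exact integral_toReal (measurable_correlation hH P γ k).aemeasurable
      (Eventually.of_forall fun y => lt_top_iff_ne_top.2 (hfin _))
  have hnorm : ∀ k, ∫ η, ‖F k η‖ ∂P = (absTerm (res Λ (dOp γ (rho μ H P))) k).toReal := by
    intro k
    rw [absTerm_res_dOp_rho hH hG hfin hb hm, ENNReal.toReal_mul, ← hgI,
      ENNReal.toReal_ofReal (by positivity), ← integral_const_mul]
    refine integral_congr_ae (Eventually.of_forall fun η => ?_)
    simp only [F, norm_mul, norm_div, norm_pow, norm_neg, norm_one, one_pow, Real.norm_natCast,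
      one_div, Real.norm_of_nonneg ENNReal.toReal_nonneg]
  -- The Ruelle bound, through `absConv_res_dOp_rho`, justifies exchanging the alternating sum with
  -- the integral over configurations.
  have hsum := (hasSum_integral_of_summable_integral_norm hFint (by
    simp only [hnorm]
    exact ENNReal.summable_toReal hconv.tsum_ne_top)).tsum_eq
  rw [expansion, tsum_congr hterm, hsum]
  have hset : MeasurableSet {η : Configuration d | η.1 ∩ Λ = ∅} := by
    have : {η : Configuration d | η.1 ∩ Λ = ∅} = {η : Configuration d | (η.1 ∩ Λ).ncard = 0} := by
      ext η
      exact (Set.ncard_eq_zero (η.2 Λ hb)).symm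
    rw [this]
    exact measurable_count hb hm (measurableSet_singleton 0)
  have hpt : ∀ η : Configuration d, ∑' k, F k η =
      {η : Configuration d | η.1 ∩ Λ = ∅}.indicator (fun η => (boltzmann μ H γ η).toReal) η := by
    intro η
    have : ∀ k, F k η = (-1 : ℝ) ^ k / (k.factorial : ℝ) *
        ((η.1 ∩ Λ).ncard.descFactorial k : ℝ) * (boltzmann μ H γ η).toReal := fun k => by
      simp only [F, g, ENNReal.toReal_mul, ENNReal.toReal_natCast]
      ring
    simp only [this]
    rw [tsum_mul_right, tsum_alternating_choose]
    by_cases h0 : η.1 ∩ Λ = ∅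
    · rw [Set.indicator_of_mem (by exact h0)]
      simp [h0]
    · rw [Set.indicator_of_notMem (by exact h0),
        if_neg fun h => h0 ((Set.ncard_eq_zero (η.2 Λ hb)).1 h), zero_mul]
  simp only [hpt]
  rw [integral_indicator hset, integral_toReal hbm.aemeasurable (ae_restrict_of_ae hbfin), janossy]

end Janossy

/-! ### Bounds for the recursively defined functions -/

section Bounds

variable {ρ : Finset (Space d) → ℝ}

/-- Measurability of the truncated functions comes from division: off `x`, `D_x ρ_T` is the quotient
of `D_x ρ` by `ρ`. -/
theorem aemeas_dOp_truncated_singleton [Nontrivial (Space d)] (h : ρ ∅ = 1)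
    (hm : ∀ γ, AEMeas (dOp γ ρ)) (x : Space d) : AEMeas (dOp {x} (truncated ρ)) := by
  have hρ : AEMeas ρ := by simpa only [dOp_empty] using hm ∅
  refine aemeas_of_starMul (Z := {x}) (G := dOp {x} ρ) (fun η hη => ?_) h hρ (hm {x})
  have hx : x ∉ η := by simpa using hη
  rw [starMul_comm, dOp_singleton_apply hx, rho_insert h hx]

theorem eqOff_dOp_pair (h : ρ ∅ = 1) {x₁ x₂ : Space d} (h12 : x₁ ≠ x₂) :
    EqOff {x₁, x₂} (dOp {x₁, x₂} ρ) fun η =>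
      starMul (starMul ρ (dOp {x₁} (truncated ρ))) (dOp {x₂} (truncated ρ)) η +
        starMul ρ (dOp {x₁, x₂} (truncated ρ)) η := by
  intro η hη
  have h1 : x₁ ∉ η := fun h' => Finset.disjoint_left.1 hη h' (by simp)
  have h2 : x₂ ∉ η := fun h' => Finset.disjoint_left.1 hη h' (by simp)
  beta_reduce
  rw [← rho_insert_insert h h12 h1 h2, dOp, if_pos hη]
  congr 1
  ext z
  simp only [Finset.mem_union, Finset.mem_insert, Finset.mem_singleton]
  tauto

theorem aemeas_dOp_truncated_pair [Nontrivial (Space d)] (h : ρ ∅ = 1)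
    (hm : ∀ γ, AEMeas (dOp γ ρ)) {x₁ x₂ : Space d} (h12 : x₁ ≠ x₂) :
    AEMeas (dOp {x₁, x₂} (truncated ρ)) := by
  have hρ : AEMeas ρ := by simpa only [dOp_empty] using hm ∅
  have h1 := aemeas_dOp_truncated_singleton h hm x₁
  have h2 := aemeas_dOp_truncated_singleton h hm x₂
  refine aemeas_of_starMul (Z := {x₁, x₂}) (G := fun η => dOp {x₁, x₂} ρ η -
    starMul (starMul ρ (dOp {x₁} (truncated ρ))) (dOp {x₂} (truncated ρ)) η) (fun η hη => ?_) h hρ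
    ((hm _).sub (aemeas_starMul (aemeas_starMul hρ h1) h2))
  change _ = dOp {x₁, x₂} ρ η - _
  rw [starMul_comm, eqOff_dOp_pair h h12 η hη]
  ring

theorem normD_eq (ρ : Finset (Space d) → ℝ) (x : Space d) :
    normD ρ x = fun η => (ρ {x})⁻¹ * dOp {x} (truncated ρ) η := by
  funext η
  rw [normD, div_eq_inv_mul]

theorem aemeas_normD [Nontrivial (Space d)] (h : ρ ∅ = 1) (hm : ∀ γ, AEMeas (dOp γ ρ))
    (x : Space d) : AEMeas (normD ρ x) := by
  rw [normD_eq]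
  exact (aemeas_dOp_truncated_singleton h hm x).const_mul _

/-- Geometric series with ratio `2 q ≤ 1/2`, so that `(1 - 2 q)⁻¹ ≤ 2`. -/
theorem tailNorm_two_le {F : Finset (Space d) → ℝ} {C q : ℝ} (hC : 0 ≤ C) (hq : 0 ≤ q)
    (hq4 : 4 * q ≤ 1) (h : ∀ k, absTerm F (k + 1) ≤ ENNReal.ofReal (C * q ^ (k + 1))) :
    tailNorm 2 F ≤ ENNReal.ofReal (4 * C * q) := by
  have hs : HasSum (fun k : ℕ => C * (2 * q) * (2 * q) ^ k) (C * (2 * q) * (1 - 2 * q)⁻¹) :=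
    (hasSum_geometric_of_lt_one (by positivity) (by linarith)).mul_left _
  calc tailNorm 2 F ≤ ∑' k : ℕ, ENNReal.ofReal (C * (2 * q) * (2 * q) ^ k) := by
        refine ENNReal.tsum_le_tsum fun k => ?_
        refine (mul_le_mul_right (h k) _).trans (le_of_eq ?_)
        rw [← ENNReal.ofReal_ofNat, ← ENNReal.ofReal_pow (by norm_num),
          ← ENNReal.ofReal_mul (by positivity)]
        congr 1
        ring
    _ = ENNReal.ofReal (C * (2 * q) * (1 - 2 * q)⁻¹) := by
        rw [← ENNReal.ofReal_tsum_of_nonneg (fun k => by positivity) hs.summable, hs.tsum_eq]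
    _ ≤ _ := by
        refine ENNReal.ofReal_le_ofReal ?_
        have h2 : (1 - 2 * q)⁻¹ ≤ 2 := by
          rw [inv_le_comm₀ (by linarith) (by norm_num)]
          linarith
        calc C * (2 * q) * (1 - 2 * q)⁻¹ ≤ C * (2 * q) * 2 := by gcongr
          _ = 4 * C * q := by ring

variable {M A D : ℝ}

theorem AssumptionB.lintegral_le (hB : AssumptionB ρ M A D) (k : ℕ) {x : Finset (Space d)}
    (hx : x.card = 1 ∨ x.card = 2) :
    absTerm (dOp x (truncated ρ)) (k + 1) ≤ ENNReal.ofReal (((k + 1).factorial : ℝ)⁻¹ *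
      (((x.card + (k + 1) - 1).factorial : ℝ) * M * A ^ x.card * D ^ (k + 1) *
        ∏ p ∈ x, ρ {p})) := by
  have := hB Set.univ MeasurableSet.univ (k + 1) (by omega) x hx
  rw [Set.pi_univ, Measure.restrict_univ] at this
  rw [ENNReal.ofReal_mul (by positivity), absTerm]
  gcongr

theorem tailNorm_normD_le (hM : 0 < M) (hA : 0 < A) (hD : 0 < D) (hD4 : 4 * D ≤ 1)
    (hB : AssumptionB ρ M A D) {x : Space d} (hx : 0 < ρ {x}) :
    tailNorm 2 (normD ρ x) ≤ ENNReal.ofReal (4 * (M * A) * D) := by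
  refine tailNorm_two_le (by positivity) hD.le hD4 fun k => ?_
  rw [normD_eq, absTerm_const_mul, Real.enorm_eq_ofReal (by positivity)]
  refine (mul_le_mul_right (hB.lintegral_le k (Or.inl (Finset.card_singleton x))) _).trans
    (le_of_eq ?_)
  rw [← ENNReal.ofReal_mul (by positivity)]
  congr 1
  rw [Finset.card_singleton, Nat.add_sub_cancel_left, Finset.prod_singleton]
  have : ((k + 1).factorial : ℝ) ≠ 0 := by positivity
  field_simp

theorem tailNorm_pair_le (hM : 0 < M) (hA : 0 < A) (hD : 0 < D) (hD8 : 8 * D ≤ 1)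
    (hB : AssumptionB ρ M A D) {x₁ x₂ : Space d} (h12 : x₁ ≠ x₂) (hx₁ : 0 < ρ {x₁})
    (hx₂ : 0 < ρ {x₂}) (hx : 0 < ρ {x₁, x₂}) {b : ℝ} (hb : ρ {x₁} * ρ {x₂} ≤ b * ρ {x₁, x₂}) :
    tailNorm 2 (fun η => dOp {x₁, x₂} (truncated ρ) η / ρ {x₁, x₂}) ≤
      ENNReal.ofReal (8 * (M * A ^ 2 * b) * D) := by
  have hb0 : 0 < b := by
    have : 0 < b * ρ {x₁, x₂} := lt_of_lt_of_le (mul_pos hx₁ hx₂) hb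
    exact pos_of_mul_pos_left this hx.le
  -- For two points the factorials leave a factor `k + 2 ≤ 2 ^ (k + 1)`, which is absorbed by
  -- replacing `D` with `2 D`. The constant `b` converts the product of densities into `ρ^(2)`.
  have := tailNorm_two_le (F := fun η => dOp {x₁, x₂} (truncated ρ) η / ρ {x₁, x₂})
    (C := M * A ^ 2 * b) (q := 2 * D) (by positivity) (by positivity) (by linarith) fun k => ?_
  · refine this.trans (le_of_eq ?_)
    congr 1
    ring
  simp only [div_eq_inv_mul]
  rw [absTerm_const_mul, Real.enorm_eq_ofReal (by positivity)]
  have hc : ({x₁, x₂} : Finset (Space d)).card = 2 := Finset.card_pair h12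
  refine (mul_le_mul_right (hB.lintegral_le k (Or.inr hc)) _).trans ?_
  rw [← ENNReal.ofReal_mul (by positivity)]
  refine ENNReal.ofReal_le_ofReal ?_
  rw [hc, show 2 + (k + 1) - 1 = (k + 1) + 1 by omega, Nat.factorial_succ (k + 1),
    Finset.prod_pair h12]
  have h2 : (((k + 1 + 1 : ℕ)) : ℝ) ≤ 2 ^ (k + 1) := by
    exact_mod_cast (Nat.lt_two_pow_self (n := k + 1))
  have hfac : ((k + 1).factorial : ℝ) ≠ 0 := by positivity
  have hr : (ρ {x₁, x₂})⁻¹ * (ρ {x₁} * ρ {x₂}) ≤ b := by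
    rw [inv_mul_le_iff₀ hx, mul_comm _ b]
    exact hb
  calc (ρ {x₁, x₂})⁻¹ * (((k + 1).factorial : ℝ)⁻¹ *
        (((k + 1 + 1) * (k + 1).factorial : ℕ) * M * A ^ 2 * D ^ (k + 1) * (ρ {x₁} * ρ {x₂})))
      = ((k + 1 + 1 : ℕ) : ℝ) * (M * A ^ 2 * D ^ (k + 1)) *
        ((ρ {x₁, x₂})⁻¹ * (ρ {x₁} * ρ {x₂})) := by
        push_cast
        field_simp
    _ ≤ 2 ^ (k + 1) * (M * A ^ 2 * D ^ (k + 1)) * b := by gcongr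
    _ = M * A ^ 2 * b * (2 * D) ^ (k + 1) := by rw [mul_pow]; ring

theorem absConv_omega1 [Nontrivial (Space d)] (h : ρ ∅ = 1) (hm : ∀ γ, AEMeas (dOp γ ρ))
    {x : Space d} (hx : ρ {x} ≠ 0) (ht : tailNorm 2 (normD ρ x) ≤ 2⁻¹) :
    AbsConv (omega1 ρ x) := by
  refine absConv_of_starExp (omega1_empty h hx) ?_ ?_ <;> rw [starExp_omega1 h hx]
  · exact aemeas_normD h hm x
  · exact ht

theorem tailNorm_congr_add_starOne (t : ℝ≥0∞) {F Q : Finset (Space d) → ℝ} {c : ℝ}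
    (h : ∀ η, F η = Q η + c * starOne η) : tailNorm t F = tailNorm t Q := by
  have : ∀ k, absTerm F (k + 1) = absTerm Q (k + 1) := by
    intro k
    have hy : ∀ y : Fin (k + 1) → Space d, atPoints F y = atPoints Q y := fun y => by
      have := atPoints_starOne_succ y
      simp only [atPoints, h] at *
      rw [this, mul_zero, add_zero]
    simp only [absTerm, hy]
  simp only [tailNorm, this]

/-- The defining equation is divided by the two one-point factors in turn. This bounds the tail of
`exp^∗ ω_{x₁,x₂}`, whose star-logarithm is then controlled. In `hDb`, the first two summands make
the geometric series converge and the divisors close to the unit; the other two are twice the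
coefficients of the final tail bound, which must not exceed `1/2`. -/
theorem absConv_omega2 [Nontrivial (Space d)] (h : ρ ∅ = 1) (hm : ∀ γ, AEMeas (dOp γ ρ))
    (hM : 0 < M) (hA : 0 < A) (hD : 0 < D) (hB : AssumptionB ρ M A D) {x₁ x₂ : Space d}
    (h12 : x₁ ≠ x₂) (hx₁ : 0 < ρ {x₁}) (hx₂ : 0 < ρ {x₂}) (hx : 0 < ρ {x₁, x₂}) {b : ℝ}
    (hb : ρ {x₁} * ρ {x₂} ≤ b * ρ {x₁, x₂})
    (hDb : D * (8 + 8 * (M * A) + 64 * (M * A ^ 2 * (1 + b)) + 48 * (M * A * (1 + b))) ≤ 1) :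
    AbsConv (omega2 ρ x₁ x₂) := by
  have hb0 : 0 < b := by
    have : 0 < b * ρ {x₁, x₂} := lt_of_lt_of_le (mul_pos hx₁ hx₂) hb
    exact pos_of_mul_pos_left this hx.le
  have p1 : 0 < D * (M * A) := by positivity
  have p2 : 0 < D * (M * A ^ 2 * (1 + b)) := by positivity
  have p3 : 0 < D * (M * A * (1 + b)) := by positivity
  have p4 : 0 < D * (M * A ^ 2) := by positivity
  have hD8 : 8 * D ≤ 1 := by nlinarith
  have hD4 : 4 * D ≤ 1 := by linarith
  have hf₁ := tailNorm_normD_le hM hA hD hD4 hB hx₁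
  have hf₂ := tailNorm_normD_le hM hA hD hD4 hB hx₂
  have hfhalf : ENNReal.ofReal (4 * (M * A) * D) ≤ 2⁻¹ := by
    rw [← ENNReal.ofReal_ofNat, ← ENNReal.ofReal_inv_of_pos (by norm_num)]
    exact ENNReal.ofReal_le_ofReal (by nlinarith)
  have hm₁ := aemeas_normD h hm x₁
  have hm₂ := aemeas_normD h hm x₂
  have h1₁ := normD_empty h hx₁.ne'
  have h1₂ := normD_empty h hx₂.ne'
  set c := ρ {x₁} * ρ {x₂} / ρ {x₁, x₂} with hc
  have hc0 : 0 < c := by positivity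
  have hcb : c ≤ b := by rw [hc, div_le_iff₀ hx]; exact hb
  let G : Finset (Space d) → ℝ := fun η => dOp {x₁, x₂} (truncated ρ) η / ρ {x₁, x₂}
  -- Subtracting a multiple of the unit changes only the term of order zero, so `Q` and the
  -- star-exponential have the same tail norm.
  let Q : Finset (Space d) → ℝ := fun ζ => starExp (omega2 ρ x₁ x₂) ζ - c * starOne ζ
  have hω0 := omega2_empty h h12 hx₁.ne' hx₂.ne' hx.ne'
  have hGm : AEMeas G := by
    have := (aemeas_dOp_truncated_pair h hm h12).const_mul (ρ {x₁, x₂})⁻¹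
    simpa only [G, div_eq_inv_mul] using this
  have hR : EqOff ∅ (starMul (starMul Q (normD ρ x₁)) (normD ρ x₂)) G := fun η _ =>
    (omega2_equation h h12 hx₁.ne' hx₂.ne' hx.ne' η).symm
  have hRm := aemeas_of_starMul hR h1₂ hm₂ hGm
  have hQ : EqOff ∅ (starMul Q (normD ρ x₁)) (starMul Q (normD ρ x₁)) := fun _ _ => rfl
  have hQm := aemeas_of_starMul hQ h1₁ hm₁ hRm
  have hQ0 : Q ∅ = 1 - c := by simp [Q, starExp_empty hω0, starOne]
  have hR0 : starMul Q (normD ρ x₁) ∅ = 1 - c := by rw [starMul_empty, hQ0, h1₁, mul_one]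
  have hG0 : G ∅ = 1 - c := by
    rw [← hR ∅ (Finset.disjoint_empty_left _), starMul_empty, hR0, h1₂, mul_one]
  have henorm : ‖1 - c‖ₑ ≤ ENNReal.ofReal (1 + b) := by
    rw [Real.enorm_eq_ofReal_abs]
    refine ENNReal.ofReal_le_ofReal (abs_le.2 ⟨by linarith, by linarith⟩)
  have hGt := tailNorm_pair_le hM hA hD hD8 hB h12 hx₁ hx₂ hx hb
  have hGt' : tailNorm 2 G ≤ ENNReal.ofReal (8 * (M * A ^ 2 * b) * D) := hGt
  have hRt : tailNorm 2 (starMul Q (normD ρ x₁)) ≤ ENNReal.ofReal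
      (2 * (8 * (M * A ^ 2 * b) * D + (1 + b) * (4 * (M * A) * D))) := by
    refine (tailNorm_le_of_starMul hR h1₂ hm₂ hGm (hf₂.trans hfhalf)
      (ne_top_of_le_ne_top ENNReal.ofReal_ne_top hGt')).trans ?_
    rw [ENNReal.ofReal_mul (by norm_num), ENNReal.ofReal_add (by positivity) (by positivity),
      ENNReal.ofReal_mul (p := 1 + b) (by positivity), ENNReal.ofReal_ofNat, hG0]
    gcongr
  have hQt : tailNorm 2 Q ≤ ENNReal.ofReal
      (2 * (2 * (8 * (M * A ^ 2 * b) * D + (1 + b) * (4 * (M * A) * D)) +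
        (1 + b) * (4 * (M * A) * D))) := by
    refine (tailNorm_le_of_starMul hQ h1₁ hm₁ hRm (hf₁.trans hfhalf)
      (ne_top_of_le_ne_top ENNReal.ofReal_ne_top hRt)).trans ?_
    rw [ENNReal.ofReal_mul (p := 2) (q := _ + _) (by norm_num),
      ENNReal.ofReal_add (p := 2 * _) (by positivity) (by positivity),
      ENNReal.ofReal_mul (p := 1 + b) (by positivity), ENNReal.ofReal_ofNat, hR0]
    gcongr
  have hexp : ∀ η, starExp (omega2 ρ x₁ x₂) η = Q η + c * starOne η := fun η => by
    simp only [Q]; ring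
  refine absConv_of_starExp hω0 ?_ ?_
  · have : starExp (omega2 ρ x₁ x₂) = fun η => Q η + c * starOne η := funext hexp
    rw [this]
    exact hQm.add (aemeas_starOne.const_mul c)
  · rw [tailNorm_congr_add_starOne 2 hexp]
    refine hQt.trans ?_
    rw [← ENNReal.ofReal_ofNat, ← ENNReal.ofReal_inv_of_pos (by norm_num)]
    exact ENNReal.ofReal_le_ofReal (by nlinarith)

end Bounds

/-! ### Expansions in a bounded region -/

section Region

variable {ρ : Finset (Space d) → ℝ} {Λ : Set (Space d)}

theorem AbsConv.normD [Nontrivial (Space d)] (h : ρ ∅ = 1) {x : Space d} (hx : ρ {x} ≠ 0)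
    (hω : AbsConv (omega1 ρ x)) : AbsConv (normD ρ x) := by
  rw [← starExp_omega1 h hx]
  exact hω.starExp (omega1_empty h hx)

theorem dOp_singleton_eq_mul_normD {x : Space d} (hx : ρ {x} ≠ 0) :
    dOp {x} (truncated ρ) = fun η => ρ {x} * normD ρ x η := by
  funext η
  rw [InverseGibbs.normD, mul_div_cancel₀ _ hx]

theorem res_const_mul (c : ℝ) (F : Finset (Space d) → ℝ) :
    res Λ (fun η => c * F η) = fun η => c * res Λ F η := by
  funext η
  simp [res]

theorem res_add (F G : Finset (Space d) → ℝ) :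
    res Λ (fun η => F η + G η) = fun η => res Λ F η + res Λ G η := by
  funext η
  simp only [res]
  split_ifs <;> simp

theorem res_starOne : res Λ (starOne : Finset (Space d) → ℝ) = starOne := res_starPow Λ 0 0

theorem EqOff.res {Z : Finset (Space d)} {F G : Finset (Space d) → ℝ} (h : EqOff Z F G) :
    EqOff Z (res Λ F) (res Λ G) := by
  intro η hη
  simp only [InverseGibbs.res, h η hη]

theorem expansion_res_normD [Nontrivial (Space d)] (h : ρ ∅ = 1) (hm : MeasurableSet Λ)
    {x : Space d} (hx : ρ {x} ≠ 0) (hω : AbsConv (omega1 ρ x)) :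
    expansion (res Λ (normD ρ x)) = Real.exp (expansion (res Λ (omega1 ρ x))) := by
  rw [← starExp_omega1 h hx, res_starExp, (hω.res hm).expansion_starExp]
  rw [res_empty, omega1_empty h hx]

theorem AbsConv.truncated_singleton [Nontrivial (Space d)] (h : ρ ∅ = 1) {x : Space d}
    (hx : ρ {x} ≠ 0) (hω : AbsConv (omega1 ρ x)) : AbsConv (dOp {x} (truncated ρ)) := by
  rw [dOp_singleton_eq_mul_normD hx]
  exact (hω.normD h hx).const_mul _

theorem expansion_res_truncated_singleton [Nontrivial (Space d)] (h : ρ ∅ = 1)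
    (hm : MeasurableSet Λ) {x : Space d} (hx : ρ {x} ≠ 0) (hω : AbsConv (omega1 ρ x)) :
    expansion (res Λ (dOp {x} (truncated ρ))) =
      ρ {x} * Real.exp (expansion (res Λ (omega1 ρ x))) := by
  rw [dOp_singleton_eq_mul_normD hx, res_const_mul, expansion_const_mul,
    expansion_res_normD h hm hx hω]

/-- The quotient of the one-point and the empty Janossy densities. -/
theorem expansion_res_dOp_singleton [Nontrivial (Space d)] (h : ρ ∅ = 1)
    (hm : MeasurableSet Λ) (hρ : AbsConv (res Λ ρ)) {x : Space d} (hx : ρ {x} ≠ 0)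
    (hω : AbsConv (omega1 ρ x)) :
    expansion (res Λ (dOp {x} ρ)) =
      expansion (res Λ ρ) * (ρ {x} * Real.exp (expansion (res Λ (omega1 ρ x)))) := by
  have heq : EqOff {x} (dOp {x} ρ) (starMul ρ (dOp {x} (truncated ρ))) := fun η hη => by
    have hxη : x ∉ η := by simpa using hη
    rw [dOp_singleton_apply hxη, rho_insert h hxη]
  rw [heq.res.expansion_eq, res_starMul,
    hρ.expansion_starMul ((hω.truncated_singleton h hx).res hm),
    expansion_res_truncated_singleton h hm hx hω]

/-- The quotient of the two-point and the empty Janossy densities. -/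
theorem expansion_res_dOp_pair [Nontrivial (Space d)] (h : ρ ∅ = 1) (hm : MeasurableSet Λ)
    (hρ : AbsConv (res Λ ρ)) {x₁ x₂ : Space d} (h12 : x₁ ≠ x₂) (hx₁ : ρ {x₁} ≠ 0)
    (hx₂ : ρ {x₂} ≠ 0) (hx : ρ {x₁, x₂} ≠ 0) (hω₁ : AbsConv (omega1 ρ x₁))
    (hω₂ : AbsConv (omega1 ρ x₂)) (hω : AbsConv (omega2 ρ x₁ x₂)) :
    expansion (res Λ (dOp {x₁, x₂} ρ)) =
      expansion (res Λ ρ) * (ρ {x₁, x₂} * Real.exp (expansion (res Λ (omega2 ρ x₁ x₂))) *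
        (Real.exp (expansion (res Λ (omega1 ρ x₁))) *
          Real.exp (expansion (res Λ (omega1 ρ x₂))))) := by
  have hω0 := omega2_empty h h12 hx₁ hx₂ hx
  set c := ρ {x₁} * ρ {x₂} / ρ {x₁, x₂} with hc
  have hT₁ := (hω₁.truncated_singleton h hx₁).res hm
  have hT₂ := (hω₂.truncated_singleton h hx₂).res hm
  have hN₁ := (hω₁.normD h hx₁).res hm
  have hN₂ := (hω₂.normD h hx₂).res hm
  let Q : Finset (Space d) → ℝ := fun ζ => starExp (omega2 ρ x₁ x₂) ζ + -c * starOne ζ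
  have hE := (hω.starExp hω0).res hm
  have hone : AbsConv fun η : Finset (Space d) => -c * starOne η := absConv_starOne.const_mul (-c)
  have hQres : res Λ Q = fun η => res Λ (starExp (omega2 ρ x₁ x₂)) η + -c * starOne η := by
    simp only [Q]
    rw [res_add, res_const_mul, res_starOne]
  have hQ : AbsConv (res Λ Q) := by
    rw [hQres]
    exact hE.add hone
  have hQexp : expansion (res Λ Q) = Real.exp (expansion (res Λ (omega2 ρ x₁ x₂))) - c := by
    rw [hQres, hE.expansion_add hone, expansion_const_mul, expansion_starOne, res_starExp,
      (hω.res hm).expansion_starExp (by rw [res_empty, hω0])]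
    ring
  have hG : dOp {x₁, x₂} (truncated ρ) =
      fun η => ρ {x₁, x₂} * starMul (starMul Q (normD ρ x₁)) (normD ρ x₂) η := by
    have hQ' : Q = fun ζ => starExp (omega2 ρ x₁ x₂) ζ - c * starOne ζ := by
      funext ζ
      simp only [Q]
      ring
    funext η
    rw [hQ', ← omega2_equation h h12 hx₁ hx₂ hx η, mul_div_cancel₀ _ hx]
  have hGconv : AbsConv (res Λ (dOp {x₁, x₂} (truncated ρ))) := by
    rw [hG, res_const_mul, res_starMul, res_starMul]
    exact ((hQ.starMul hN₁).starMul hN₂).const_mul _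
  have hGexp : expansion (res Λ (dOp {x₁, x₂} (truncated ρ))) = ρ {x₁, x₂} *
      ((Real.exp (expansion (res Λ (omega2 ρ x₁ x₂))) - c) *
        Real.exp (expansion (res Λ (omega1 ρ x₁))) *
          Real.exp (expansion (res Λ (omega1 ρ x₂)))) := by
    rw [hG, res_const_mul, res_starMul, res_starMul, expansion_const_mul,
      (hQ.starMul hN₁).expansion_starMul hN₂, hQ.expansion_starMul hN₁, hQexp,
      expansion_res_normD h hm hx₁ hω₁, expansion_res_normD h hm hx₂ hω₂]
  rw [(eqOff_dOp_pair h h12).res.expansion_eq, res_add, res_starMul, res_starMul, res_starMul,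
    ((hρ.starMul hT₁).starMul hT₂).expansion_add (hρ.starMul hGconv),
    (hρ.starMul hT₁).expansion_starMul hT₂, hρ.expansion_starMul hT₁,
    hρ.expansion_starMul hGconv, hGexp, expansion_res_truncated_singleton h hm hx₁ hω₁,
    expansion_res_truncated_singleton h hm hx₂ hω₂]
  -- The contribution of `- c 𝟙` cancels the product of the two one-point expansions exactly.
  have hcc : ρ {x₁, x₂} * c = ρ {x₁} * ρ {x₂} := by rw [hc, mul_div_cancel₀ _ hx]
  linear_combination (-(expansion (res Λ ρ) * Real.exp (expansion (res Λ (omega1 ρ x₁))) *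
    Real.exp (expansion (res Λ (omega1 ρ x₂))))) * hcc

end Region

end InverseGibbs

end

/-! ### The theorem: smallness constant and infinite-volume limit. -/

theorem theorem3p1 (d : ℕ) (hd : 1 ≤ d) (M A r dr : ℝ) (hM : 0 < M) (hA : 0 < A) (hr : 0 < r) :
    ∃ D₀ : ℝ, 0 < D₀ ∧
      ∀ (μ : ℝ) (H : Finset (Space d) → EReal) (P : Measure (Configuration d))
        (D : ℝ) (ρ : Finset (Space d) → ℝ),
        IsProbabilityMeasure P → IsHamiltonian H → IsGibbs μ H P → TranslationInvariant P →
        RuelleBound μ H P → ρ = rho μ H P →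
        AssumptionA μ H P → 0 < D → D ≤ D₀ → AssumptionB ρ M A D → AssumptionC ρ r dr →
        -- the density is constant
        (∀ x : Space d, ρ {x} = ρ {0}) ∧
        -- `ρ_T`, `ω_x` and `ω_{x₁,x₂}` satisfy the equations by which they are defined
        truncated ρ ∅ = 0 ∧ ρ = starExp (truncated ρ) ∧
        (∀ x : Space d, omega1 ρ x ∅ = 0) ∧
        (∀ (x : Space d) (η : Finset (Space d)),
          dOp {x} (truncated ρ) η / ρ {x} = starExp (omega1 ρ x) η) ∧
        (∀ x₁ x₂ : Space d, r ≤ dist x₁ x₂ → omega2 ρ x₁ x₂ ∅ = 0) ∧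
        (∀ x₁ x₂ : Space d, r ≤ dist x₁ x₂ → ∀ η : Finset (Space d),
          dOp {x₁, x₂} (truncated ρ) η / ρ {x₁, x₂} =
            starMul (starMul
              (fun ζ => starExp (omega2 ρ x₁ x₂) ζ -
                ρ {x₁} * ρ {x₂} / ρ {x₁, x₂} * starOne ζ)
              (fun ζ => dOp {x₁} (truncated ρ) ζ / ρ {x₁}))
              (fun ζ => dOp {x₂} (truncated ρ) ζ / ρ {x₂}) η) ∧
        -- the expansion of the chemical potential
        ((∀ k : ℕ, 1 ≤ k → Integrable (fun y : Fin k → Space d => atPoints (omega1 ρ 0) y)) ∧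
          Summable (fun k : ℕ => expansionTerm (omega1 ρ 0) (k + 1)) ∧
          μ = Real.log (ρ {0}) + ∑' k : ℕ, expansionTerm (omega1 ρ 0) (k + 1)) ∧
        -- the expansion of the pair interaction
        (∀ x₁ x₂ : Space d, r ≤ dist x₁ x₂ →
          (∀ k : ℕ, 1 ≤ k → Integrable (fun y : Fin k → Space d => atPoints (omega2 ρ x₁ x₂) y)) ∧
          Summable (fun k : ℕ => expansionTerm (omega2 ρ x₁ x₂) (k + 1)) ∧
          H {x₁, x₂} =
            ((-Real.log (ρ {x₁, x₂} / ρ {0} ^ 2) -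
              ∑' k : ℕ, expansionTerm (omega2 ρ x₁ x₂) (k + 1) : ℝ) : EReal)) := by
  have hnt := nontrivial_space hd
  -- The smallness condition of `absConv_omega2` with `b = |dr|`. The absolute value keeps the
  -- constant positive whatever the sign of `dr`, and the lower bound on `ρ^(2)` persists since
  -- `ρ^(2) ≥ 0`.
  refine ⟨(8 + 8 * (M * A) + 64 * (M * A ^ 2 * (1 + |dr|)) + 48 * (M * A * (1 + |dr|)))⁻¹,
    by positivity, ?_⟩
  intro μ H P D ρ hP hH hG hTI hR hρ hA' hD hD₀ hB hC
  have hDb : D * (8 + 8 * (M * A) + 64 * (M * A ^ 2 * (1 + |dr|)) +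
      48 * (M * A * (1 + |dr|))) ≤ 1 :=
    (le_inv_mul_iff₀ (by positivity)).1 (by simpa using hD₀) |>.trans_eq' (mul_comm _ _)
  have h1 : ρ ∅ = 1 := by rw [hρ, rho, hG.correlation_empty hH, ENNReal.toReal_one]
  have hm : ∀ γ, AEMeas (dOp γ ρ) := fun γ => hρ ▸ aemeas_dOp_rho hH γ
  have hconst : ∀ x : Space d, ρ {x} = ρ {0} := fun x => by
    rw [hρ, rho, rho, hG.correlation_singleton hH hTI]
  have hpos := hC.1
  have hpair : ∀ x₁ x₂ : Space d, r ≤ dist x₁ x₂ →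
      x₁ ≠ x₂ ∧ 0 < ρ {x₁, x₂} ∧ ρ {x₁} * ρ {x₂} ≤ |dr| * ρ {x₁, x₂} := by
    intro x₁ x₂ hx
    have hne : x₁ ≠ x₂ := dist_pos.1 (hr.trans_le hx)
    have h0 : 0 ≤ ρ {x₁, x₂} := by rw [hρ]; exact ENNReal.toReal_nonneg
    have hle : ρ {x₁} * ρ {x₂} ≤ |dr| * ρ {x₁, x₂} :=
      (hC.2 x₁ x₂ hx).trans (mul_le_mul_of_nonneg_right (le_abs_self dr) h0)
    refine ⟨hne, h0.lt_of_ne fun h => ?_, hle⟩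
    rw [← h, mul_zero] at hle
    exact absurd hle (not_le.2 (mul_pos (hpos x₁) (hpos x₂)))
  have hω₁ : ∀ x, AbsConv (omega1 ρ x) := by
    intro x
    have p1 : 0 < D * (M * A) := by positivity
    have p2 : 0 < D * (M * A ^ 2 * (1 + |dr|)) := by positivity
    have p3 : 0 < D * (M * A * (1 + |dr|)) := by positivity
    refine absConv_omega1 h1 hm (hpos x).ne' ((tailNorm_normD_le hM hA hD (by nlinarith) hB
      (hpos x)).trans ?_)
    rw [← ENNReal.ofReal_ofNat, ← ENNReal.ofReal_inv_of_pos (by norm_num)]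
    exact ENNReal.ofReal_le_ofReal (by nlinarith)
  have hω₂ : ∀ x₁ x₂ : Space d, r ≤ dist x₁ x₂ → AbsConv (omega2 ρ x₁ x₂) := by
    intro x₁ x₂ hx
    obtain ⟨hne, h12, hle⟩ := hpair x₁ x₂ hx
    exact absConv_omega2 h1 hm hM hA hD hB hne (hpos x₁) (hpos x₂) h12 hle hDb
  obtain ⟨Λ, hmono, hbdd, hmeas, hU, hlim⟩ := hA'
  -- The expansion of `ρ` itself is needed only in bounded regions, because it cancels from the
  -- quotients before the limit is taken.
  have hρΛ : ∀ i, AbsConv (res (Λ i) ρ) := fun i => by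
    have := absConv_res_dOp_rho hH hG hR (hbdd i) (hmeas i) ∅
    rwa [dOp_empty, ← hρ] at this
  have hj : ∀ i γ, janossy μ H P (Λ i) γ = expansion (res (Λ i) (dOp γ ρ)) := fun i γ => by
    rw [hρ]
    exact janossy_eq_expansion hH hG hR (hbdd i) (hmeas i) γ
  have hj0 : ∀ i, janossy μ H P (Λ i) ∅ = expansion (res (Λ i) ρ) := fun i => by
    rw [hj, dOp_empty]
  have hratio : ∀ (n : ℕ) (x : Finset (Space d)), n = 1 ∨ n = 2 → x.card = n →
      Tendsto (fun i => janossy μ H P (Λ i) x / janossy μ H P (Λ i) ∅) atTop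
        (𝓝 (EReal.exp (((n * μ : ℝ) : EReal) - H x)).toReal) := fun n x hn hx =>
    (hlim n hn x x.finite_toSet.isBounded).tendsto_at ⟨hx, subset_rfl⟩
  have hratio₁ : ∀ x : Space d, Tendsto (fun i => janossy μ H P (Λ i) {x} /
      janossy μ H P (Λ i) ∅) atTop (𝓝 (Real.exp μ)) := by
    intro x
    have := hratio 1 {x} (Or.inl rfl) (Finset.card_singleton x)
    rwa [hH.singleton, sub_zero, EReal.exp_coe, ENNReal.toReal_ofReal (Real.exp_pos _).le,
      Nat.cast_one, one_mul] at this
  -- A vanishing denominator would make the quotient `0` by convention, but the quotients converge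
  -- to `e^μ > 0`. Hence the cancellation of the empty Janossy density is eventually legitimate.
  have hj0ne : ∀ᶠ i in atTop, expansion (res (Λ i) ρ) ≠ 0 := by
    filter_upwards [(hratio₁ 0).eventually_ne (Real.exp_pos μ).ne'] with i hi h
    rw [hj0, h, div_zero] at hi
    exact hi rfl
  have hexpμ : ∀ x : Space d, Real.exp μ = ρ {x} * Real.exp (expansion (omega1 ρ x)) := by
    intro x
    have ht := (hω₁ x).tendsto_expansion_res hmono hmeas hU
    refine tendsto_nhds_unique (hratio₁ x)
      ((((Real.continuous_exp.tendsto _).comp ht).const_mul (ρ {x})).congr' ?_)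
    filter_upwards [hj0ne] with i hi
    rw [hj0, hj, expansion_res_dOp_singleton h1 (hmeas i) (hρΛ i) (hpos x).ne' (hω₁ x),
      mul_div_cancel_left₀ _ hi]
    rfl
  refine ⟨hconst, truncated_empty h1, (starExp_truncated h1).symm,
    fun x => omega1_empty h1 (hpos x).ne', fun x η => ?_, fun x₁ x₂ hx => ?_,
    fun x₁ x₂ hx η => ?_, ⟨fun k _ => (hω₁ 0).integrable k, ?_, ?_⟩,
    fun x₁ x₂ hx => ⟨fun k _ => (hω₂ x₁ x₂ hx).integrable k, ?_, ?_⟩⟩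
  · rw [starExp_omega1 h1 (hpos x).ne']
    rfl
  · obtain ⟨hne, h12, -⟩ := hpair x₁ x₂ hx
    exact omega2_empty h1 hne (hpos x₁).ne' (hpos x₂).ne' h12.ne'
  · obtain ⟨hne, h12, -⟩ := hpair x₁ x₂ hx
    exact omega2_equation h1 hne (hpos x₁).ne' (hpos x₂).ne' h12.ne' η
  · exact (summable_nat_add_iff 1).2 (hω₁ 0).summable
  · have h := congrArg Real.log (hexpμ 0)
    rwa [Real.log_exp, Real.log_mul (hpos 0).ne' (Real.exp_pos _).ne', Real.log_exp,
      (hω₁ 0).expansion_eq_add, omega1_empty h1 (hpos 0).ne', zero_add] at h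
  · exact (summable_nat_add_iff 1).2 (hω₂ x₁ x₂ hx).summable
  · obtain ⟨hne, h12, -⟩ := hpair x₁ x₂ hx
    have hω := hω₂ x₁ x₂ hx
    have hlim₂ : (EReal.exp (((((2 : ℕ) : ℝ) * μ : ℝ) : EReal) - H {x₁, x₂})).toReal =
        ρ {x₁, x₂} * Real.exp (expansion (omega2 ρ x₁ x₂)) *
          (Real.exp (expansion (omega1 ρ x₁)) * Real.exp (expansion (omega1 ρ x₂))) := by
      have hexp : ∀ {F : Finset (Space d) → ℝ}, AbsConv F →
          Tendsto (fun i => Real.exp (expansion (res (Λ i) F))) atTop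
            (𝓝 (Real.exp (expansion F))) := fun hF =>
        (Real.continuous_exp.tendsto _).comp (hF.tendsto_expansion_res hmono hmeas hU)
      refine tendsto_nhds_unique (hratio 2 {x₁, x₂} (Or.inr rfl) (Finset.card_pair hne))
        ((((hexp hω).const_mul (ρ {x₁, x₂})).mul ((hexp (hω₁ x₁)).mul (hexp (hω₁ x₂)))).congr' ?_)
      filter_upwards [hj0ne] with i hi
      rw [hj0, hj, expansion_res_dOp_pair h1 (hmeas i) (hρΛ i) hne (hpos x₁).ne' (hpos x₂).ne'
        h12.ne' (hω₁ x₁) (hω₁ x₂) hω, mul_div_cancel_left₀ _ hi]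
    -- An infinite energy would make the limit zero, whereas the expansion gives a positive number.
    have hHtop : H {x₁, x₂} ≠ ⊤ := by
      intro htop
      rw [htop, ereal_coe_sub_top, EReal.exp_bot, ENNReal.toReal_zero] at hlim₂
      have : 0 < ρ {x₁, x₂} * Real.exp (expansion (omega2 ρ x₁ x₂)) *
          (Real.exp (expansion (omega1 ρ x₁)) * Real.exp (expansion (omega1 ρ x₂))) := by
        positivity
      exact this.ne hlim₂
    lift H {x₁, x₂} to ℝ using ⟨hHtop, hH.ne_bot _⟩ with e
    rw [← EReal.coe_sub, EReal.exp_coe, ENNReal.toReal_ofReal (Real.exp_pos _).le] at hlim₂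
    -- By the one-point identity and the constant density, each one-point expansion equals `μ - log
    -- ρ`. The two of them cancel `2 μ` and turn `log ρ^(2)` into `log (ρ^(2) / ρ^2)`.
    have hlog : ∀ x : Space d, expansion (omega1 ρ x) = μ - Real.log (ρ {0}) := fun x => by
      have h := congrArg Real.log (hexpμ x)
      rw [Real.log_exp, Real.log_mul (hpos x).ne' (Real.exp_pos _).ne', Real.log_exp,
        hconst x] at h
      linarith
    have h := congrArg Real.log hlim₂
    rw [Real.log_exp, Real.log_mul (by positivity) (by positivity),
      Real.log_mul h12.ne' (by positivity), Real.log_mul (by positivity) (by positivity),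
      Real.log_exp, Real.log_exp, Real.log_exp, hlog, hlog, hω.expansion_eq_add,
      omega2_empty h1 hne (hpos x₁).ne' (hpos x₂).ne' h12.ne', zero_add] at h
    have h0 := (hpos 0).ne'
    have : e = -Real.log (ρ {x₁, x₂} / ρ {0} ^ 2) -
        ∑' k : ℕ, expansionTerm (omega2 ρ x₁ x₂) (k + 1) := by
      rw [Real.log_div h12.ne' (pow_ne_zero 2 h0), Real.log_pow]
      push_cast at h ⊢
      linarith
    rw [this]
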